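/- **Setting.** Let $T>0$, $\Omega=(-1,1)$, $Q=(0,T)\times\Omega$, let $\omega\subset\Omega$ be nonempty and measurable, $\omega_T=(0,T)\times\omega$. Let $a\in C^1([-1,1])$ with $a>0$ in $(-1,1)$, $a(\pm1)=0$ and $x\mapsto\int_0^x \frac{ds}{a(s)}\in L^1(-1,1)$. Let $\alpha>0$, $m<M$ be real numbers and $y^0,y^d\in L^\infty(\Omega)$. Let $H^1_a(\Omega)$ be the space of $u\in L^2(\Omega)$ that are locally absolutely continuous in $\Omega$ with $\sqrt a\,u_x\in L^2(\Omega)$, with norm $\|u\|^2=\|u\|_{L^2}^2+\|\sqrt a\,u_x\|_{L^2}^2$, and let $W_a(0,T)=\{\rho\in L^2((0,T);H^1_a(\Omega)):\rho_t\in L^2((0,T);(H^1_a(\Omega))')\}$. Let $H(Q)$ be the set of $\phi\in L^2((0,T);H^1_a(\Omega))$ with $\phi_t\in L^2(Q)$. For $v\in L^\infty(\omega_T)$ and $p^0\in L^2(\Omega)$, a weak solution of $$p_t-(a p_x)_x=v\chi_\omega p\ \text{in }Q,\qquad a p_x|_{x=\pm1}=0,\qquad p(0,\cdot)=p^0$$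 is a $p\in W_a(0,T)$ with $-\int_Q\phi_t p+\int_Q a p_x\phi_x-\int_{\omega_T}vp\phi=\int_\Omega p^0\phi(0,\cdot)$ for all $\phi\in H(Q)$ with $\phi(T,\cdot)=0$. A weak solution of the backward problem $$-q_t-(a q_x)_x=v\chi_\omega q\ \text{in }Q,\qquad a q_x|_{x=\pm1}=0,\qquad q(T,\cdot)=q_T$$ is a $q\in W_a(0,T)$ with $\int_Q\phi_t q+\int_Q a q_x\phi_x-\int_{\omega_T}vq\phi=\int_\Omega q_T\phi(T,\cdot)$ for all $\phi\in H(Q)$ with $\phi(0,\cdot)=0$. Let $G(v)$ be the weak solution of the first problem with $p^0=y^0$, let $$\mathcal J(v)=\tfrac12\|G(v)(T)-y^d\|^2_{L^2(\Omega)}+\tfrac\alpha2\|v\|^2_{L^2(\omega_T)},\qquad \mathcal U=\{w\in L^\infty(\omega_T):m\le w\le M\text{ a.e.}\},$$ and call $u\in\mathcal U$ an $L^\infty$-local minimum if for some $\varepsilon>0$ one has $\mathcal J(u)\le\mathcal J(v)$ for all $v\in\mathcal U$ with $\|v-u\|_{L^\infty(\omega_T)}<\varepsilon$. **Theorem (first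 order necessary optimality conditions).** These objects are well defined: every $\rho\in W_a(0,T)$ has a representative in $C([0,T];L^2(\Omega))$, and for every $v\in L^\infty(\omega_T)$ the state $G(v)$ exists and is unique. Let $u\in\mathcal U$. Then $\mathcal J:L^\infty(\omega_T)\to\mathbb R$ is Fréchet differentiable at $u$, and if $u$ is an $L^\infty$-local minimum, then $$\mathcal J'(u)(v-u)\ge0\qquad\forall v\in\mathcal U. \tag{1}$$ Moreover there are $y,q\in W_a(0,T)\cap L^\infty(Q)$ such that $y$ is the weak solution of the state equation with control $u$ and $y(0,\cdot)=y^0$, $q$ is a weak solution of the backward problem with $v=u$ and $q(T,\cdot)=y(T,\cdot)-y^d$, and $$\mathcal J'(u)w=\int_{\omega_T}(\alpha u+yq)\,w\,dx\,dt\qquad\forall w\in L^\infty(\omega_T).$$ Condition (1) is equivalent to $$\int_{\omega_T}(\alpha u+yq)(v-u)\,dx\,dt\ge0\qquad\forall v\in\mathcal U, \tag{2}$$ and (2) is equivalent to $$u=\min\Bigl(\max\Bigl(m,-\frac{q}{\alpha}\,y\Bigr),M\Bigr)\quad\text{a.e. in }\omega_T. \tag{3}$$ In particular, if $u$ is an $L^\infty$-local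 minimum, then (1), (2) and (3) hold. -/

import Mathlib

open MeasureTheory Set
open scoped ENNReal

noncomputable section

namespace DegenerateControl

/-- Lebesgue measure on the spatial domain `Ω = (-1, 1)`. -/
abbrev muOmega : Measure ℝ := volume.restrict (Ioo (-1) 1)

/-- `L²(Ω)`. -/
abbrev L2Omega : Type := Lp ℝ 2 muOmega

/-- Lebesgue measure on the time interval `(0, T)`. -/
abbrev muTime (T : ℝ) : Measure ℝ := volume.restrict (Ioo 0 T)

/-- Lebesgue measure on `Q = (0, T) × Ω`; points are written `(t, x)`. -/
abbrev muQ (T : ℝ) : Measure (ℝ × ℝ) := volume.restrict (Ioo 0 T ×ˢ Ioo (-1) 1)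

/-- Lebesgue measure on `ω_T = (0, T) × ω`. -/
abbrev muControl (T : ℝ) (ω : Set ℝ) : Measure (ℝ × ℝ) := volume.restrict (Ioo 0 T ×ˢ ω)

/-- The control space `L^∞(ω_T)`. -/
abbrev Control (T : ℝ) (ω : Set ℝ) : Type := Lp ℝ ∞ (muControl T ω)

/-- The assumptions on the (strongly degenerate) diffusion coefficient. -/
structure IsDegenerateCoefficient (a : ℝ → ℝ) : Prop where
  contDiffOn : ContDiffOn ℝ 1 a (Icc (-1) 1)
  pos : ∀ x ∈ Ioo (-1 : ℝ) 1, 0 < a x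
  left : a (-1) = 0
  right : a 1 = 0
  integrable : IntegrableOn (fun x => ∫ s in (0 : ℝ)..x, 1 / a s) (Ioo (-1) 1)

/-- `g = √a · u_x`, where `u` is (a.e. equal to) a function which is locally absolutely continuous
in `Ω`, with a.e. derivative `u_x`. -/
def IsWeightedDeriv (a : ℝ → ℝ) (u g : ℝ → ℝ) : Prop :=
  ∃ f f' : ℝ → ℝ,
    (∀ c d : ℝ, -1 < c → c ≤ d → d < 1 → AbsolutelyContinuousOnInterval f c d) ∧
    (∀ᵐ x ∂muOmega, HasDerivAt f (f' x) x) ∧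
    u =ᵐ[muOmega] f ∧
    g =ᵐ[muOmega] fun x => √(a x) * f' x

/-- The weighted Sobolev space `H¹_a(Ω)`. A function `u` in it is recorded by the pair
`(u, √a u_x) ∈ L²(Ω) × L²(Ω)`, so that the Hilbertian product norm inherited by this subspace is
`‖u‖² = ‖u‖²_{L²} + ‖√a u_x‖²_{L²}`. The second entry is determined by the first. -/
def H1a (a : ℝ → ℝ) : Submodule ℝ (WithLp 2 (L2Omega × L2Omega)) where
  carrier := {p | IsWeightedDeriv a p.fst p.snd}
  zero_mem' := by
    refine ⟨fun _ => 0, fun _ => 0, ?_, ?_, ?_, ?_⟩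
    · intro c d _ _ _
      simpa using AbsolutelyContinuousOnInterval.const_mul (f := fun x : ℝ => x) 0
        ((LipschitzWith.id.lipschitzOnWith
          (s := uIcc c d)).absolutelyContinuousOnInterval)
    · exact Filter.Eventually.of_forall fun x => hasDerivAt_const x (0 : ℝ)
    · exact Lp.coeFn_zero ℝ 2 muOmega
    · filter_upwards [Lp.coeFn_zero ℝ 2 muOmega] with x hx
      simpa using hx
  add_mem' := by
    rintro p q ⟨f, f', hf, hf', hu, hg⟩ ⟨k, k', hk, hk', hv, hh⟩
    refine ⟨f + k, f' + k', ?_, ?_, ?_, ?_⟩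
    · intro c d h1 h2 h3
      exact (hf c d h1 h2 h3).add (hk c d h1 h2 h3)
    · filter_upwards [hf', hk'] with x h1 h2 using h1.add h2
    · filter_upwards [Lp.coeFn_add p.fst q.fst, hu, hv] with x h1 h2 h3
      rw [WithLp.add_fst, h1, Pi.add_apply, h2, h3, Pi.add_apply]
    · filter_upwards [Lp.coeFn_add p.snd q.snd, hg, hh] with x h1 h2 h3
      rw [WithLp.add_snd, h1, Pi.add_apply, h2, h3, Pi.add_apply]
      ring
  smul_mem' := by
    rintro c p ⟨f, f', hf, hf', hu, hg⟩
    refine ⟨fun x => c * f x, fun x => c * f' x, ?_, ?_, ?_, ?_⟩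
    · intro r s h1 h2 h3
      exact (hf r s h1 h2 h3).const_mul c
    · filter_upwards [hf'] with x h1 using h1.const_mul c
    · filter_upwards [Lp.coeFn_smul c p.fst, hu] with x h1 h2
      rw [WithLp.smul_fst, h1, Pi.smul_apply, h2, smul_eq_mul]
    · filter_upwards [Lp.coeFn_smul c p.snd, hg] with x h1 h2
      rw [WithLp.smul_snd, h1, Pi.smul_apply, h2, smul_eq_mul]
      ring

/-- The inclusion `H¹_a(Ω) → L²(Ω)`. -/
def toL2 {a : ℝ → ℝ} (u : H1a a) : L2Omega := (u : WithLp 2 (L2Omega × L2Omega)).fst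

/-- The weighted derivative `√a u_x ∈ L²(Ω)` of `u ∈ H¹_a(Ω)`. -/
def wderiv {a : ℝ → ℝ} (u : H1a a) : L2Omega := (u : WithLp 2 (L2Omega × L2Omega)).snd

/-- `toL2` as a continuous linear map. -/
def toL2L (a : ℝ → ℝ) : H1a a →L[ℝ] L2Omega :=
  LinearMap.mkContinuous
    ((WithLp.fstₗ 2 ℝ L2Omega L2Omega).comp (H1a a).subtype) 1 (by
      intro u
      have h := WithLp.prod_norm_sq_eq_of_L2 (u : WithLp 2 (L2Omega × L2Omega))
      rw [one_mul]
      refine abs_le_of_sq_le_sq' ?_ (norm_nonneg _) |>.2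
      change ‖(u : WithLp 2 (L2Omega × L2Omega)).fst‖ ^ 2
        ≤ ‖(u : WithLp 2 (L2Omega × L2Omega))‖ ^ 2
      nlinarith [sq_nonneg ‖(u : WithLp 2 (L2Omega × L2Omega)).snd‖])

/-- The canonical map `H¹_a(Ω) ↪ L²(Ω) ↪ (H¹_a(Ω))'`, that is `u ↦ (h ↦ ∫_Ω u h dx)`. -/
def toDual {a : ℝ → ℝ} (u : H1a a) : StrongDual ℝ (H1a a) :=
  (innerSL ℝ (toL2 u)).comp (toL2L a)

/-- `L²((0,T); H¹_a(Ω))`. -/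
abbrev L2H1a (T : ℝ) (a : ℝ → ℝ) : Type := Lp (H1a a) 2 (muTime T)

/-- `L²((0,T); (H¹_a(Ω))')`. -/
abbrev L2Dual (T : ℝ) (a : ℝ → ℝ) : Type := Lp (StrongDual ℝ (H1a a)) 2 (muTime T)

/-- `L²(Q) = L²((0,T); L²(Ω))`. -/
abbrev L2Q (T : ℝ) : Type := Lp L2Omega 2 (muTime T)

/-- `g` is the derivative of `f` on `(0,T)` in the sense of vector-valued distributions. -/
def IsTimeDeriv (T : ℝ) {E : Type*} [NormedAddCommGroup E] [NormedSpace ℝ E]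
    (f g : ℝ → E) : Prop :=
  ∀ ψ : ℝ → ℝ, ContDiff ℝ (⊤ : ℕ∞) ψ → HasCompactSupport ψ → tsupport ψ ⊆ Ioo 0 T →
    ∫ t in Ioo 0 T, deriv ψ t • f t = -∫ t in Ioo 0 T, ψ t • g t

/-- `W_a(0,T) = {ρ ∈ L²((0,T); H¹_a(Ω)) : ρ_t ∈ L²((0,T); (H¹_a(Ω))')}`. -/
def Wa (T : ℝ) (a : ℝ → ℝ) : Set (L2H1a T a) :=
  {ρ | ∃ g : L2Dual T a, IsTimeDeriv T (fun t => toDual (ρ t)) g}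

/-- `r` is a representative of `ρ` belonging to `C([0,T]; L²(Ω))`. -/
def IsContinuousRep {T : ℝ} {a : ℝ → ℝ} (ρ : L2H1a T a) (r : ℝ → L2Omega) : Prop :=
  ContinuousOn r (Icc 0 T) ∧ ∀ᵐ t ∂muTime T, r t = toL2 (ρ t)

open Classical in
/-- The value `ρ(t, ·) ∈ L²(Ω)` at the time `t ∈ [0,T]` of the representative of `ρ` in
`C([0,T]; L²(Ω))` (and zero if there is no such representative). -/
def valueAt {T : ℝ} {a : ℝ → ℝ} (ρ : L2H1a T a) (t : ℝ) : L2Omega :=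
  if h : ∃ r, IsContinuousRep ρ r then h.choose t else 0

/-- `φ ∈ L²((0,T); H¹_a(Ω))` has the time derivative `φ_t = φ' ∈ L²(Q)`. -/
def HasL2TimeDeriv {T : ℝ} {a : ℝ → ℝ} (φ : L2H1a T a) (φ' : L2Q T) : Prop :=
  IsTimeDeriv T (fun t => toL2 (φ t)) φ'

/-- `∫_Q φ' p dx dt + ∫_Q a p_x φ_x dx dt - ∫_{ω_T} v p φ dx dt`, written with iterated
integrals. -/
def spaceTimeForm {T : ℝ} {a : ℝ → ℝ} {ω : Set ℝ} (v : Control T ω) (p φ : L2H1a T a)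
    (φ' : ℝ → L2Omega) : ℝ :=
  (∫ t in Ioo 0 T, ∫ x in Ioo (-1) 1, φ' t x * toL2 (p t) x)
    + (∫ t in Ioo 0 T, ∫ x in Ioo (-1) 1, wderiv (p t) x * wderiv (φ t) x)
    - ∫ t in Ioo 0 T, ∫ x in ω, v (t, x) * toL2 (p t) x * toL2 (φ t) x

/-- `p ∈ W_a(0,T)` is a weak solution of
`p_t - (a p_x)_x = v χ_ω p` in `Q`, `a p_x = 0` at `x = ±1`, `p(0, ·) = p₀`:
for all `φ ∈ L²((0,T); H¹_a(Ω))` with `φ_t ∈ L²(Q)` and `φ(T, ·) = 0`,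
`-∫_Q φ_t p + ∫_Q a p_x φ_x - ∫_{ω_T} v p φ = ∫_Ω p₀ φ(0, ·)`. -/
def IsWeakSolution {T : ℝ} {a : ℝ → ℝ} {ω : Set ℝ} (v : Control T ω) (p₀ : L2Omega)
    (p : L2H1a T a) : Prop :=
  p ∈ Wa T a ∧
  ∀ (φ : L2H1a T a) (φ' : L2Q T), HasL2TimeDeriv φ φ' → valueAt φ T = 0 →
    spaceTimeForm v p φ (fun t => -φ' t) = ∫ x in Ioo (-1) 1, p₀ x * valueAt φ 0 x

/-- `q ∈ W_a(0,T)` is a weak solution of the backward problem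
`-q_t - (a q_x)_x = v χ_ω q` in `Q`, `a q_x = 0` at `x = ±1`, `q(T, ·) = q_T`:
for all `φ ∈ L²((0,T); H¹_a(Ω))` with `φ_t ∈ L²(Q)` and `φ(0, ·) = 0`,
`∫_Q φ_t q + ∫_Q a q_x φ_x - ∫_{ω_T} v q φ = ∫_Ω q_T φ(T, ·)`. -/
def IsBackwardWeakSolution {T : ℝ} {a : ℝ → ℝ} {ω : Set ℝ} (v : Control T ω) (qT : L2Omega)
    (q : L2H1a T a) : Prop :=
  q ∈ Wa T a ∧
  ∀ (φ : L2H1a T a) (φ' : L2Q T), HasL2TimeDeriv φ φ' → valueAt φ 0 = 0 →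
    spaceTimeForm v q φ φ' = ∫ x in Ioo (-1) 1, qT x * valueAt φ T x

open Classical in
/-- The control-to-state map `G`: `G(v)` is the weak solution of the state equation with control
`v` and initial datum `y₀` (and zero if there is none). -/
def stateMap {T : ℝ} (a : ℝ → ℝ) {ω : Set ℝ} (y₀ : L2Omega) (v : Control T ω) : L2H1a T a :=
  if h : ∃ y : L2H1a T a, IsWeakSolution v y₀ y then h.choose else 0

/-- The reduced cost functional
`𝒥(v) = 1/2 ‖G(v)(T) - y^d‖²_{L²(Ω)} + α/2 ‖v‖²_{L²(ω_T)}`. -/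
def cost {T : ℝ} (a : ℝ → ℝ) {ω : Set ℝ} (α : ℝ) (y₀ yd : L2Omega) (v : Control T ω) : ℝ :=
  1 / 2 * ‖valueAt (stateMap a y₀ v) T - yd‖ ^ 2
    + α / 2 * ∫ z in Ioo 0 T ×ˢ ω, v z ^ 2

/-- The set `𝒰` of admissible controls. -/
def admissible (T : ℝ) (ω : Set ℝ) (m M : ℝ) : Set (Control T ω) :=
  {w | ∀ᵐ z ∂muControl T ω, m ≤ w z ∧ w z ≤ M}

/-- `u` is an `L^∞`-local minimum of `𝒥` over `𝒰`. -/
def IsLinftyLocalMin {T : ℝ} (a : ℝ → ℝ) {ω : Set ℝ} (α m M : ℝ) (y₀ yd : L2Omega)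
    (u : Control T ω) : Prop :=
  u ∈ admissible T ω m M ∧
  ∃ ε > 0, ∀ v ∈ admissible T ω m M, ‖v - u‖ < ε → cost a α y₀ yd u ≤ cost a α y₀ yd v

/-- The function `Y ∈ L^∞(Q)` is the one given by `ρ ∈ L²((0,T); H¹_a(Ω))`; thus
`∃ Y, IsLinftyRep ρ Y` says that `ρ ∈ L^∞(Q)`. -/
def IsLinftyRep {T : ℝ} {a : ℝ → ℝ} (ρ : L2H1a T a) (Y : Lp ℝ ∞ (muQ T)) : Prop :=
  ∀ᵐ t ∂muTime T, toL2 (ρ t) =ᵐ[muOmega] fun x => Y (t, x)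

end DegenerateControl

end

/-!
The state equation is treated abstractly, for Hilbert spaces `V ⊂ H` and an operator `D : V → K`
with `‖u‖_V² = ‖u‖_H² + ‖D u‖²` (`FormTriple`); the operator of the equation is `A = D* D`, and the
concrete case is `V = H¹_a(Ω)`, `H = K = L²(Ω)`, `D u = √a u_x`
(`IsDegenerateCoefficient.triple`). No compactness and no regularity theory is used: the one
analytic tool is smoothing by the resolvents `R_n = (1 + ε_n A)⁻¹`, which map `V'` to `V`, are
contractions of `H` and of `V`, commute with `A`, and converge strongly to the identity. A curve
`ρ ∈ L²(0,T;V)` with `ρ' ∈ L²(0,T;V')` becomes an absolutely continuous curve `R_n ρ` in `H`, for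
which the chain rule holds, and one then lets `n → ∞`. Three facts are obtained this way:

* `ρ` has a representative in `C([0,T];H)` (`exists_evolves`);
* integration by parts `∫ ⟨ρ', σ⟩ + ⟨σ', ρ⟩ = ⟪ρ(T), σ(T)⟫ - ⟪ρ(0), σ(0)⟫`
  (`Evolves.integral_pairing`);
* the truncation inequality for `‖(ρ - k)⁺‖²` (`Solves.truncation`).

Integration by parts identifies weak solutions with solutions of `ρ' + A ρ = f` (`Solves`), for
which an energy estimate gives uniqueness and continuous dependence (`Solves.norm_sq_le`,
`Solves.eqOn`). Existence comes from the projection theorem of Lions, applied to `C¹` test curves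
with an exponential weight in time (`exists_solves`). The truncation inequality, with `k` growing
exponentially in time, is the maximum principle: solutions with bounded initial values are bounded
(`Solves.ae_abs_le`). Backward problems are reduced to forward ones by time reversal.

For the derivative of the cost, let `δ = G(u + w) - G(u)`, and let `q` be the adjoint state, with
`q(T) = y(T) - y^d`. The energy estimate yields `‖δ‖_{C([0,T];H)} ≤ C ‖w‖`
(`exists_state_lipschitz`). Integrating the pairing of `δ` with `q` by parts cancels all terms but
`⟪δ(T), q(T)⟫ = ∫ w G(u + w) q` (`inner_sub_final`), whence `𝒥(u + w) - 𝒥(u)` equals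
`∫ (α u + y q) w` up to `O(‖w‖²)` (`hasFDerivAt_cost`). The variational inequality is then the usual
first order condition on a convex set, and it is equivalent to the projection formula because
`α u + y q = α (u - p)` with `p = -(q / α) y`: testing with the pointwise projection of `p` onto
`[m, M]` makes the integrand at most `-α (v - u)²` (`variational_iff_projection`).
-/

noncomputable section

namespace DegenerateControl

open Filter Topology
open scoped NNReal

section

/-! ### Primitives of vector-valued integrable functions -/

section Primitive

variable {E : Type*} [NormedAddCommGroup E] [NormedSpace ℝ E]

/-- A curve whose increments are dominated by those of an absolutely continuous function is
absolutely continuous. This transfers the scalar theory to primitives with values in a Banach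
space, and to compositions with Lipschitz functions. -/
theorem _root_.AbsolutelyContinuousOnInterval.of_dist_le {X : Type*} [PseudoMetricSpace X]
    {u : ℝ → X} {N : ℝ → ℝ} {a b C : ℝ} (hN : AbsolutelyContinuousOnInterval N a b)
    (h : ∀ x ∈ uIcc a b, ∀ y ∈ uIcc a b, dist (u x) (u y) ≤ C * dist (N x) (N y)) :
    AbsolutelyContinuousOnInterval u a b := by
  unfold AbsolutelyContinuousOnInterval at hN ⊢
  refine squeeze_zero' (Eventually.of_forall fun _ => Finset.sum_nonneg fun i _ => dist_nonneg) ?_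
    (by simpa using hN.const_mul C)
  rw [eventually_inf_principal]
  filter_upwards with I hI
  rw [Finset.mul_sum]
  exact Finset.sum_le_sum fun i hi => h _ (hI.1 i hi).1 _ (hI.1 i hi).2

theorem dist_primitive_le {f : ℝ → E} {a b : ℝ} (hf : IntervalIntegrable f volume a b) {x y : ℝ}
    (hx : x ∈ uIcc a b) (hy : y ∈ uIcc a b) :
    dist (∫ s in a..x, f s) (∫ s in a..y, f s)
      ≤ 1 * dist (∫ s in a..x, ‖f s‖) (∫ s in a..y, ‖f s‖) := by
  have hx' : IntervalIntegrable f volume a x := hf.mono_set (uIcc_subset_uIcc_left hx)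
  have hy' : IntervalIntegrable f volume a y := hf.mono_set (uIcc_subset_uIcc_left hy)
  rw [dist_eq_norm, Real.dist_eq, one_mul, intervalIntegral.integral_interval_sub_left hx' hy',
    intervalIntegral.integral_interval_sub_left hx'.norm hy'.norm]
  exact intervalIntegral.norm_integral_le_abs_integral_norm

theorem absolutelyContinuousOnInterval_primitive {f : ℝ → E} {a b : ℝ}
    (hf : IntervalIntegrable f volume a b) (c : E) :
    AbsolutelyContinuousOnInterval (fun x => c + ∫ s in a..x, f s) a b :=
  AbsolutelyContinuousOnInterval.of_dist_le (C := 1)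
    (hf.norm.absolutelyContinuousOnInterval_intervalIntegral left_mem_uIcc)
    fun x hx y hy => by rw [dist_add_left]; exact dist_primitive_le hf hx hy

/-- Fundamental theorem of calculus for an absolutely continuous curve in a Banach space whose
derivative exists almost everywhere. (In a general Banach space the existence of the derivative
is not automatic.) -/
theorem _root_.AbsolutelyContinuousOnInterval.integral_eq_sub [CompleteSpace E] {u f : ℝ → E}
    {a b : ℝ} (hu : AbsolutelyContinuousOnInterval u a b) (hf : IntervalIntegrable f volume a b)
    (hd : ∀ᵐ x, x ∈ uIcc a b → HasDerivAt u (f x) x) :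
    ∫ s in a..b, f s = u b - u a := by
  have hP := absolutelyContinuousOnInterval_primitive hf 0
  obtain ⟨C, hC⟩ := (hu.sub hP).const_of_ae_hasDerivAt_zero (by
    filter_upwards [hd, hf.ae_hasDerivAt_integral] with x h1 h2 hx
    simpa using (h1 hx).sub ((h2 hx a left_mem_uIcc).const_add (0 : E)))
  have h1 := hC a left_mem_uIcc
  have h2 := hC b right_mem_uIcc
  simp only [Pi.sub_apply, intervalIntegral.integral_same, zero_add, sub_zero] at h1 h2
  rw [h1, ← h2]; abel

/-- Chain rule along a primitive: no regularity of the integrand is needed beyond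
integrability. -/
theorem integral_fderiv_primitive [CompleteSpace E] {Φ : E → ℝ} {Φ' : E → E →L[ℝ] ℝ}
    (hΦ : ∀ x, HasFDerivAt Φ (Φ' x) x)
    (hL : ∀ R : ℝ, ∃ L : ℝ, ∀ x y : E, ‖x‖ ≤ R → ‖y‖ ≤ R → |Φ x - Φ y| ≤ L * ‖x - y‖)
    {f : ℝ → E} {a b : ℝ} (hf : IntervalIntegrable f volume a b) (c : E) {Z : ℝ → E}
    (hZ : ∀ t ∈ uIcc a b, Z t = c + ∫ s in a..t, f s) :
    IntervalIntegrable (fun s => Φ' (Z s) (f s)) volume a b ∧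
      ∫ s in a..b, Φ' (Z s) (f s) = Φ (Z b) - Φ (Z a) := by
  set W : ℝ → E := fun t => c + ∫ s in a..t, f s with hW
  have hWac : AbsolutelyContinuousOnInterval W a b := absolutelyContinuousOnInterval_primitive hf c
  obtain ⟨R, hR⟩ := hWac.exists_bound
  obtain ⟨L, hL⟩ := hL R
  have hac : AbsolutelyContinuousOnInterval (fun t => Φ (W t)) a b := by
    refine AbsolutelyContinuousOnInterval.of_dist_le (C := |L|)
      (hf.norm.absolutelyContinuousOnInterval_intervalIntegral left_mem_uIcc) fun x hx y hy => ?_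
    rw [Real.dist_eq]
    refine (hL _ _ (hR x hx) (hR y hy)).trans
      (mul_le_mul (le_abs_self L) ?_ (norm_nonneg _) (abs_nonneg _))
    rw [← dist_eq_norm, hW, dist_add_left]
    simpa using dist_primitive_le hf hx hy
  have hder : ∀ᵐ x, x ∈ uIcc a b → HasDerivAt (fun t => Φ (W t)) (Φ' (Z x) (f x)) x := by
    filter_upwards [hf.ae_hasDerivAt_integral] with x h2 hx
    rw [hZ x hx]
    exact (hΦ (W x)).comp_hasDerivAt x ((h2 hx a left_mem_uIcc).const_add c)
  have hint : IntervalIntegrable (fun s => Φ' (Z s) (f s)) volume a b := by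
    refine hac.intervalIntegrable_deriv.congr_ae ?_
    rw [EventuallyEq, ae_restrict_iff' measurableSet_uIoc]
    filter_upwards [hder] with x hx hx'
    exact (hx (uIoc_subset_uIcc hx')).deriv
  refine ⟨hint, ?_⟩
  rw [hac.integral_eq_sub hint hder, hZ b right_mem_uIcc, hZ a left_mem_uIcc]

end Primitive

/-! ### Integral form of the Grönwall inequality -/

theorem le_mul_exp_of_le_add_integral {u : ℝ → ℝ} {T c K : ℝ} (hu : ContinuousOn u (Icc 0 T))
    (hK : 0 ≤ K) (h : ∀ t ∈ Icc 0 T, u t ≤ c + K * ∫ s in (0 : ℝ)..t, u s) :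
    ∀ t ∈ Icc 0 T, u t ≤ c * Real.exp (K * t) := by
  intro t ht
  have hT : 0 ≤ T := ht.1.trans ht.2
  have hint : ∀ x ∈ Icc 0 T, IntervalIntegrable u volume 0 x := fun x hx =>
    (hu.mono (by rw [uIcc_of_le hx.1]; exact Icc_subset_Icc_right hx.2)).intervalIntegrable
  have hcont : ContinuousOn (fun x => c + K * ∫ s in (0 : ℝ)..x, u s) (Icc 0 T) := by
    refine continuousOn_const.add (continuousOn_const.mul ?_)
    have := intervalIntegral.continuousOn_primitive_interval (μ := volume) (f := u) (a := 0)
      (b := T) (by rw [uIcc_of_le hT]; exact hu.integrableOn_Icc)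
    rwa [uIcc_of_le hT] at this
  -- the right-hand side of the hypothesis is differentiable and satisfies the differential inequality
  have hmain := le_gronwallBound_of_liminf_deriv_right_le (f' := fun x => K * u x) (δ := c)
    (K := K) (ε := 0) hcont (fun x hx r hr => ?_) (by simp) (fun x hx => ?_) t ht
  · rw [gronwallBound_ε0, sub_zero] at hmain
    exact (h t ht).trans hmain
  · have hxT : x ∈ Icc 0 T := ⟨hx.1, hx.2.le⟩
    have hev : Icc x T ∈ 𝓝[>] x := by
      filter_upwards [Ioc_mem_nhdsGT hx.2] with y hy using ⟨hy.1.le, hy.2⟩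
    have hd : HasDerivWithinAt (fun y => ∫ s in (0 : ℝ)..y, u s) (u x) (Ici x) x := by
      refine intervalIntegral.integral_hasDerivWithinAt_right (hint x hxT) (t := Ioi x) ?_ ?_
      · refine ⟨Icc x T, hev, ?_⟩
        exact (hu.mono (Icc_subset_Icc_left hx.1)).aestronglyMeasurable measurableSet_Icc
      · exact ((hu x hxT).mono_of_mem_nhdsWithin (by
          filter_upwards [hev] with y hy using ⟨hx.1.trans hy.1, hy.2⟩))
    exact ((hd.const_mul K).const_add c).liminf_right_slope_le hr
  · rw [add_zero]
    exact mul_le_mul_of_nonneg_left (h x ⟨hx.1, hx.2.le⟩) hK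

/-! ### Distributional time derivatives and primitives -/

section TimeDeriv

variable {E : Type*} [NormedAddCommGroup E]

theorem intervalIntegrable_of_muTime {T : ℝ} {f : ℝ → E} (hf : Integrable f (muTime T)) {s t : ℝ}
    (hs : s ∈ Icc 0 T) (ht : t ∈ Icc 0 T) : IntervalIntegrable f volume s t := by
  have h0 : IntegrableOn f (Icc 0 T) := by rw [integrableOn_Icc_iff_integrableOn_Ioo]; exact hf
  rw [intervalIntegrable_iff]
  exact h0.mono_set (uIoc_subset_uIcc.trans (uIcc_subset_Icc hs ht))

theorem ae_muTime_iff {T : ℝ} {p : ℝ → Prop} :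
    (∀ᵐ t ∂muTime T, p t) ↔ ∀ᵐ t, t ∈ Icc 0 T → p t := by
  rw [← ae_restrict_iff' measurableSet_Icc, muTime, restrict_Ioo_eq_restrict_Icc]

variable [NormedSpace ℝ E]

theorem integral_Ioo_eq {T : ℝ} (hT : 0 ≤ T) (f : ℝ → E) :
    ∫ t in Ioo 0 T, f t = ∫ t in (0 : ℝ)..T, f t := by
  rw [intervalIntegral.integral_of_le hT, integral_Ioc_eq_integral_Ioo]

/-- A primitive has the integrand as distributional derivative. -/
theorem isTimeDeriv_of_primitive [CompleteSpace E] {T : ℝ} (hT : 0 ≤ T) {F g : ℝ → E} {c : E}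
    (hg : Integrable g (muTime T)) (hF : ∀ᵐ t ∂muTime T, F t = c + ∫ s in (0 : ℝ)..t, g s) :
    IsTimeDeriv T F g := by
  intro ψ hψ hψc hψs
  have hgi : IntervalIntegrable g volume 0 T :=
    intervalIntegrable_of_muTime hg (left_mem_Icc.2 hT) (right_mem_Icc.2 hT)
  set W : ℝ → E := fun t => c + ∫ s in (0 : ℝ)..t, g s with hW
  have hWac : AbsolutelyContinuousOnInterval W 0 T := absolutelyContinuousOnInterval_primitive hgi c
  have hψ1 : ContDiff ℝ 1 ψ := hψ.of_le (by exact_mod_cast le_top)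
  have hψd : Continuous (deriv ψ) := hψ1.continuous_deriv le_rfl
  have h1 : IntervalIntegrable (fun t => deriv ψ t • W t) volume 0 T :=
    (hψd.continuousOn.smul hWac.continuousOn).intervalIntegrable
  have h2 : IntervalIntegrable (fun t => ψ t • g t) volume 0 T :=
    hgi.continuousOn_smul hψ.continuous.continuousOn
  have hzero : ∀ t, t ∉ Ioo 0 T → ψ t = 0 := fun t ht =>
    image_eq_zero_of_notMem_tsupport fun h => ht (hψs h)
  have hac : AbsolutelyContinuousOnInterval (fun t => ψ t • W t) 0 T :=
    (hψ1.contDiffOn.absolutelyContinuousOnInterval).smul hWac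
  have key := hac.integral_eq_sub (f := fun t => deriv ψ t • W t + ψ t • g t) (h1.add h2) (by
    filter_upwards [hgi.ae_hasDerivAt_integral] with t h ht
    have hd := (hψ1.differentiable one_ne_zero t).hasDerivAt.smul
      ((h ht 0 left_mem_uIcc).const_add c)
    rw [add_comm]
    exact hd)
  rw [hzero 0 (by simp), hzero T (by simp), zero_smul, zero_smul, sub_zero] at key
  rw [intervalIntegral.integral_add h1 h2] at key
  have e1 : ∫ t in Ioo 0 T, deriv ψ t • F t = ∫ t in Ioo 0 T, deriv ψ t • W t := by
    refine integral_congr_ae ?_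
    filter_upwards [hF] with t ht
    rw [ht]
  rw [e1, integral_Ioo_eq hT, integral_Ioo_eq hT]
  exact eq_neg_of_add_eq_zero_left key

theorem exists_test_integral_eq_one {T : ℝ} (hT : 0 < T) :
    ∃ ψ : ℝ → ℝ, ContDiff ℝ (⊤ : ℕ∞) ψ ∧ HasCompactSupport ψ ∧ tsupport ψ ⊆ Ioo 0 T ∧
      ∫ t, ψ t = 1 := by
  let b : ContDiffBump (T / 2) := ⟨T / 8, T / 4, by positivity, by linarith⟩
  refine ⟨b.normed volume, b.contDiff_normed, b.hasCompactSupport_normed, ?_, b.integral_normed⟩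
  rw [b.tsupport_normed_eq, Real.closedBall_eq_Icc]
  intro x hx
  have h1 : b.rOut = T / 4 := rfl
  rw [h1] at hx
  exact ⟨by linarith [hx.1], by linarith [hx.2]⟩

/-- A compactly supported smooth function of integral zero is the derivative of a compactly
supported smooth function. -/
theorem exists_test_primitive {T : ℝ} {ψ : ℝ → ℝ} (hψ : ContDiff ℝ (⊤ : ℕ∞) ψ)
    (hψc : HasCompactSupport ψ) (hψs : tsupport ψ ⊆ Ioo 0 T) (h0 : ∫ t, ψ t = 0) :
    ∃ θ : ℝ → ℝ, ContDiff ℝ (⊤ : ℕ∞) θ ∧ HasCompactSupport θ ∧ tsupport θ ⊆ Ioo 0 T ∧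
      deriv θ = ψ := by
  obtain ⟨p, q, hp, hq, hpq⟩ : ∃ p q : ℝ, 0 < p ∧ q < T ∧ tsupport ψ ⊆ Icc p q := by
    rcases (tsupport ψ).eq_empty_or_nonempty with he | hne
    · exact ⟨1, T - 1, one_pos, by linarith, by simp [he]⟩
    · obtain ⟨p, hp⟩ := hψc.isCompact.exists_isLeast hne
      obtain ⟨q, hq⟩ := hψc.isCompact.exists_isGreatest hne
      exact ⟨p, q, (hψs hp.1).1, (hψs hq.1).2, fun x hx => ⟨hp.2 hx, hq.2 hx⟩⟩
  have hz : ∀ t, t ∉ Icc p q → ψ t = 0 := fun t ht =>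
    image_eq_zero_of_notMem_tsupport fun h => ht (hpq h)
  have hder : ∀ t, HasDerivAt (fun x => ∫ s in (0 : ℝ)..x, ψ s) (ψ t) t := fun t =>
    intervalIntegral.integral_hasDerivAt_right (hψ.continuous.intervalIntegrable _ _)
      (hψ.continuous.stronglyMeasurableAtFilter _ _) hψ.continuous.continuousAt
  have hderiv : deriv (fun x => ∫ s in (0 : ℝ)..x, ψ s) = ψ := funext fun t => (hder t).deriv
  have hsupp : ∀ t, t ∉ Icc p q → ∫ s in (0 : ℝ)..t, ψ s = 0 := by
    intro t ht
    rcases lt_or_ge t p with h | h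
    · rw [intervalIntegral.integral_congr (g := fun _ => 0)]
      · simp
      · intro s hs
        refine hz s fun hs' => ?_
        rcases mem_uIcc.1 hs with h' | h' <;> linarith [hs'.1, h'.1, h'.2]
    · have htq : q < t := by
        by_contra hcon
        exact ht ⟨h, not_lt.1 hcon⟩
      rw [intervalIntegral.integral_eq_integral_of_support_subset, h0]
      intro s hs
      have : s ∈ Icc p q := by
        by_contra hcon
        exact hs (hz s hcon)
      exact ⟨by linarith [this.1], by linarith [this.2]⟩
  refine ⟨fun x => ∫ s in (0 : ℝ)..x, ψ s, ?_, ?_, ?_, hderiv⟩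
  · rw [contDiff_infty_iff_deriv, hderiv]
    exact ⟨fun t => (hder t).differentiableAt, hψ⟩
  · exact HasCompactSupport.intro isCompact_Icc hsupp
  · have : tsupport (fun x => ∫ s in (0 : ℝ)..x, ψ s) ⊆ Icc p q :=
      closure_minimal (fun t ht => by
        by_contra hcon
        exact ht (hsupp t hcon)) isClosed_Icc
    exact this.trans fun x hx => ⟨hp.trans_le hx.1, hx.2.trans_lt hq⟩

theorem integrable_test_smul {T : ℝ} {f : ℝ → E} (hf : Integrable f (muTime T)) {ψ : ℝ → ℝ}
    (hψ : Continuous ψ) (hψc : HasCompactSupport ψ) :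
    Integrable (fun t => ψ t • f t) (muTime T) := by
  obtain ⟨C, hC⟩ := hψ.bounded_above_of_compact_support hψc
  exact hf.bdd_smul C hψ.aestronglyMeasurable (Eventually.of_forall hC)

/-- The du Bois-Reymond lemma: every test function differs from a multiple of a fixed one of
integral one by the derivative of a test function. -/
theorem ae_eq_const_of_isTimeDeriv_zero [CompleteSpace E] {T : ℝ} (hT : 0 < T) {f : ℝ → E}
    (hf : Integrable f (muTime T)) (h : IsTimeDeriv T f 0) :
    ∃ c, ∀ᵐ t ∂muTime T, f t = c := by
  obtain ⟨ψ₀, h1, h2, h3, h4⟩ := exists_test_integral_eq_one hT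
  set c : E := ∫ t in Ioo 0 T, ψ₀ t • f t with hc
  refine ⟨c, ?_⟩
  have hset : ∀ (ψ : ℝ → ℝ), tsupport ψ ⊆ Ioo 0 T → ∀ G : ℝ → E,
      ∫ t, ψ t • G t = ∫ t in Ioo 0 T, ψ t • G t := fun ψ hψ G =>
    (setIntegral_eq_integral_of_forall_compl_eq_zero fun t ht => by
      rw [image_eq_zero_of_notMem_tsupport fun h => ht (hψ h), zero_smul]).symm
  have hset' : ∀ (ψ : ℝ → ℝ), tsupport ψ ⊆ Ioo 0 T →
      ∫ t, ψ t = ∫ t in Ioo 0 T, ψ t := fun ψ hψ =>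
    (setIntegral_eq_integral_of_forall_compl_eq_zero fun t ht => by
      rw [image_eq_zero_of_notMem_tsupport fun h => ht (hψ h)]).symm
  have hmain : ∀ᵐ t, t ∈ Ioo 0 T → f t - c = 0 := by
    refine isOpen_Ioo.ae_eq_zero_of_integral_contDiff_smul_eq_zero ?_ ?_
    · have : IntegrableOn f (Ioo 0 T) := hf
      exact (this.sub (integrableOn_const (by simp))).locallyIntegrableOn
    · intro ψ hψ hψc hψs
      set m : ℝ := ∫ t, ψ t with hm
      have hs : tsupport (ψ - m • ψ₀) ⊆ Ioo 0 T := by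
        refine (tsupport_sub _ _).trans (union_subset hψs ?_)
        exact (tsupport_smul_subset_right (fun _ => m) ψ₀).trans h3
      have hcs : HasCompactSupport (ψ - m • ψ₀) := hψc.sub (h2.smul_left (f := fun _ => m))
      obtain ⟨θ, ht1, ht2, ht3, ht4⟩ := exists_test_primitive (ψ := ψ - m • ψ₀)
        (hψ.sub (contDiff_const.smul h1)) hcs hs (by
          have e1 : Integrable ψ := hψ.continuous.integrable_of_hasCompactSupport hψc
          have e2 : Integrable ψ₀ := h1.continuous.integrable_of_hasCompactSupport h2
          simp only [Pi.sub_apply, Pi.smul_apply, smul_eq_mul]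
          rw [integral_sub e1 (e2.const_mul m), integral_const_mul, h4, mul_one, hm, sub_self])
      have key := h θ ht1 ht2 ht3
      rw [ht4] at key
      have i1 := integrable_test_smul hf hψ.continuous hψc
      have i2 := integrable_test_smul hf h1.continuous h2
      simp only [Pi.zero_apply, smul_zero, integral_zero, neg_zero, Pi.sub_apply, Pi.smul_apply,
        smul_eq_mul, sub_smul, mul_smul] at key
      rw [integral_sub (g := fun t => m • ψ₀ t • f t) i1 (i2.smul m), integral_smul, ← hc] at key
      rw [hset ψ hψs]
      simp only [smul_sub]
      have i3 : Integrable (fun t => ψ t • c) (muTime T) := by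
        have : Integrable ψ := hψ.continuous.integrable_of_hasCompactSupport hψc
        exact (this.smul_const c).restrict
      rw [integral_sub i1 i3, integral_smul_const, ← hset' ψ hψs, ← hm]
      exact key
  rw [ae_restrict_iff' measurableSet_Ioo]
  filter_upwards [hmain] with t ht ht' using sub_eq_zero.1 (ht ht')

/-- A function with an integrable distributional derivative is almost everywhere equal to a
primitive of it. -/
theorem IsTimeDeriv.exists_primitive [CompleteSpace E] {T : ℝ} (hT : 0 < T) {f g : ℝ → E}
    (hf : Integrable f (muTime T)) (hg : Integrable g (muTime T)) (h : IsTimeDeriv T f g) :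
    ∃ c, ∀ᵐ t ∂muTime T, f t = c + ∫ s in (0 : ℝ)..t, g s := by
  set G : ℝ → E := fun t => ∫ s in (0 : ℝ)..t, g s with hG
  have hGd : IsTimeDeriv T G g :=
    isTimeDeriv_of_primitive hT.le (c := 0) hg (Eventually.of_forall fun t => by simp [hG])
  have hgi : IntervalIntegrable g volume 0 T :=
    intervalIntegrable_of_muTime hg (left_mem_Icc.2 hT.le) (right_mem_Icc.2 hT.le)
  have hGi : Integrable G (muTime T) := by
    have hGc : ContinuousOn G (uIcc 0 T) := by
      have := (absolutelyContinuousOnInterval_primitive hgi 0).continuousOn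
      simpa [hG] using this
    rw [uIcc_of_le hT.le] at hGc
    exact hGc.integrableOn_Icc.mono_set Ioo_subset_Icc_self
  obtain ⟨c, hc⟩ := ae_eq_const_of_isTimeDeriv_zero hT (hf.sub hGi) (fun ψ a b d => by
    have hψ1 : Continuous (deriv ψ) :=
      (a.of_le (m := 1) (by exact_mod_cast le_top)).continuous_deriv le_rfl
    have e := h ψ a b d
    have e' := hGd ψ a b d
    simp only [Pi.sub_apply, smul_sub, Pi.zero_apply, smul_zero, integral_zero, neg_zero]
    rw [integral_sub (integrable_test_smul hf hψ1 b.deriv) (integrable_test_smul hGi hψ1 b.deriv),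
      e, e', sub_self])
  refine ⟨c, ?_⟩
  filter_upwards [hc] with t ht
  rw [← ht]; simp [hG]

end TimeDeriv

end

section

/-! ### Form triples and their resolvents -/

/-- A Hilbert space `V` densely and injectively embedded in a Hilbert space `H` by `ι`, together
with a map `D` into a third Hilbert space such that `‖u‖² = ‖ι u‖² + ‖D u‖²`. The associated
operator `A` from `V` to its dual is given by `⟨A u, φ⟩ = ⟪D u, D φ⟫`. -/
structure FormTriple (V H K : Type*) [NormedAddCommGroup V] [InnerProductSpace ℝ V]
    [NormedAddCommGroup H] [InnerProductSpace ℝ H] [NormedAddCommGroup K]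
    [InnerProductSpace ℝ K] where
  ι : V →L[ℝ] H
  D : V →L[ℝ] K
  inner_eq : ∀ u v, inner ℝ u v = inner ℝ (ι u) (ι v) + inner ℝ (D u) (D v)
  dense : DenseRange ι
  injective : Function.Injective ι

/-- Norm-decreasing operators converging strongly to the identity on a dense set do so
everywhere. -/
theorem tendsto_id_of_dense {X : Type*} [NormedAddCommGroup X] [NormedSpace ℝ X]
    {S : ℕ → X →L[ℝ] X} (hS : ∀ n x, ‖S n x‖ ≤ ‖x‖) {Y : Type*} {e : Y → X} (he : DenseRange e)
    (h : ∀ y, Tendsto (fun n => S n (e y)) atTop (𝓝 (e y))) (x : X) :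
    Tendsto (fun n => S n x) atTop (𝓝 x) := by
  rw [Metric.tendsto_atTop]
  intro δ hδ
  obtain ⟨y, hy⟩ := he.exists_dist_lt x (show 0 < δ / 3 by positivity)
  obtain ⟨N, hN⟩ := Metric.tendsto_atTop.1 (h y) (δ / 3) (by positivity)
  refine ⟨N, fun n hn => ?_⟩
  have h1 : dist (S n x) (S n (e y)) ≤ dist x (e y) := by
    rw [dist_eq_norm, dist_eq_norm, ← map_sub]; exact hS n _
  have h2 := hN n hn
  rw [dist_comm] at hy
  have h3 := dist_triangle4 (S n x) (S n (e y)) (e y) x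
  rw [dist_comm x] at h1
  linarith

/-- The Riesz isomorphism from the dual of `V` to `V`, as a linear map. -/
def riesz (V : Type*) [NormedAddCommGroup V] [InnerProductSpace ℝ V] [CompleteSpace V] :
    StrongDual ℝ V →L[ℝ] V :=
  LinearMap.mkContinuous
    { toFun := fun f => (InnerProductSpace.toDual ℝ V).symm f
      map_add' := fun f g => map_add _ f g
      map_smul' := fun c f => by simp } 1 fun f => by simp

@[simp] theorem inner_riesz {V : Type*} [NormedAddCommGroup V] [InnerProductSpace ℝ V]
    [CompleteSpace V] (f : StrongDual ℝ V) (v : V) : inner ℝ (riesz V f) v = f v :=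
  InnerProductSpace.toDual_symm_apply

namespace FormTriple

variable {V H K : Type*} [NormedAddCommGroup V] [InnerProductSpace ℝ V]
  [NormedAddCommGroup H] [InnerProductSpace ℝ H]
  [NormedAddCommGroup K] [InnerProductSpace ℝ K] (𝒢 : FormTriple V H K)

theorem norm_sq (u : V) : ‖u‖ ^ 2 = ‖𝒢.ι u‖ ^ 2 + ‖𝒢.D u‖ ^ 2 := by
  simp only [← real_inner_self_eq_norm_sq]; exact 𝒢.inner_eq u u

theorem norm_ι_le (u : V) : ‖𝒢.ι u‖ ≤ ‖u‖ :=
  abs_le_of_sq_le_sq' (by rw [𝒢.norm_sq u]; nlinarith [sq_nonneg ‖𝒢.D u‖]) (norm_nonneg _) |>.2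

theorem norm_D_le (u : V) : ‖𝒢.D u‖ ≤ ‖u‖ :=
  abs_le_of_sq_le_sq' (by rw [𝒢.norm_sq u]; nlinarith [sq_nonneg ‖𝒢.ι u‖]) (norm_nonneg _) |>.2

/-- The embedding `h ↦ ⟪h, ι ·⟫` of `H` in the dual of `V`. -/
def emb : H →L[ℝ] StrongDual ℝ V :=
  ((ContinuousLinearMap.compL ℝ V H ℝ).flip 𝒢.ι).comp (innerSL ℝ)

/-- The map `k ↦ ⟪k, D ·⟫` from `K` to the dual of `V`. -/
def embD : K →L[ℝ] StrongDual ℝ V :=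
  ((ContinuousLinearMap.compL ℝ V K ℝ).flip 𝒢.D).comp (innerSL ℝ)

@[simp] theorem emb_apply (h : H) (v : V) : 𝒢.emb h v = inner ℝ h (𝒢.ι v) := rfl

@[simp] theorem embD_apply (k : K) (v : V) : 𝒢.embD k v = inner ℝ k (𝒢.D v) := rfl

theorem emb_injective : Function.Injective 𝒢.emb := by
  rw [injective_iff_map_eq_zero]
  intro h hh
  exact 𝒢.dense.eq_zero_of_inner_left ℝ fun v => by
    rw [← emb_apply, hh]; rfl

/-- The vanishing sequence of parameters used in the resolvents. -/
def eps (n : ℕ) : ℝ := 1 / ((n : ℝ) + 1)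

theorem eps_pos (n : ℕ) : 0 < eps n := Nat.one_div_pos_of_nat

theorem eps_le_one (n : ℕ) : eps n ≤ 1 := by
  rw [eps, div_le_one (by positivity)]
  linarith [(Nat.cast_nonneg n : (0 : ℝ) ≤ n)]

theorem tendsto_eps : Tendsto eps atTop (𝓝 0) := tendsto_one_div_add_atTop_nhds_zero_nat

/-- The bilinear form `⟪ι u, ι φ⟫ + ε ⟪D u, D φ⟫` of `1 + ε A`. -/
def resForm (n : ℕ) : V →L[ℝ] V →L[ℝ] ℝ := 𝒢.emb.comp 𝒢.ι + eps n • 𝒢.embD.comp 𝒢.D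

theorem resForm_apply (n : ℕ) (u v : V) :
    𝒢.resForm n u v = inner ℝ (𝒢.ι u) (𝒢.ι v) + eps n * inner ℝ (𝒢.D u) (𝒢.D v) := rfl

theorem resForm_coercive (n : ℕ) : IsCoercive (𝒢.resForm n) := by
  refine ⟨eps n, eps_pos n, fun u => ?_⟩
  rw [resForm_apply, real_inner_self_eq_norm_sq, real_inner_self_eq_norm_sq, mul_assoc, ← sq,
    𝒢.norm_sq u]
  nlinarith [eps_le_one n, sq_nonneg ‖𝒢.ι u‖]

variable [CompleteSpace V]

/-- The resolvent `R = (1 + ε A)⁻¹`, as a map from the dual of `V` to `V`, given by the Lax-Milgram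
lemma. -/
def res (n : ℕ) : StrongDual ℝ V →L[ℝ] V :=
  ((𝒢.resForm_coercive n).continuousLinearEquivOfBilin.symm : V →L[ℝ] V).comp (riesz V)

theorem res_spec (n : ℕ) (f : StrongDual ℝ V) (v : V) :
    inner ℝ (𝒢.ι (𝒢.res n f)) (𝒢.ι v) + eps n * inner ℝ (𝒢.D (𝒢.res n f)) (𝒢.D v) = f v := by
  rw [← resForm_apply, ← IsCoercive.continuousLinearEquivOfBilin_apply (𝒢.resForm_coercive n)]
  simp [res]

theorem res_symm (n : ℕ) (f g : StrongDual ℝ V) : f (𝒢.res n g) = g (𝒢.res n f) := by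
  rw [← 𝒢.res_spec n f, ← 𝒢.res_spec n g, real_inner_comm, real_inner_comm (𝒢.D _)]

theorem inner_ι_res (n : ℕ) (f : StrongDual ℝ V) (h : H) :
    inner ℝ (𝒢.ι (𝒢.res n f)) h = f (𝒢.res n (𝒢.emb h)) := by
  rw [𝒢.res_symm, emb_apply, real_inner_comm]

/-- The resolvent is a contraction of `H`: test its equation with the solution. -/
theorem norm_ι_res_emb_le (n : ℕ) (h : H) : ‖𝒢.ι (𝒢.res n (𝒢.emb h))‖ ≤ ‖h‖ := by
  set u := 𝒢.res n (𝒢.emb h) with hu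
  have h1 := 𝒢.res_spec n (𝒢.emb h) u
  rw [← hu, real_inner_self_eq_norm_sq, real_inner_self_eq_norm_sq, emb_apply] at h1
  have h2 := real_inner_le_norm h (𝒢.ι u)
  have h3 : 0 ≤ eps n * ‖𝒢.D u‖ ^ 2 := mul_nonneg (eps_pos n).le (sq_nonneg _)
  by_contra hcon
  push Not at hcon
  nlinarith [norm_nonneg h, norm_nonneg (𝒢.ι u)]

/-- The resolvent is a contraction of `V`: test the equation for `w = R u` with `w - u`. -/
theorem norm_res_emb_le (n : ℕ) (u : V) : ‖𝒢.res n (𝒢.emb (𝒢.ι u))‖ ≤ ‖u‖ := by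
  set w := 𝒢.res n (𝒢.emb (𝒢.ι u)) with hw
  have h1 := 𝒢.res_spec n (𝒢.emb (𝒢.ι u)) (w - u)
  rw [← hw, emb_apply] at h1
  have h0 := 𝒢.norm_ι_res_emb_le n (𝒢.ι u)
  rw [← hw] at h0
  have h2 : inner ℝ (𝒢.ι w) (𝒢.ι (w - u)) - inner ℝ (𝒢.ι u) (𝒢.ι (w - u))
      = ‖𝒢.ι (w - u)‖ ^ 2 := by
    rw [← inner_sub_left, ← map_sub, real_inner_self_eq_norm_sq]
  have h3 : inner ℝ (𝒢.D w) (𝒢.D (w - u)) = ‖𝒢.D w‖ ^ 2 - inner ℝ (𝒢.D w) (𝒢.D u) := by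
    rw [map_sub, inner_sub_right, real_inner_self_eq_norm_sq]
  have h4 : inner ℝ (𝒢.D w) (𝒢.D (w - u)) ≤ 0 := by
    by_contra hcon
    push Not at hcon
    nlinarith [mul_pos (eps_pos n) hcon, sq_nonneg ‖𝒢.ι (w - u)‖]
  have h5 := real_inner_le_norm (𝒢.D w) (𝒢.D u)
  have h6 : ‖𝒢.D w‖ ≤ ‖𝒢.D u‖ := by
    by_contra hcon
    push Not at hcon
    nlinarith [norm_nonneg (𝒢.D u), norm_nonneg (𝒢.D w)]
  refine abs_le_of_sq_le_sq' ?_ (norm_nonneg _) |>.2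
  rw [𝒢.norm_sq, 𝒢.norm_sq]
  gcongr

/-- On the domain of `A` the resolvents converge to the identity at the rate `√ε`. -/
theorem norm_res_sub_sq_le (n : ℕ) {u : V} {f : H}
    (hf : ∀ v, inner ℝ (𝒢.D u) (𝒢.D v) = inner ℝ f (𝒢.ι v)) :
    ‖𝒢.res n (𝒢.emb (𝒢.ι u)) - u‖ ^ 2 ≤ 2 * ‖f‖ ^ 2 * eps n := by
  set w := 𝒢.res n (𝒢.emb (𝒢.ι u)) with hw
  set d := w - u with hd
  have h1 := 𝒢.res_spec n (𝒢.emb (𝒢.ι u)) d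
  rw [← hw, emb_apply] at h1
  have h2 : inner ℝ (𝒢.ι w) (𝒢.ι d) - inner ℝ (𝒢.ι u) (𝒢.ι d) = ‖𝒢.ι d‖ ^ 2 := by
    rw [← inner_sub_left, ← map_sub, real_inner_self_eq_norm_sq]
  have h3 : inner ℝ (𝒢.D w) (𝒢.D d) = ‖𝒢.D d‖ ^ 2 + inner ℝ f (𝒢.ι d) := by
    rw [← hf d, ← real_inner_self_eq_norm_sq, ← inner_add_left, ← map_add, hd, sub_add_cancel]
  have h4 : -(‖f‖ * ‖𝒢.ι d‖) ≤ inner ℝ f (𝒢.ι d) :=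
    (abs_le.1 (abs_real_inner_le_norm f (𝒢.ι d))).1
  have he := eps_pos n
  have he1 := eps_le_one n
  rw [h3] at h1
  have h5 : ‖𝒢.ι d‖ ^ 2 + eps n * ‖𝒢.D d‖ ^ 2 ≤ eps n * (‖f‖ * ‖𝒢.ι d‖) := by
    nlinarith [mul_le_mul_of_nonneg_left h4 he.le]
  have h6 : ‖𝒢.ι d‖ ≤ eps n * ‖f‖ := by
    by_contra hcon
    push Not at hcon
    have : 0 ≤ eps n * ‖f‖ := mul_nonneg he.le (norm_nonneg f)
    nlinarith [mul_nonneg he.le (sq_nonneg ‖𝒢.D d‖), mul_pos (this.trans_lt hcon) (sub_pos.2 hcon)]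
  have h7 : ‖𝒢.D d‖ ^ 2 ≤ eps n * ‖f‖ ^ 2 := by
    have : eps n * ‖𝒢.D d‖ ^ 2 ≤ eps n * (‖f‖ * ‖𝒢.ι d‖) := by nlinarith [sq_nonneg ‖𝒢.ι d‖]
    have := le_of_mul_le_mul_left this he
    nlinarith [mul_le_mul_of_nonneg_left h6 (norm_nonneg f)]
  have h8 : ‖𝒢.ι d‖ ^ 2 ≤ eps n * ‖f‖ ^ 2 := by
    have : ‖𝒢.ι d‖ ^ 2 ≤ (eps n * ‖f‖) ^ 2 := by gcongr
    nlinarith [mul_nonneg he.le (sq_nonneg ‖f‖)]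
  rw [𝒢.norm_sq]
  linarith

/-- The range of `(1 + A)⁻¹` on `H` is dense in `V`: since `ε₀ = 1`, an element `w` orthogonal to it
satisfies `⟪h, ι w⟫ = 0` for all `h`. -/
theorem denseRange_res_zero : DenseRange fun h => 𝒢.res 0 (𝒢.emb h) := by
  have hr : (range fun h => 𝒢.res 0 (𝒢.emb h)) = ((𝒢.res 0).comp 𝒢.emb).range := rfl
  rw [DenseRange, hr, Submodule.dense_iff_topologicalClosure_eq_top,
    Submodule.topologicalClosure_eq_top_iff, Submodule.eq_bot_iff]
  intro w hw
  rw [Submodule.mem_orthogonal] at hw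
  refine 𝒢.injective ?_
  rw [map_zero, ← inner_self_eq_zero (𝕜 := ℝ), ← emb_apply, ← 𝒢.res_spec 0]
  have := hw (𝒢.res 0 (𝒢.emb (𝒢.ι w))) ⟨_, rfl⟩
  rw [𝒢.inner_eq] at this
  simpa [eps] using this

/-- The resolvents converge strongly to the identity on `V`. -/
theorem tendsto_res (u : V) : Tendsto (fun n => 𝒢.res n (𝒢.emb (𝒢.ι u))) atTop (𝓝 u) := by
  refine tendsto_id_of_dense (S := fun n => ((𝒢.res n).comp 𝒢.emb).comp 𝒢.ι)
    (fun n x => 𝒢.norm_res_emb_le n x) 𝒢.denseRange_res_zero (fun h => ?_) u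
  set u := 𝒢.res 0 (𝒢.emb h) with hu
  have hf : ∀ v, inner ℝ (𝒢.D u) (𝒢.D v) = inner ℝ (h - 𝒢.ι u) (𝒢.ι v) := fun v => by
    have := 𝒢.res_spec 0 (𝒢.emb h) v
    rw [← hu, emb_apply] at this
    simp only [eps, Nat.cast_zero, zero_add, div_one, one_mul] at this
    rw [inner_sub_left]; linarith
  rw [tendsto_iff_norm_sub_tendsto_zero]
  have h1 : Tendsto (fun n => √(2 * ‖h - 𝒢.ι u‖ ^ 2 * eps n)) atTop (𝓝 0) := by
    have := (tendsto_eps.const_mul (2 * ‖h - 𝒢.ι u‖ ^ 2)).sqrt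
    simpa using this
  exact squeeze_zero (fun n => norm_nonneg _)
    (fun n => Real.le_sqrt_of_sq_le (𝒢.norm_res_sub_sq_le n hf)) h1

/-- The resolvents converge strongly to the identity on `H`. -/
theorem tendsto_ι_res (h : H) : Tendsto (fun n => 𝒢.ι (𝒢.res n (𝒢.emb h))) atTop (𝓝 h) :=
  tendsto_id_of_dense (S := fun n => (𝒢.ι.comp (𝒢.res n)).comp 𝒢.emb)
    (fun n x => 𝒢.norm_ι_res_emb_le n x) 𝒢.dense
    (fun u => (𝒢.ι.continuous.tendsto u).comp (𝒢.tendsto_res u)) h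

/-- The resolvent commutes with `A`, that is `R A u = A R u`; the left-hand side is `R A u ∈ V`,
paired with `w` in `H`. -/
theorem inner_ι_res_embD (n : ℕ) (u w : V) :
    inner ℝ (𝒢.ι (𝒢.res n (𝒢.embD (𝒢.D u)))) (𝒢.ι w)
      = inner ℝ (𝒢.D (𝒢.res n (𝒢.emb (𝒢.ι u)))) (𝒢.D w) := by
  rw [inner_ι_res, embD_apply]
  have h1 := 𝒢.res_spec n (𝒢.emb (𝒢.ι w)) u
  have h2 := 𝒢.res_spec n (𝒢.emb (𝒢.ι u)) w
  have h3 := 𝒢.inner_ι_res n (𝒢.emb (𝒢.ι w)) (𝒢.ι u)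
  rw [emb_apply] at h1 h2 h3
  rw [h3, real_inner_comm _ (𝒢.ι w)] at h1
  rw [real_inner_comm (𝒢.ι u) (𝒢.ι w)] at h1
  rw [real_inner_comm _ (𝒢.D u)]
  exact mul_left_cancel₀ (eps_pos n).ne' (by linarith)

end FormTriple

end

section

/-! ### Curves with time derivative in the dual space -/

section Aux

variable {E F : Type*} [NormedAddCommGroup E] [NormedAddCommGroup F]

theorem integrable_of_memLp_two {T : ℝ} {f : ℝ → E} (hf : MemLp f 2 (muTime T)) :
    Integrable f (muTime T) := hf.integrable (by norm_num)

theorem integrable_norm_mul_norm {T : ℝ} {f : ℝ → E} {g : ℝ → F} (hf : MemLp f 2 (muTime T))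
    (hg : MemLp g 2 (muTime T)) : Integrable (fun t => ‖f t‖ * ‖g t‖) (muTime T) :=
  hf.norm.integrable_mul hg.norm

variable [NormedSpace ℝ E] [NormedSpace ℝ F]

theorem integrable_dual_apply {T : ℝ} {f : ℝ → StrongDual ℝ E} {g : ℝ → E}
    (hf : MemLp f 2 (muTime T)) (hg : MemLp g 2 (muTime T)) :
    Integrable (fun t => f t (g t)) (muTime T) := by
  refine (integrable_norm_mul_norm hf hg).mono' ?_ (Eventually.of_forall fun t => (f t).le_opNorm _)
  exact (ContinuousLinearMap.id ℝ (StrongDual ℝ E)).aestronglyMeasurable_comp₂ hf.1 hg.1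

theorem IsTimeDeriv.clm_comp [CompleteSpace E] [CompleteSpace F] {T : ℝ} {f g : ℝ → E}
    (hf : Integrable f (muTime T)) (hg : Integrable g (muTime T)) (h : IsTimeDeriv T f g)
    (L : E →L[ℝ] F) :
    IsTimeDeriv T (fun t => L (f t)) (fun t => L (g t)) := by
  intro ψ h1 h2 h3
  have h4 : Continuous (deriv ψ) :=
    (h1.of_le (m := 1) (by exact_mod_cast le_top)).continuous_deriv le_rfl
  have := congrArg L (h ψ h1 h2 h3)
  rw [map_neg, ← L.integral_comp_comm (integrable_test_smul hf h4 h2.deriv),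
    ← L.integral_comp_comm (integrable_test_smul hg h1.continuous h2)] at this
  simpa using this

theorem ae_uIoc_of_muTime {T t : ℝ} (ht : t ∈ Icc 0 T) {p : ℝ → Prop}
    (h : ∀ᵐ s ∂muTime T, p s) : ∀ᵐ s, s ∈ uIoc 0 t → p s := by
  rw [ae_muTime_iff] at h
  filter_upwards [h] with s hs hst
  rw [uIoc_of_le ht.1] at hst
  exact hs ⟨hst.1.le, hst.2.trans ht.2⟩

theorem measurePreserving_reverse (T : ℝ) :
    MeasurePreserving (fun t => T - t) (muTime T) (muTime T) := by
  have h := (volume.measurePreserving_sub_left T).restrict_preimage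
    (measurableSet_Ioo (a := (0 : ℝ)) (b := T))
  simpa using h

/-- Product rule for two primitives in a Hilbert space. -/
theorem integral_inner_primitive {X : Type*} [NormedAddCommGroup X] [InnerProductSpace ℝ X]
    [CompleteSpace X] {f g W Z : ℝ → X} {t : ℝ} (hf : IntervalIntegrable f volume 0 t)
    (hg : IntervalIntegrable g volume 0 t)
    (hW : ∀ s ∈ uIcc 0 t, W s = W 0 + ∫ τ in (0 : ℝ)..s, f τ)
    (hZ : ∀ s ∈ uIcc 0 t, Z s = Z 0 + ∫ τ in (0 : ℝ)..s, g τ) :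
    IntervalIntegrable (fun s => inner ℝ (W s) (g s) + inner ℝ (f s) (Z s)) volume 0 t ∧
      ∫ s in (0 : ℝ)..t, inner ℝ (W s) (g s) + inner ℝ (f s) (Z s)
        = inner ℝ (W t) (Z t) - inner ℝ (W 0) (Z 0) := by
  have hfg : IntervalIntegrable (fun s => (f s, g s)) volume 0 t := by
    rw [intervalIntegrable_iff] at hf hg ⊢
    exact hf.prodMk hg
  have key := integral_fderiv_primitive (Φ := fun p : X × X => inner ℝ p.1 p.2)
    (Φ' := fun p => fderivInnerCLM ℝ p)
    (fun p => by
      have := (hasFDerivAt_fst (𝕜 := ℝ) (p := p)).inner ℝ (hasFDerivAt_snd (𝕜 := ℝ) (p := p))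
      refine this.congr_fderiv ?_
      ext <;> simp)
    (fun R => ⟨2 * R, fun x y hx hy => by
      have e : (inner ℝ x.1 x.2 - inner ℝ y.1 y.2 : ℝ)
          = inner ℝ x.1 (x.2 - y.2) + inner ℝ (x.1 - y.1) y.2 := by
        rw [inner_sub_right, inner_sub_left]; ring
      have h1 : ‖x.1‖ ≤ R := (norm_fst_le x).trans hx
      have h2 : ‖y.2‖ ≤ R := (norm_snd_le y).trans hy
      have h3 : ‖x.1 - y.1‖ ≤ ‖x - y‖ := norm_fst_le (x - y)
      have h4 : ‖x.2 - y.2‖ ≤ ‖x - y‖ := norm_snd_le (x - y)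
      have h5 := abs_real_inner_le_norm x.1 (x.2 - y.2)
      have h6 := abs_real_inner_le_norm (x.1 - y.1) y.2
      have hR : 0 ≤ R := (norm_nonneg x).trans hx
      have h7 : ‖x.1‖ * ‖x.2 - y.2‖ ≤ R * ‖x - y‖ := by gcongr
      have h8 : ‖x.1 - y.1‖ * ‖y.2‖ ≤ ‖x - y‖ * R := by gcongr
      rw [e]
      refine (abs_add_le _ _).trans ?_
      linarith⟩)
    hfg (W 0, Z 0) (Z := fun s => (W s, Z s)) (fun s hs => by
      have hfs := hf.mono_set (uIcc_subset_uIcc_left hs)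
      have hgs := hg.mono_set (uIcc_subset_uIcc_left hs)
      have hfgs := hfg.mono_set (uIcc_subset_uIcc_left hs)
      have e1 := (ContinuousLinearMap.fst ℝ X X).intervalIntegral_comp_comm hfgs
      have e2 := (ContinuousLinearMap.snd ℝ X X).intervalIntegral_comp_comm hfgs
      simp only [ContinuousLinearMap.coe_fst', ContinuousLinearMap.coe_snd'] at e1 e2
      ext
      · simp [hW s hs, ← e1]
      · simp [hZ s hs, ← e2])
  simpa [fderivInnerCLM_apply] using key

end Aux

variable {V H K : Type*} [NormedAddCommGroup V] [InnerProductSpace ℝ V]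
  [NormedAddCommGroup H] [InnerProductSpace ℝ H]
  [NormedAddCommGroup K] [InnerProductSpace ℝ K] {𝒢 : FormTriple V H K} {T : ℝ}

variable (𝒢 T) in
/-- `ρ ∈ L²(0,T;V)` has the time derivative `g ∈ L²(0,T;V')` and the representative
`r ∈ C([0,T];H)`. The derivative is encoded by the fundamental theorem of calculus in `V'`. -/
structure Evolves (ρ : ℝ → V) (g : ℝ → StrongDual ℝ V) (r : ℝ → H) : Prop where
  memLp : MemLp ρ 2 (muTime T)
  memLp_deriv : MemLp g 2 (muTime T)
  cont : ContinuousOn r (Icc 0 T)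
  ae_eq : ∀ᵐ t ∂muTime T, r t = 𝒢.ι (ρ t)
  emb_eq : ∀ t ∈ Icc 0 T, 𝒢.emb (r t) = 𝒢.emb (r 0) + ∫ s in (0 : ℝ)..t, g s

namespace Evolves

variable {ρ σ : ℝ → V} {g k : ℝ → StrongDual ℝ V} {r s : ℝ → H}

theorem sub (h₁ : Evolves 𝒢 T ρ g r) (h₂ : Evolves 𝒢 T σ k s) :
    Evolves 𝒢 T (fun t => ρ t - σ t) (fun t => g t - k t) (fun t => r t - s t) where
  memLp := h₁.memLp.sub h₂.memLp
  memLp_deriv := h₁.memLp_deriv.sub h₂.memLp_deriv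
  cont := h₁.cont.sub h₂.cont
  ae_eq := by
    filter_upwards [h₁.ae_eq, h₂.ae_eq] with t e1 e2
    rw [e1, e2, map_sub]
  emb_eq t ht := by
    have h0 : (0 : ℝ) ∈ Icc 0 T := ⟨le_rfl, ht.1.trans ht.2⟩
    rw [intervalIntegral.integral_sub
      (intervalIntegrable_of_muTime (integrable_of_memLp_two h₁.memLp_deriv) h0 ht)
      (intervalIntegrable_of_muTime (integrable_of_memLp_two h₂.memLp_deriv) h0 ht),
      map_sub, map_sub, h₁.emb_eq t ht, h₂.emb_eq t ht]
    abel

theorem neg (h₁ : Evolves 𝒢 T ρ g r) :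
    Evolves 𝒢 T (fun t => -ρ t) (fun t => -g t) (fun t => -r t) where
  memLp := h₁.memLp.neg
  memLp_deriv := h₁.memLp_deriv.neg
  cont := h₁.cont.neg
  ae_eq := by
    filter_upwards [h₁.ae_eq] with t e1
    rw [e1, map_neg]
  emb_eq t ht := by
    rw [intervalIntegral.integral_neg, map_neg, map_neg, h₁.emb_eq t ht]
    abel

theorem congr {ρ' : ℝ → V} {g' : ℝ → StrongDual ℝ V} (h : Evolves 𝒢 T ρ g r)
    (hρ : ρ =ᵐ[muTime T] ρ') (hg : g =ᵐ[muTime T] g') : Evolves 𝒢 T ρ' g' r where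
  memLp := h.memLp.ae_eq hρ
  memLp_deriv := h.memLp_deriv.ae_eq hg
  cont := h.cont
  ae_eq := by
    filter_upwards [h.ae_eq, hρ] with t e1 e2
    rw [e1, e2]
  emb_eq t ht := by
    rw [h.emb_eq t ht, intervalIntegral.integral_congr_ae (ae_uIoc_of_muTime ht hg)]

/-- Time reversal. -/
theorem reverse (h : Evolves 𝒢 T ρ g r) :
    Evolves 𝒢 T (fun t => ρ (T - t)) (fun t => -g (T - t)) (fun t => r (T - t)) where
  memLp := h.memLp.comp_measurePreserving (measurePreserving_reverse T)
  memLp_deriv := (h.memLp_deriv.comp_measurePreserving (measurePreserving_reverse T)).neg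
  cont := h.cont.comp (by fun_prop) fun t ht => ⟨by linarith [ht.2], by linarith [ht.1]⟩
  ae_eq := (measurePreserving_reverse T).quasiMeasurePreserving.ae h.ae_eq
  emb_eq t ht := by
    have hT : 0 ≤ T := ht.1.trans ht.2
    have h1 : T - t ∈ Icc 0 T := ⟨by linarith [ht.2], by linarith [ht.1]⟩
    have h2 : T ∈ Icc 0 T := ⟨hT, le_rfl⟩
    have h0 : (0 : ℝ) ∈ Icc 0 T := ⟨le_rfl, hT⟩
    have hi := integrable_of_memLp_two h.memLp_deriv
    rw [sub_zero, h.emb_eq _ h1, h.emb_eq _ h2, intervalIntegral.integral_neg,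
      intervalIntegral.integral_comp_sub_left (fun s => g s) T, sub_zero,
      ← intervalIntegral.integral_interval_sub_left (intervalIntegrable_of_muTime hi h0 h2)
        (intervalIntegrable_of_muTime hi h0 h1)]
    abel

/-- `g` is the derivative of `ρ`, as a curve in `V'`, in the sense of distributions. -/
theorem isTimeDeriv (h : Evolves 𝒢 T ρ g r) (hT : 0 ≤ T) :
    IsTimeDeriv T (fun t => 𝒢.emb (𝒢.ι (ρ t))) g := by
  refine isTimeDeriv_of_primitive hT (c := 𝒢.emb (r 0)) (integrable_of_memLp_two h.memLp_deriv) ?_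
  filter_upwards [h.ae_eq, ae_restrict_mem measurableSet_Ioo] with t h1 h2
  rw [← h1, h.emb_eq t (Ioo_subset_Icc_self h2)]

variable [CompleteSpace V]

theorem intervalIntegrable_res (h : Evolves 𝒢 T ρ g r) (n : ℕ) {t : ℝ} (ht : t ∈ Icc 0 T) :
    IntervalIntegrable (fun s => 𝒢.ι (𝒢.res n (g s))) volume 0 t :=
  intervalIntegrable_of_muTime ((𝒢.ι.comp (𝒢.res n)).integrable_comp
    (integrable_of_memLp_two h.memLp_deriv)) ⟨le_rfl, ht.1.trans ht.2⟩ ht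

variable [CompleteSpace H]

/-- The curve smoothed by the resolvent is a primitive in `H`. -/
theorem res_eq (h : Evolves 𝒢 T ρ g r) (n : ℕ) {t : ℝ} (ht : t ∈ Icc 0 T) :
    𝒢.ι (𝒢.res n (𝒢.emb (r t)))
      = 𝒢.ι (𝒢.res n (𝒢.emb (r 0))) + ∫ s in (0 : ℝ)..t, 𝒢.ι (𝒢.res n (g s)) := by
  have hi := intervalIntegrable_of_muTime (integrable_of_memLp_two h.memLp_deriv)
    ⟨le_rfl, ht.1.trans ht.2⟩ ht
  have := (𝒢.ι.comp (𝒢.res n)).intervalIntegral_comp_comm hi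
  simp only [ContinuousLinearMap.comp_apply] at this
  rw [this, h.emb_eq t ht, map_add, map_add]

/-- Integration by parts in time, `d/dt ⟪r, s⟫ = ⟨g, σ⟩ + ⟨k, ρ⟩`: it holds for the curves smoothed
by the resolvents, and the pairings converge pointwise in time under a common integrable bound. -/
theorem integral_pairing (h₁ : Evolves 𝒢 T ρ g r) (h₂ : Evolves 𝒢 T σ k s) {t : ℝ}
    (ht : t ∈ Icc 0 T) :
    ∫ τ in (0 : ℝ)..t, (g τ (σ τ) + k τ (ρ τ)) = inner ℝ (r t) (s t) - inner ℝ (r 0) (s 0) := by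
  have h0 : (0 : ℝ) ∈ Icc 0 T := ⟨le_rfl, ht.1.trans ht.2⟩
  have hsub : ∀ τ ∈ uIcc 0 t, τ ∈ Icc 0 T := fun τ hτ => by
    rw [uIcc_of_le ht.1] at hτ; exact ⟨hτ.1, hτ.2.trans ht.2⟩
  have key := fun n => integral_inner_primitive (h₁.intervalIntegrable_res n ht)
    (h₂.intervalIntegrable_res n ht) (W := fun τ => 𝒢.ι (𝒢.res n (𝒢.emb (r τ))))
    (Z := fun τ => 𝒢.ι (𝒢.res n (𝒢.emb (s τ)))) (fun τ hτ => h₁.res_eq n (hsub τ hτ))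
    (fun τ hτ => h₂.res_eq n (hsub τ hτ))
  -- the resolvents are uniformly bounded on `V`, so their squares converge to the identity as well
  have hRR : ∀ v, Tendsto (fun n => 𝒢.res n (𝒢.emb (𝒢.ι (𝒢.res n (𝒢.emb (𝒢.ι v))))))
      atTop (𝓝 v) := fun v => by
    have h1 := 𝒢.tendsto_res v
    have h2 := tendsto_iff_norm_sub_tendsto_zero.1 h1
    have h3 : Tendsto (fun n => 𝒢.res n (𝒢.emb (𝒢.ι (𝒢.res n (𝒢.emb (𝒢.ι v)) - v))))
        atTop (𝓝 0) :=
      squeeze_zero_norm (fun n => 𝒢.norm_res_emb_le n _) h2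
    have h4 := h3.add h1
    rw [zero_add] at h4
    refine h4.congr fun n => ?_
    simp only [map_sub]; abel
  have hlim : Tendsto (fun n => ∫ τ in (0 : ℝ)..t,
      (inner ℝ (𝒢.ι (𝒢.res n (𝒢.emb (r τ)))) (𝒢.ι (𝒢.res n (k τ)))
        + inner ℝ (𝒢.ι (𝒢.res n (g τ))) (𝒢.ι (𝒢.res n (𝒢.emb (s τ)))))) atTop
      (𝓝 (∫ τ in (0 : ℝ)..t, (g τ (σ τ) + k τ (ρ τ)))) := by
    refine intervalIntegral.tendsto_integral_filter_of_dominated_convergence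
      (fun τ => ‖g τ‖ * ‖σ τ‖ + ‖k τ‖ * ‖ρ τ‖) ?_ ?_ ?_ ?_
    · exact Eventually.of_forall fun n => (intervalIntegrable_iff.1 (key n).1).aestronglyMeasurable
    · refine Eventually.of_forall fun n => ae_uIoc_of_muTime ht ?_
      filter_upwards [h₁.ae_eq, h₂.ae_eq] with τ e1 e2
      rw [e1, e2, real_inner_comm, 𝒢.inner_ι_res, 𝒢.inner_ι_res, add_comm]
      refine (norm_add_le _ _).trans (add_le_add ?_ ?_)
      · refine ((g τ).le_opNorm _).trans (mul_le_mul_of_nonneg_left ?_ (norm_nonneg _))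
        exact (𝒢.norm_res_emb_le n _).trans (𝒢.norm_res_emb_le n _)
      · refine ((k τ).le_opNorm _).trans (mul_le_mul_of_nonneg_left ?_ (norm_nonneg _))
        exact (𝒢.norm_res_emb_le n _).trans (𝒢.norm_res_emb_le n _)
    · exact intervalIntegrable_of_muTime ((integrable_norm_mul_norm h₁.memLp_deriv h₂.memLp).add
        (integrable_norm_mul_norm h₂.memLp_deriv h₁.memLp)) h0 ht
    · refine ae_uIoc_of_muTime ht ?_
      filter_upwards [h₁.ae_eq, h₂.ae_eq] with τ e1 e2
      have : ∀ n, (inner ℝ (𝒢.ι (𝒢.res n (𝒢.emb (r τ)))) (𝒢.ι (𝒢.res n (k τ)))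
        + inner ℝ (𝒢.ι (𝒢.res n (g τ))) (𝒢.ι (𝒢.res n (𝒢.emb (s τ)))) : ℝ)
        = g τ (𝒢.res n (𝒢.emb (𝒢.ι (𝒢.res n (𝒢.emb (𝒢.ι (σ τ)))))))
          + k τ (𝒢.res n (𝒢.emb (𝒢.ι (𝒢.res n (𝒢.emb (𝒢.ι (ρ τ))))))) := fun n => by
        rw [e1, e2, real_inner_comm, 𝒢.inner_ι_res, 𝒢.inner_ι_res, add_comm]
      simp_rw [this]
      exact (((g τ).continuous.tendsto _).comp (hRR _)).add
        (((k τ).continuous.tendsto _).comp (hRR _))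
  refine tendsto_nhds_unique hlim ?_
  simp_rw [fun n => (key n).2]
  exact ((𝒢.tendsto_ι_res _).inner (𝒢.tendsto_ι_res _)).sub
    ((𝒢.tendsto_ι_res _).inner (𝒢.tendsto_ι_res _))

end Evolves

end

section

/-! ### Continuous representatives -/

variable {V H K : Type*} [NormedAddCommGroup V] [InnerProductSpace ℝ V] [CompleteSpace V]
  [NormedAddCommGroup H] [InnerProductSpace ℝ H]
  [NormedAddCommGroup K] [InnerProductSpace ℝ K] {𝒢 : FormTriple V H K} {T : ℝ}

section ContinuousRep

variable {ρ : ℝ → V} {g : ℝ → StrongDual ℝ V}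

variable (𝒢) in
/-- The smoothed curve `ι R_n (c + ∫₀ᵗ g)`. -/
def smoothCurve (g : ℝ → StrongDual ℝ V) (c : StrongDual ℝ V) (n : ℕ) (t : ℝ) : H :=
  𝒢.ι (𝒢.res n (c + ∫ s in (0 : ℝ)..t, g s))

variable (𝒢) in
/-- The distance between a curve and its smoothing, measured in `V`. -/
def smoothErr (ρ : ℝ → V) (n : ℕ) (t : ℝ) : ℝ := ‖𝒢.res n (𝒢.emb (𝒢.ι (ρ t))) - ρ t‖

theorem smoothErr_le (n : ℕ) (t : ℝ) : smoothErr 𝒢 ρ n t ≤ 2 * ‖ρ t‖ := by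
  have := norm_sub_le (𝒢.res n (𝒢.emb (𝒢.ι (ρ t)))) (ρ t)
  have h2 := 𝒢.norm_res_emb_le n (ρ t)
  rw [smoothErr]; linarith

theorem tendsto_smoothErr (t : ℝ) : Tendsto (fun n => smoothErr 𝒢 ρ n t) atTop (𝓝 0) :=
  tendsto_iff_norm_sub_tendsto_zero.1 (𝒢.tendsto_res (ρ t))

theorem memLp_smoothErr (hρ : MemLp ρ 2 (muTime T)) (n : ℕ) :
    MemLp (smoothErr 𝒢 ρ n) 2 (muTime T) := by
  refine MemLp.of_le_mul hρ (c := 2) ?_ (Eventually.of_forall fun t => ?_)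
  · exact ((((𝒢.res n).comp (𝒢.emb.comp 𝒢.ι)).continuous.comp_aestronglyMeasurable hρ.1).sub
      hρ.1).norm
  · rw [smoothErr, norm_norm]
    exact smoothErr_le n t

theorem continuousOn_smoothCurve (hT : 0 ≤ T) (hg : MemLp g 2 (muTime T)) (c : StrongDual ℝ V)
    (n : ℕ) : ContinuousOn (smoothCurve 𝒢 g c n) (Icc 0 T) := by
  have h := (absolutelyContinuousOnInterval_primitive (intervalIntegrable_of_muTime
    (integrable_of_memLp_two hg) (left_mem_Icc.2 hT) (right_mem_Icc.2 hT)) c).continuousOn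
  rw [uIcc_of_le hT] at h
  exact (𝒢.ι.comp (𝒢.res n)).continuous.comp_continuousOn h

/-- The quantity controlling the distance in `C([0,T];H)` of the smoothed curves. -/
def smoothBound (𝒢 : FormTriple V H K) (T : ℝ) (ρ : ℝ → V) (g : ℝ → StrongDual ℝ V) (n : ℕ) : ℝ :=
  ∫ t in Ioo 0 T, (2 * smoothErr 𝒢 ρ n t ^ 2 + 8 * T * (‖g t‖ * smoothErr 𝒢 ρ n t))

theorem integrable_smoothBound (hρ : MemLp ρ 2 (muTime T)) (hg : MemLp g 2 (muTime T)) (n : ℕ) :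
    Integrable (fun t => 2 * smoothErr 𝒢 ρ n t ^ 2 + 8 * T * (‖g t‖ * smoothErr 𝒢 ρ n t))
      (muTime T) := by
  have h := memLp_smoothErr (𝒢 := 𝒢) hρ n
  exact (h.integrable_sq.const_mul 2).add ((hg.norm.integrable_mul h).const_mul (8 * T))

theorem tendsto_smoothBound (hρ : MemLp ρ 2 (muTime T)) (hg : MemLp g 2 (muTime T)) (hT : 0 ≤ T) :
    Tendsto (smoothBound 𝒢 T ρ g) atTop (𝓝 0) := by
  have : (0 : ℝ) = ∫ t in Ioo 0 T, (0 : ℝ) := by simp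
  rw [this]
  refine tendsto_integral_of_dominated_convergence
    (fun t => 8 * ‖ρ t‖ ^ 2 + 16 * T * (‖g t‖ * ‖ρ t‖))
    (fun n => (integrable_smoothBound hρ hg n).1) ?_ (fun n => Eventually.of_forall fun t => ?_)
    (Eventually.of_forall fun t => ?_)
  · exact (hρ.norm.integrable_sq.const_mul 8).add
      ((integrable_norm_mul_norm hg hρ).const_mul (16 * T))
  · have h1 := smoothErr_le (𝒢 := 𝒢) (ρ := ρ) n t
    have h2 : 0 ≤ smoothErr 𝒢 ρ n t := norm_nonneg _
    rw [Real.norm_of_nonneg (by positivity)]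
    have h3 : smoothErr 𝒢 ρ n t ^ 2 ≤ (2 * ‖ρ t‖) ^ 2 := by gcongr
    have h4 : ‖g t‖ * smoothErr 𝒢 ρ n t ≤ ‖g t‖ * (2 * ‖ρ t‖) := by gcongr
    have h5 := mul_le_mul_of_nonneg_left h4 hT
    nlinarith
  · have h := tendsto_smoothErr (𝒢 := 𝒢) (ρ := ρ) t
    simpa using ((h.pow 2).const_mul 2).add ((h.const_mul ‖g t‖).const_mul (8 * T))

variable [CompleteSpace H]

/-- The smoothed curves form a Cauchy sequence in `C([0,T];H)`. For the difference `z` of two of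
them, `|‖z(t)‖² - ‖z(s)‖²|` is bounded by the integral of `2 |⟪z', z⟫|`; averaging over `s ∈ (0,T)`
bounds `‖z(t)‖²` itself. -/
theorem norm_smoothCurve_sub_sq_le (hT : 0 < T) (hρ : MemLp ρ 2 (muTime T))
    (hg : MemLp g 2 (muTime T)) {c : StrongDual ℝ V}
    (hc : ∀ᵐ t ∂muTime T, 𝒢.emb (𝒢.ι (ρ t)) = c + ∫ s in (0 : ℝ)..t, g s) (n m : ℕ)
    {t : ℝ} (ht : t ∈ Icc 0 T) :
    T * ‖smoothCurve 𝒢 g c n t - smoothCurve 𝒢 g c m t‖ ^ 2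
      ≤ smoothBound 𝒢 T ρ g n + smoothBound 𝒢 T ρ g m := by
  set L : StrongDual ℝ V →L[ℝ] V := 𝒢.res n - 𝒢.res m with hL
  set z : ℝ → H := fun t => smoothCurve 𝒢 g c n t - smoothCurve 𝒢 g c m t with hz
  have h0 : (0 : ℝ) ∈ Icc 0 T := left_mem_Icc.2 hT.le
  have hgi := integrable_of_memLp_two hg
  have hzL : ∀ t, z t = 𝒢.ι (L (c + ∫ s in (0 : ℝ)..t, g s)) := fun t => by
    simp [hz, hL, smoothCurve]
  have hzp : ∀ t ∈ Icc 0 T, z t = z 0 + ∫ s in (0 : ℝ)..t, 𝒢.ι (L (g s)) := fun t ht => by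
    have := (𝒢.ι.comp L).intervalIntegral_comp_comm (intervalIntegrable_of_muTime hgi h0 ht)
    simp only [ContinuousLinearMap.comp_apply] at this
    rw [this, hzL, hzL, intervalIntegral.integral_same, add_zero, ← map_add, ← map_add]
  have hint : ∀ t ∈ Icc 0 T, IntervalIntegrable (fun s => 𝒢.ι (L (g s))) volume 0 t := fun t ht =>
    intervalIntegrable_of_muTime ((𝒢.ι.comp L).integrable_comp hgi) h0 ht
  -- `‖z(t)‖²` as an integral, and a bound for the integrand
  have hprod := fun t (ht : t ∈ Icc 0 T) => integral_inner_primitive (hint t ht) (hint t ht)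
    (W := z) (Z := z) (fun s hs => hzp s (by
      rw [uIcc_of_le ht.1] at hs; exact ⟨hs.1, hs.2.trans ht.2⟩)) (fun s hs => hzp s (by
      rw [uIcc_of_le ht.1] at hs; exact ⟨hs.1, hs.2.trans ht.2⟩))
  set e : ℝ → ℝ := fun t => smoothErr 𝒢 ρ n t + smoothErr 𝒢 ρ m t with he
  have hLe : ∀ t, ‖L (𝒢.emb (𝒢.ι (ρ t)))‖ ≤ e t := fun t => by
    have : L (𝒢.emb (𝒢.ι (ρ t))) = (𝒢.res n (𝒢.emb (𝒢.ι (ρ t))) - ρ t)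
        - (𝒢.res m (𝒢.emb (𝒢.ι (ρ t))) - ρ t) := by
      simp [hL]
    rw [this]
    exact norm_sub_le _ _
  have hLL : ∀ v, ‖L (𝒢.emb (𝒢.ι v))‖ ≤ 2 * ‖v‖ := fun v => by
    have h1 := norm_sub_le (𝒢.res n (𝒢.emb (𝒢.ι v))) (𝒢.res m (𝒢.emb (𝒢.ι v)))
    have h2 := 𝒢.norm_res_emb_le n v
    have h3 := 𝒢.norm_res_emb_le m v
    simp only [hL, sub_apply]
    linarith
  have hbd : ∀ᵐ s ∂muTime T, ‖(inner ℝ (z s) (𝒢.ι (L (g s))) + inner ℝ (𝒢.ι (L (g s))) (z s) : ℝ)‖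
      ≤ 4 * (‖g s‖ * e s) := by
    filter_upwards [hc] with s hs
    have e1 : z s = 𝒢.ι (L (𝒢.emb (𝒢.ι (ρ s)))) := by rw [hzL, hs]
    have e2 : ∀ h : H, inner ℝ (𝒢.ι (L (g s))) h = g s (L (𝒢.emb h)) := fun h => by
      simp only [hL, sub_apply, map_sub, inner_sub_left, 𝒢.inner_ι_res]
    rw [real_inner_comm, ← two_mul, e2, e1, norm_mul, Real.norm_ofNat]
    have h1 := (g s).le_opNorm (L (𝒢.emb (𝒢.ι (L (𝒢.emb (𝒢.ι (ρ s)))))))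
    have h2 := hLL (L (𝒢.emb (𝒢.ι (ρ s))))
    have h3 := hLe s
    have h4 : ‖g s‖ * ‖L (𝒢.emb (𝒢.ι (L (𝒢.emb (𝒢.ι (ρ s))))))‖ ≤ ‖g s‖ * (2 * e s) := by
      gcongr; linarith
    linarith
  have hei : Integrable (fun s => 4 * (‖g s‖ * e s)) (muTime T) :=
    (hg.norm.integrable_mul ((memLp_smoothErr hρ n).add (memLp_smoothErr hρ m))).const_mul 4
  set I : ℝ := ∫ s in Ioo 0 T, 4 * (‖g s‖ * e s) with hI
  have hdiff : ∀ t ∈ Icc 0 T, |‖z t‖ ^ 2 - ‖z 0‖ ^ 2| ≤ I := fun t ht => by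
    rw [← real_inner_self_eq_norm_sq, ← real_inner_self_eq_norm_sq, ← (hprod t ht).2,
      intervalIntegral.integral_of_le ht.1, ← Real.norm_eq_abs]
    have hsub : Ioc 0 t ⊆ Icc 0 T := fun s hs => ⟨hs.1.le, hs.2.trans ht.2⟩
    have hei' : IntegrableOn (fun s => 4 * (‖g s‖ * e s)) (Icc 0 T) := by
      rw [integrableOn_Icc_iff_integrableOn_Ioo]; exact hei
    refine (norm_integral_le_of_norm_le (hei'.mono_set hsub) (ae_restrict_of_ae_restrict_of_subset
      hsub (by rw [← restrict_Ioo_eq_restrict_Icc]; exact hbd))).trans ?_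
    rw [hI, ← integral_Icc_eq_integral_Ioo]
    refine setIntegral_mono_set hei' (Eventually.of_forall fun s => ?_) hsub.eventuallyLE
    have : 0 ≤ e s := add_nonneg (norm_nonneg _) (norm_nonneg _)
    show (0 : ℝ) ≤ 4 * (‖g s‖ * e s)
    positivity
  have hfin : ∀ᵐ s ∂muTime T, ‖z t‖ ^ 2
      ≤ 2 * smoothErr 𝒢 ρ n s ^ 2 + 2 * smoothErr 𝒢 ρ m s ^ 2 + 2 * I := by
    filter_upwards [hc, ae_restrict_mem measurableSet_Ioo] with s hs hsm
    have h1 := abs_le.1 (hdiff t ht)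
    have h2 := abs_le.1 (hdiff s (Ioo_subset_Icc_self hsm))
    have h3 : ‖z s‖ ≤ e s := by
      rw [hzL, ← hs]
      exact (𝒢.norm_ι_le _).trans (hLe s)
    have h4 : ‖z s‖ ^ 2 ≤ e s ^ 2 := by gcongr
    simp only [he] at h4
    nlinarith [sq_nonneg (smoothErr 𝒢 ρ n s - smoothErr 𝒢 ρ m s)]
  have hn := (memLp_smoothErr (𝒢 := 𝒢) hρ n).integrable_sq.const_mul 2
  have hm := (memLp_smoothErr (𝒢 := 𝒢) hρ m).integrable_sq.const_mul 2
  have hconst : ∀ x : ℝ, ∫ _ in Ioo 0 T, x = T * x := fun x => by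
    simp [hT.le]
  have hmono := integral_mono_ae (integrable_const (μ := muTime T) (‖z t‖ ^ 2))
    ((hn.add hm).add (integrable_const (2 * I))) hfin
  simp only [Pi.add_apply] at hmono
  rw [integral_add (f := fun s => 2 * smoothErr 𝒢 ρ n s ^ 2 + 2 * smoothErr 𝒢 ρ m s ^ 2)
    (hn.add hm) (integrable_const _), integral_add hn hm, hconst, hconst] at hmono
  have hgn : Integrable (fun s => ‖g s‖ * smoothErr 𝒢 ρ n s) (muTime T) :=
    hg.norm.integrable_mul (memLp_smoothErr hρ n)
  have hgm : Integrable (fun s => ‖g s‖ * smoothErr 𝒢 ρ m s) (muTime T) :=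
    hg.norm.integrable_mul (memLp_smoothErr hρ m)
  have hI2 : I = 4 * (∫ s in Ioo 0 T, ‖g s‖ * smoothErr 𝒢 ρ n s)
      + 4 * ∫ s in Ioo 0 T, ‖g s‖ * smoothErr 𝒢 ρ m s := by
    rw [hI, integral_const_mul, ← mul_add, ← integral_add hgn hgm]
    simp only [he, mul_add]
  have hBn : smoothBound 𝒢 T ρ g n = (∫ s in Ioo 0 T, 2 * smoothErr 𝒢 ρ n s ^ 2)
      + 8 * T * ∫ s in Ioo 0 T, ‖g s‖ * smoothErr 𝒢 ρ n s := by
    rw [smoothBound, integral_add hn (hgn.const_mul (8 * T)), integral_const_mul (8 * T)]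
  have hBm : smoothBound 𝒢 T ρ g m = (∫ s in Ioo 0 T, 2 * smoothErr 𝒢 ρ m s ^ 2)
      + 8 * T * ∫ s in Ioo 0 T, ‖g s‖ * smoothErr 𝒢 ρ m s := by
    rw [smoothBound, integral_add hm (hgm.const_mul (8 * T)), integral_const_mul (8 * T)]
  rw [hBn, hBm]
  rw [hI2] at hmono
  linarith

/-- A curve in `L²(0,T;V)` with derivative in `L²(0,T;V')` has a representative in `C([0,T];H)`:
the uniform limit of the smoothed curves. -/
theorem exists_evolves (hT : 0 < T) (hρ : MemLp ρ 2 (muTime T)) (hg : MemLp g 2 (muTime T))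
    (h : IsTimeDeriv T (fun t => 𝒢.emb (𝒢.ι (ρ t))) g) : ∃ r, Evolves 𝒢 T ρ g r := by
  have hgi := integrable_of_memLp_two hg
  obtain ⟨c, hc⟩ := h.exists_primitive hT
    ((𝒢.emb.comp 𝒢.ι).integrable_comp (integrable_of_memLp_two hρ)) hgi
  simp only [ContinuousLinearMap.comp_apply] at hc
  set z := smoothCurve 𝒢 g c with hz
  have hB := tendsto_smoothBound (𝒢 := 𝒢) hρ hg hT.le
  have hcau : UniformCauchySeqOn z atTop (Icc 0 T) := by
    rw [Metric.uniformCauchySeqOn_iff]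
    intro δ hδ
    obtain ⟨N, hN⟩ := eventually_atTop.1 (hB.eventually_lt_const
      (show (0 : ℝ) < T * δ ^ 2 / 2 by positivity))
    refine ⟨N, fun n hn m hm t ht => ?_⟩
    have h1 := norm_smoothCurve_sub_sq_le hT hρ hg hc n m ht
    have h2 := hN n hn
    have h3 := hN m hm
    rw [dist_eq_norm]
    refine lt_of_pow_lt_pow_left₀ 2 hδ.le (lt_of_mul_lt_mul_left ?_ hT.le)
    linarith
  have hlim : ∀ t ∈ Icc 0 T, ∃ y, Tendsto (fun n => z n t) atTop (𝓝 y) := fun t ht =>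
    cauchySeq_tendsto_of_complete (hcau.cauchySeq ht)
  choose! r hr using hlim
  have hunif := hcau.tendstoUniformlyOn_of_tendsto hr
  have hcont : ContinuousOn r (Icc 0 T) := hunif.continuousOn
    (Eventually.of_forall fun n => continuousOn_smoothCurve hT.le hg c n).frequently
  have hae : ∀ᵐ t ∂muTime T, r t = 𝒢.ι (ρ t) := by
    filter_upwards [hc, ae_restrict_mem measurableSet_Ioo] with t h1 h2
    refine tendsto_nhds_unique (hr t (Ioo_subset_Icc_self h2)) ?_
    simp only [hz, smoothCurve, ← h1]
    exact (𝒢.ι.continuous.tendsto _).comp (𝒢.tendsto_res (ρ t))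
  have hGc : ContinuousOn (fun t => c + ∫ s in (0 : ℝ)..t, g s) (Icc 0 T) := by
    have h := (absolutelyContinuousOnInterval_primitive (intervalIntegrable_of_muTime hgi
      (left_mem_Icc.2 hT.le) (right_mem_Icc.2 hT.le)) c).continuousOn
    rwa [uIcc_of_le hT.le] at h
  have heq : EqOn (fun t => 𝒢.emb (r t)) (fun t => c + ∫ s in (0 : ℝ)..t, g s) (Icc 0 T) := by
    refine Measure.eqOn_Icc_of_ae_eq volume hT.ne ?_ (𝒢.emb.continuous.comp_continuousOn hcont) hGc
    rw [← restrict_Ioo_eq_restrict_Icc]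
    filter_upwards [hc, hae] with t h1 h2
    rw [h2, h1]
  refine ⟨r, hρ, hg, hcont, hae, fun t ht => ?_⟩
  have h1 := heq ht
  have h2 := heq (left_mem_Icc.2 hT.le)
  simp only [intervalIntegral.integral_same, add_zero] at h1 h2
  rw [h1, h2]

end ContinuousRep

end

section

variable {V H K : Type*} [NormedAddCommGroup V] [InnerProductSpace ℝ V] [CompleteSpace V]
  [NormedAddCommGroup H] [InnerProductSpace ℝ H] [CompleteSpace H]
  [NormedAddCommGroup K] [InnerProductSpace ℝ K] {𝒢 : FormTriple V H K} {T : ℝ}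

/-! ### Solutions of the evolution equation with a source -/

theorem memLp_of_continuousOn {E : Type*} [NormedAddCommGroup E] {f : ℝ → E}
    (hf : ContinuousOn f (Icc 0 T)) (p : ℝ≥0∞) : MemLp f p (muTime T) := by
  obtain ⟨C, hC⟩ := isCompact_Icc.exists_bound_of_continuousOn hf
  refine MemLp.of_bound ((hf.mono Ioo_subset_Icc_self).aestronglyMeasurable measurableSet_Ioo) C ?_
  filter_upwards [ae_restrict_mem measurableSet_Ioo] with t ht using hC t (Ioo_subset_Icc_self ht)

omit [CompleteSpace H] in
theorem integrable_inner_of_memLp {f g : ℝ → H} (hf : MemLp f 2 (muTime T))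
    (hg : MemLp g 2 (muTime T)) : Integrable (fun t => (inner ℝ (f t) (g t) : ℝ)) (muTime T) :=
  (integrable_norm_mul_norm hf hg).mono' (hf.1.inner hg.1)
    (Eventually.of_forall fun _ => norm_inner_le_norm _ _)

variable (𝒢 T) in
/-- `ρ' + A ρ = f` on `(0,T)` with `f ∈ L²(0,T;H)`; `r` is the continuous representative of `ρ`. -/
structure Solves (ρ : ℝ → V) (f : ℝ → H) (r : ℝ → H) : Prop where
  evolves : Evolves 𝒢 T ρ (fun t => 𝒢.emb (f t) - 𝒢.embD (𝒢.D (ρ t))) r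
  source : MemLp f 2 (muTime T)

omit [CompleteSpace V] [CompleteSpace H] in
theorem memLp_solves_deriv {ρ : ℝ → V} {f : ℝ → H} (hρ : MemLp ρ 2 (muTime T))
    (hf : MemLp f 2 (muTime T)) :
    MemLp (fun t => 𝒢.emb (f t) - 𝒢.embD (𝒢.D (ρ t))) 2 (muTime T) :=
  (𝒢.emb.comp_memLp' hf).sub ((𝒢.embD.comp 𝒢.D).comp_memLp' hρ)

namespace Solves

variable {ρ σ : ℝ → V} {f k : ℝ → H} {r s : ℝ → H}

omit [CompleteSpace V] [CompleteSpace H] in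
theorem sub (h₁ : Solves 𝒢 T ρ f r) (h₂ : Solves 𝒢 T σ k s) :
    Solves 𝒢 T (fun t => ρ t - σ t) (fun t => f t - k t) (fun t => r t - s t) where
  evolves := by
    convert h₁.evolves.sub h₂.evolves using 2 with t
    simp only [map_sub]; abel
  source := h₁.source.sub h₂.source

omit [CompleteSpace V] [CompleteSpace H] in
theorem neg (h₁ : Solves 𝒢 T ρ f r) :
    Solves 𝒢 T (fun t => -ρ t) (fun t => -f t) (fun t => -r t) where
  evolves := by
    convert h₁.evolves.neg using 2 with t
    simp only [map_neg]; abel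
  source := h₁.source.neg

omit [CompleteSpace V] [CompleteSpace H] in
theorem congr {ρ' : ℝ → V} {f' : ℝ → H} (h : Solves 𝒢 T ρ f r)
    (hρ : ρ =ᵐ[muTime T] ρ') (hf : f =ᵐ[muTime T] f') : Solves 𝒢 T ρ' f' r where
  evolves := h.evolves.congr hρ (by
    filter_upwards [hρ, hf] with t h1 h2
    rw [h1, h2])
  source := h.source.ae_eq hf

omit [CompleteSpace V] [CompleteSpace H] in
theorem memLp_rep (h : Solves 𝒢 T ρ f r) : MemLp r 2 (muTime T) :=
  memLp_of_continuousOn h.evolves.cont 2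

/-- Energy inequality; the nonnegative elliptic term `‖D ρ‖²` is dropped. -/
theorem energy (h : Solves 𝒢 T ρ f r) {t : ℝ} (ht : t ∈ Icc 0 T) :
    ‖r t‖ ^ 2 ≤ ‖r 0‖ ^ 2 + 2 * ∫ τ in (0 : ℝ)..t, inner ℝ (f τ) (r τ) := by
  have h0 : (0 : ℝ) ∈ Icc 0 T := ⟨le_rfl, ht.1.trans ht.2⟩
  have key := h.evolves.integral_pairing h.evolves ht
  rw [real_inner_self_eq_norm_sq, real_inner_self_eq_norm_sq] at key
  have hi := integrable_dual_apply h.evolves.memLp_deriv h.evolves.memLp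
  have hfr : Integrable (fun τ => (inner ℝ (f τ) (r τ) : ℝ)) (muTime T) :=
    integrable_inner_of_memLp h.source h.memLp_rep
  have hle : ∫ τ in (0 : ℝ)..t, ((𝒢.emb (f τ) - 𝒢.embD (𝒢.D (ρ τ))) (ρ τ)
      + (𝒢.emb (f τ) - 𝒢.embD (𝒢.D (ρ τ))) (ρ τ))
      ≤ ∫ τ in (0 : ℝ)..t, 2 * inner ℝ (f τ) (r τ) := by
    refine intervalIntegral.integral_mono_ae_restrict ht.1
      (intervalIntegrable_of_muTime (hi.add hi) h0 ht)
      (intervalIntegrable_of_muTime (hfr.const_mul 2) h0 ht) ?_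
    refine ae_restrict_of_ae_restrict_of_subset (Icc_subset_Icc_right ht.2) ?_
    rw [← restrict_Ioo_eq_restrict_Icc]
    filter_upwards [h.evolves.ae_eq] with τ hτ
    simp only [sub_apply, FormTriple.emb_apply, FormTriple.embD_apply, hτ]
    linarith [real_inner_self_nonneg (F := K) (x := 𝒢.D (ρ τ))]
  rw [key, intervalIntegral.integral_const_mul] at hle
  linarith

/-- Energy estimate for a source growing at most linearly in the solution. -/
theorem norm_sq_le (h : Solves 𝒢 T ρ f r) {c b : ℝ} (hc : 0 ≤ c)
    (hf : ∀ᵐ τ ∂muTime T, ‖f τ‖ ≤ c * ‖r τ‖ + b) {t : ℝ} (ht : t ∈ Icc 0 T) :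
    ‖r t‖ ^ 2 ≤ (‖r 0‖ ^ 2 + T * b ^ 2) * Real.exp ((2 * c + 1) * T) := by
  have hT : 0 ≤ T := ht.1.trans ht.2
  have h0 : (0 : ℝ) ∈ Icc 0 T := ⟨le_rfl, hT⟩
  have hfr : Integrable (fun τ => (inner ℝ (f τ) (r τ) : ℝ)) (muTime T) :=
    integrable_inner_of_memLp h.source h.memLp_rep
  have hr2 : Integrable (fun τ => ‖r τ‖ ^ 2) (muTime T) := h.memLp_rep.norm.integrable_sq
  have hcont : ContinuousOn (fun τ => ‖r τ‖ ^ 2) (Icc 0 T) := h.evolves.cont.norm.pow 2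
  have hmain := le_mul_exp_of_le_add_integral (c := ‖r 0‖ ^ 2 + T * b ^ 2) (K := 2 * c + 1) hcont
    (by positivity) (fun t ht => by
      have h1 := h.energy ht
      have h2 : ∫ τ in (0 : ℝ)..t, 2 * inner ℝ (f τ) (r τ)
          ≤ ∫ τ in (0 : ℝ)..t, ((2 * c + 1) * ‖r τ‖ ^ 2 + b ^ 2) := by
        refine intervalIntegral.integral_mono_ae_restrict ht.1
          (intervalIntegrable_of_muTime (hfr.const_mul 2) h0 ht)
          (intervalIntegrable_of_muTime ((hr2.const_mul _).add (integrable_const _)) h0 ht) ?_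
        refine ae_restrict_of_ae_restrict_of_subset (Icc_subset_Icc_right ht.2) ?_
        rw [← restrict_Ioo_eq_restrict_Icc]
        filter_upwards [hf] with τ hτ
        have e1 := real_inner_le_norm (f τ) (r τ)
        have e2 := mul_le_mul_of_nonneg_right hτ (norm_nonneg (r τ))
        nlinarith [sq_nonneg (‖r τ‖ - b)]
      rw [intervalIntegral.integral_const_mul, intervalIntegral.integral_add
        ((intervalIntegrable_of_muTime hr2 h0 ht).const_mul _) intervalIntegrable_const,
        intervalIntegral.integral_const_mul, intervalIntegral.integral_const, sub_zero,
        smul_eq_mul] at h2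
      have h3 : t * b ^ 2 ≤ T * b ^ 2 := mul_le_mul_of_nonneg_right ht.2 (sq_nonneg b)
      linarith) t ht
  refine hmain.trans (mul_le_mul_of_nonneg_left (Real.exp_le_exp.2 ?_) (by positivity))
  exact mul_le_mul_of_nonneg_left ht.2 (by positivity)

/-- Two solutions with the same initial value, whose sources differ by at most a multiple of the
difference of the solutions, coincide. -/
theorem eqOn (h₁ : Solves 𝒢 T ρ f r) (h₂ : Solves 𝒢 T σ k s) {c : ℝ} (hc : 0 ≤ c)
    (hf : ∀ᵐ τ ∂muTime T, ‖f τ - k τ‖ ≤ c * ‖r τ - s τ‖) (h0 : r 0 = s 0) :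
    EqOn r s (Icc 0 T) ∧ ρ =ᵐ[muTime T] σ := by
  have heq : EqOn r s (Icc 0 T) := fun t ht => by
    have := (h₁.sub h₂).norm_sq_le (c := c) (b := 0) hc (by simpa using hf) ht
    simp only [h0, sub_self, norm_zero] at this
    have h2 : ‖r t - s t‖ ^ 2 ≤ 0 := by simpa using this
    have h3 : ‖r t - s t‖ = 0 := by
      have := sq_nonneg ‖r t - s t‖
      exact pow_eq_zero_iff two_ne_zero |>.1 (le_antisymm h2 this)
    exact sub_eq_zero.1 (norm_eq_zero.1 h3)
  refine ⟨heq, ?_⟩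
  filter_upwards [h₁.evolves.ae_eq, h₂.evolves.ae_eq, ae_restrict_mem measurableSet_Ioo]
    with t e1 e2 e3
  exact 𝒢.injective (by rw [← e1, ← e2, heq (Ioo_subset_Icc_self e3)])

end Solves

omit [CompleteSpace H] in
/-- Continuously differentiable curves in `V` are admissible, with the classical derivative. -/
theorem evolves_of_contDiff {φ : ℝ → V} (hφ : ContDiff ℝ 1 φ) :
    Evolves 𝒢 T φ (fun t => 𝒢.emb (𝒢.ι (deriv φ t))) (fun t => 𝒢.ι (φ t)) where
  memLp := memLp_of_continuousOn hφ.continuous.continuousOn 2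
  memLp_deriv := memLp_of_continuousOn (((𝒢.emb.comp 𝒢.ι).continuous.comp
    (hφ.continuous_deriv le_rfl)).continuousOn) 2
  cont := (𝒢.ι.continuous.comp hφ.continuous).continuousOn
  ae_eq := Eventually.of_forall fun _ => rfl
  emb_eq t _ := by
    have hi := (hφ.continuous_deriv le_rfl).intervalIntegrable (μ := volume) 0 t
    have h1 := intervalIntegral.integral_eq_sub_of_hasDerivAt
      (fun s _ => (hφ.differentiable one_ne_zero s).hasDerivAt) hi
    have h2 := (𝒢.emb.comp 𝒢.ι).intervalIntegral_comp_comm hi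
    simp only [ContinuousLinearMap.comp_apply] at h2
    rw [h2, h1, map_sub, map_sub]; abel

/-- A curve satisfying the weak formulation against `C¹` test curves vanishing at the final time is
a solution. -/
theorem exists_solves_of_weak (hT : 0 < T) {ρ : ℝ → V} {f : ℝ → H} {p₀ : H}
    (hρ : MemLp ρ 2 (muTime T)) (hf : MemLp f 2 (muTime T))
    (hw : ∀ φ : ℝ → V, ContDiff ℝ 1 φ → φ T = 0 →
      ∫ t in Ioo 0 T, (-inner ℝ (𝒢.ι (deriv φ t)) (𝒢.ι (ρ t)) + inner ℝ (𝒢.D (φ t)) (𝒢.D (ρ t))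
        - inner ℝ (𝒢.ι (φ t)) (f t)) = inner ℝ p₀ (𝒢.ι (φ 0))) :
    ∃ r, Solves 𝒢 T ρ f r ∧ r 0 = p₀ := by
  set g : ℝ → StrongDual ℝ V := fun t => 𝒢.emb (f t) - 𝒢.embD (𝒢.D (ρ t)) with hg
  have hgL : MemLp g 2 (muTime T) := memLp_solves_deriv hρ hf
  have hgi := integrable_of_memLp_two hgL
  have hρi := integrable_of_memLp_two hρ
  have hEi : Integrable (fun t => 𝒢.emb (𝒢.ι (ρ t))) (muTime T) :=
    (𝒢.emb.comp 𝒢.ι).integrable_comp hρi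
  -- test curves `ψ(t) v` with `ψ` of compact support show that `g` is the time derivative of `ρ`
  have hd : IsTimeDeriv T (fun t => 𝒢.emb (𝒢.ι (ρ t))) g := by
    intro ψ h1 h2 h3
    have hψ1 : ContDiff ℝ 1 ψ := h1.of_le (by exact_mod_cast le_top)
    have hψd : Continuous (deriv ψ) := hψ1.continuous_deriv le_rfl
    have i1 := integrable_test_smul hEi hψd h2.deriv
    have i2 := integrable_test_smul hgi h1.continuous h2
    have hz : ∀ t, t ∉ Ioo 0 T → ψ t = 0 := fun t ht =>
      image_eq_zero_of_notMem_tsupport fun h => ht (h3 h)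
    ext v
    rw [neg_apply, ContinuousLinearMap.integral_apply i1, ContinuousLinearMap.integral_apply i2]
    have hdv : ∀ t, deriv (fun t => ψ t • v) t = deriv ψ t • v := fun t =>
      ((hψ1.differentiable one_ne_zero t).hasDerivAt.smul_const v).deriv
    have key := hw (fun t => ψ t • v) (hψ1.smul contDiff_const) (by rw [hz T (by simp), zero_smul])
    rw [hz 0 (by simp), zero_smul, map_zero, inner_zero_right] at key
    have i1' := i1.apply_continuousLinearMap v
    have i2' := i2.apply_continuousLinearMap v
    have e : ∀ t, (-inner ℝ (𝒢.ι (deriv (fun t => ψ t • v) t)) (𝒢.ι (ρ t))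
        + inner ℝ (𝒢.D (ψ t • v)) (𝒢.D (ρ t)) - inner ℝ (𝒢.ι (ψ t • v)) (f t) : ℝ)
        = -((deriv ψ t • 𝒢.emb (𝒢.ι (ρ t))) v + (ψ t • g t) v) := fun t => by
      rw [hdv]
      simp only [hg, map_smul, inner_smul_left, smul_apply, sub_apply,
        FormTriple.emb_apply, FormTriple.embD_apply, smul_eq_mul, real_inner_comm,
        RCLike.conj_to_real]
      ring
    simp_rw [e] at key
    rw [integral_neg, integral_add i1' i2'] at key
    linarith
  obtain ⟨r, hr⟩ := exists_evolves hT hρ hgL hd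
  refine ⟨r, ⟨hr, hf⟩, ?_⟩
  -- the test curves `(T - t) v` determine the initial value
  refine 𝒢.emb_injective ?_
  ext v
  set φ : ℝ → V := fun t => (T - t) • v with hφ
  have hφC : ContDiff ℝ 1 φ := (contDiff_const.sub contDiff_id).smul contDiff_const
  have hdφ : ∀ t, deriv φ t = -v := fun t => by
    have : HasDerivAt (fun t : ℝ => T - t) (-1) t := by
      simpa using (hasDerivAt_id t).const_sub T
    simpa using (this.smul_const v).deriv
  have key := hw φ hφC (by simp [hφ])
  have hpair := hr.integral_pairing (evolves_of_contDiff (𝒢 := 𝒢) (T := T) hφC)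
    (right_mem_Icc.2 hT.le)
  rw [← integral_Ioo_eq hT.le] at hpair
  have e : ∀ t, (-inner ℝ (𝒢.ι (deriv φ t)) (𝒢.ι (ρ t)) + inner ℝ (𝒢.D (φ t)) (𝒢.D (ρ t))
        - inner ℝ (𝒢.ι (φ t)) (f t) : ℝ)
        = -(g t (φ t) + 𝒢.emb (𝒢.ι (deriv φ t)) (ρ t)) := fun t => by
    simp only [hg, sub_apply, FormTriple.emb_apply, FormTriple.embD_apply]
    rw [real_inner_comm (𝒢.D (ρ t)), real_inner_comm (f t)]
    ring
  simp_rw [e] at key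
  rw [integral_neg, hpair] at key
  simp only [hφ, sub_self, zero_smul, map_zero, inner_zero_right, sub_zero, zero_sub, neg_neg,
    map_smul, inner_smul_right] at key
  exact mul_left_cancel₀ hT.ne' key

end

section

/-! ### Existence by projection onto test curves -/

/-- The projection theorem of Lions: if `|L φ| ≤ C ‖S φ‖`, then `L` is represented as
`φ ↦ ⟪p, S φ⟫`. No topology on the space of test functions is needed. -/
theorem exists_inner_eq_of_le {X Φ : Type*} [NormedAddCommGroup X] [InnerProductSpace ℝ X]
    [CompleteSpace X] [AddCommGroup Φ] [Module ℝ Φ] (S : Φ →ₗ[ℝ] X) (L : Φ →ₗ[ℝ] ℝ) (C : ℝ)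
    (h : ∀ φ, |L φ| ≤ C * ‖S φ‖) : ∃ p : X, ∀ φ, inner ℝ p (S φ) = L φ := by
  have hker : LinearMap.ker S ≤ LinearMap.ker L := fun φ hφ => by
    have := h φ
    rw [LinearMap.mem_ker.1 hφ, norm_zero, mul_zero] at this
    exact LinearMap.mem_ker.2 (abs_nonpos_iff.1 this)
  let L₁ : LinearMap.range S →ₗ[ℝ] ℝ :=
    ((LinearMap.ker S).liftQ L hker).comp (S.quotKerEquivRange.symm : LinearMap.range S →ₗ[ℝ] _)
  have hL₁ : ∀ φ (hφ : S φ ∈ LinearMap.range S), L₁ ⟨S φ, hφ⟩ = L φ := fun φ hφ => by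
    have : S.quotKerEquivRange.symm ⟨S φ, hφ⟩ = (LinearMap.ker S).mkQ φ :=
      S.quotKerEquivRange_symm_apply_image φ hφ
    simp only [L₁, LinearMap.comp_apply, LinearEquiv.coe_coe, this]
    simp
  let L₂ : StrongDual ℝ (LinearMap.range S) := L₁.mkContinuous C (by
    rintro ⟨_, φ, rfl⟩
    exact (congrArg norm (hL₁ φ ⟨φ, rfl⟩)).trans_le (h φ))
  obtain ⟨g, hg, -⟩ := _root_.exists_extension_norm_eq (𝕜 := ℝ) (LinearMap.range S) L₂
  refine ⟨riesz X g, fun φ => ?_⟩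
  rw [inner_riesz]
  have := hg ⟨S φ, φ, rfl⟩
  rw [this]
  exact hL₁ φ _

variable {V H K : Type*} [NormedAddCommGroup V] [InnerProductSpace ℝ V] [CompleteSpace V]
  [NormedAddCommGroup H] [InnerProductSpace ℝ H] [CompleteSpace H]
  [NormedAddCommGroup K] [InnerProductSpace ℝ K] {𝒢 : FormTriple V H K} {T : ℝ}

/-- Test curves: `C¹` with values in `V`, vanishing at the final time. -/
def testCurves (V : Type*) [NormedAddCommGroup V] [InnerProductSpace ℝ V] (T : ℝ) :
    Submodule ℝ (ℝ → V) where
  carrier := {φ | ContDiff ℝ 1 φ ∧ φ T = 0}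
  zero_mem' := ⟨contDiff_const, rfl⟩
  add_mem' h₁ h₂ := ⟨h₁.1.add h₂.1, by simp [h₁.2, h₂.2]⟩
  smul_mem' c _ h := ⟨h.1.const_smul c, by simp [h.2]⟩

omit [CompleteSpace V] in
theorem norm_sq_Lp (p : Lp V 2 (muTime T)) : ‖p‖ ^ 2 = ∫ t in Ioo 0 T, ‖p t‖ ^ 2 := by
  rw [← real_inner_self_eq_norm_sq, L2.inner_def]
  simp_rw [real_inner_self_eq_norm_sq]

omit [CompleteSpace V] in
theorem integral_norm_le (hT : 0 ≤ T) (p : Lp V 2 (muTime T)) :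
    ∫ t in Ioo 0 T, ‖p t‖ ≤ (T + 1) / 2 * ‖p‖ := by
  have hp := Lp.memLp p
  have hi := integrable_of_memLp_two hp
  rcases eq_or_ne ‖p‖ 0 with h | h
  · have h2 := norm_sq_Lp p
    rw [norm_eq_zero] at h
    subst h
    have : ∫ t in Ioo 0 T, ‖(0 : Lp V 2 (muTime T)) t‖ = ∫ t in Ioo 0 T, (0 : ℝ) := by
      refine integral_congr_ae ?_
      filter_upwards [Lp.coeFn_zero V 2 (muTime T)] with t ht
      rw [ht]; simp
    rw [this]; simp
  · have hpos : 0 < ‖p‖ := lt_of_le_of_ne (norm_nonneg _) (Ne.symm h)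
    have h1 : ∫ t in Ioo 0 T, ‖p‖ * ‖p t‖ ≤ ∫ t in Ioo 0 T, (‖p‖ ^ 2 / 2 + ‖p t‖ ^ 2 / 2) :=
      integral_mono (hi.norm.const_mul _)
        ((integrable_const _).add (hp.norm.integrable_sq.div_const 2))
        fun t => by
          show ‖p‖ * ‖p t‖ ≤ ‖p‖ ^ 2 / 2 + ‖p t‖ ^ 2 / 2
          nlinarith [sq_nonneg (‖p‖ - ‖p t‖)]
    rw [integral_const_mul, integral_add (integrable_const _) (hp.norm.integrable_sq.div_const 2),
      integral_div _ (fun t => ‖p t‖ ^ 2), ← norm_sq_Lp] at h1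
    have h2 : ∫ _ in Ioo 0 T, ‖p‖ ^ 2 / 2 = T * (‖p‖ ^ 2 / 2) := by simp [hT]
    rw [h2] at h1
    refine le_of_mul_le_mul_left ?_ hpos
    nlinarith

/-- The integrand of the weak formulation, as a functional of the value of the solution. -/
def weakIntegrand (𝒢 : FormTriple V H K) (B : ℝ → H →L[ℝ] H) (φ : ℝ → V) (t : ℝ) :
    StrongDual ℝ V :=
  𝒢.embD (𝒢.D (φ t)) - 𝒢.emb (𝒢.ι (deriv φ t)) - ((innerSL ℝ (𝒢.ι (φ t))).comp (B t)).comp 𝒢.ι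

omit [CompleteSpace V] [CompleteSpace H] in
theorem weakIntegrand_apply (B : ℝ → H →L[ℝ] H) (φ : ℝ → V) (t : ℝ) (v : V) :
    weakIntegrand 𝒢 B φ t v = inner ℝ (𝒢.D (φ t)) (𝒢.D v) - inner ℝ (𝒢.ι (deriv φ t)) (𝒢.ι v)
      - inner ℝ (𝒢.ι (φ t)) (B t (𝒢.ι v)) := rfl

/-- A uniformly bounded family of operators on `H`, measurable in time in the sense that it maps
measurable curves to measurable curves. -/
structure BoundedFamily (T : ℝ) (B : ℝ → H →L[ℝ] H) (c : ℝ) : Prop where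
  nonneg : 0 ≤ c
  le : ∀ t h, ‖B t h‖ ≤ c * ‖h‖
  meas : ∀ p : ℝ → H, AEStronglyMeasurable p (muTime T) →
    AEStronglyMeasurable (fun t => B t (p t)) (muTime T)

variable {B : ℝ → H →L[ℝ] H} {c : ℝ}

omit [CompleteSpace H] in
theorem BoundedFamily.memLp (hB : BoundedFamily T B c) {p : ℝ → H} (hp : MemLp p 2 (muTime T)) :
    MemLp (fun t => B t (p t)) 2 (muTime T) :=
  MemLp.of_le_mul hp (hB.meas p hp.1) (Eventually.of_forall fun t => hB.le t _)

omit [CompleteSpace H] in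
theorem BoundedFamily.reverse (hB : BoundedFamily T B c) :
    BoundedFamily T (fun t => B (T - t)) c where
  nonneg := hB.nonneg
  le t h := hB.le _ h
  meas p hp := by
    have h1 := hp.comp_measurePreserving (measurePreserving_reverse T)
    have h2 := (hB.meas _ h1).comp_measurePreserving (measurePreserving_reverse T)
    refine h2.congr (Eventually.of_forall fun t => ?_)
    simp

omit [CompleteSpace V] [CompleteSpace H] in
theorem integrable_weakIntegrand (hB : BoundedFamily T B c) {φ : ℝ → V} (hφ : ContDiff ℝ 1 φ)
    {ρ : ℝ → V} (hρ : MemLp ρ 2 (muTime T)) :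
    Integrable (fun t => weakIntegrand 𝒢 B φ t (ρ t)) (muTime T) := by
  have h1 : MemLp φ 2 (muTime T) := memLp_of_continuousOn hφ.continuous.continuousOn 2
  have h2 : MemLp (deriv φ) 2 (muTime T) :=
    memLp_of_continuousOn (hφ.continuous_deriv le_rfl).continuousOn 2
  have h3 := 𝒢.ι.comp_memLp' hρ
  exact ((integrable_inner_of_memLp (𝒢.D.comp_memLp' h1) (𝒢.D.comp_memLp' hρ)).sub
    (integrable_inner_of_memLp (𝒢.ι.comp_memLp' h2) h3)).sub
    (integrable_inner_of_memLp (𝒢.ι.comp_memLp' h1) (hB.memLp h3))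

omit [CompleteSpace V] [CompleteSpace H] in
theorem exists_weakIntegrand_bound (hB : BoundedFamily T B c) {φ : ℝ → V} (hφ : ContDiff ℝ 1 φ) :
    ∃ C, ∀ t ∈ Icc 0 T, ∀ v, ‖weakIntegrand 𝒢 B φ t v‖ ≤ C * ‖v‖ := by
  obtain ⟨C₁, h₁⟩ := isCompact_Icc.exists_bound_of_continuousOn (s := Icc 0 T)
    hφ.continuous.continuousOn
  obtain ⟨C₂, h₂⟩ := isCompact_Icc.exists_bound_of_continuousOn (s := Icc 0 T)
    (hφ.continuous_deriv le_rfl).continuousOn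
  refine ⟨C₁ + C₂ + C₁ * c, fun t ht v => ?_⟩
  have e1 : ‖(inner ℝ (𝒢.D (φ t)) (𝒢.D v) : ℝ)‖ ≤ C₁ * ‖v‖ :=
    (norm_inner_le_norm _ _).trans (mul_le_mul ((𝒢.norm_D_le _).trans (h₁ t ht)) (𝒢.norm_D_le _)
      (norm_nonneg _) ((norm_nonneg _).trans (h₁ t ht)))
  have e2 : ‖(inner ℝ (𝒢.ι (deriv φ t)) (𝒢.ι v) : ℝ)‖ ≤ C₂ * ‖v‖ :=
    (norm_inner_le_norm _ _).trans (mul_le_mul ((𝒢.norm_ι_le _).trans (h₂ t ht)) (𝒢.norm_ι_le _)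
      (norm_nonneg _) ((norm_nonneg _).trans (h₂ t ht)))
  have e3 : ‖(inner ℝ (𝒢.ι (φ t)) (B t (𝒢.ι v)) : ℝ)‖ ≤ C₁ * (c * ‖v‖) :=
    (norm_inner_le_norm _ _).trans (mul_le_mul ((𝒢.norm_ι_le _).trans (h₁ t ht))
      ((hB.le t _).trans (mul_le_mul_of_nonneg_left (𝒢.norm_ι_le _) hB.nonneg))
      (norm_nonneg _) ((norm_nonneg _).trans (h₁ t ht)))
  rw [weakIntegrand_apply]
  refine (norm_sub_le _ _).trans ?_
  have := norm_sub_le (inner ℝ (𝒢.D (φ t)) (𝒢.D v)) (inner ℝ (𝒢.ι (deriv φ t)) (𝒢.ι v) : ℝ)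
  nlinarith

/-- The weak formulation tested with `φ`, as a functional on `L²(0,T;V)`. -/
def weakFunctional (𝒢 : FormTriple V H K) (hT : 0 ≤ T) (hB : BoundedFamily T B c) {φ : ℝ → V}
    (hφ : ContDiff ℝ 1 φ) : StrongDual ℝ (Lp V 2 (muTime T)) :=
  LinearMap.mkContinuousOfExistsBound
    { toFun := fun p => ∫ t in Ioo 0 T, weakIntegrand 𝒢 B φ t (p t)
      map_add' := fun p q => by
        rw [← integral_add (integrable_weakIntegrand hB hφ (Lp.memLp p))
          (integrable_weakIntegrand hB hφ (Lp.memLp q))]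
        refine integral_congr_ae ?_
        filter_upwards [Lp.coeFn_add p q] with t ht
        rw [ht, Pi.add_apply, map_add]
      map_smul' := fun a p => by
        rw [RingHom.id_apply, smul_eq_mul, ← integral_const_mul]
        refine integral_congr_ae ?_
        filter_upwards [Lp.coeFn_smul a p] with t ht
        rw [ht, Pi.smul_apply, map_smul, smul_eq_mul] }
    (by
      obtain ⟨C, hC⟩ := exists_weakIntegrand_bound (𝒢 := 𝒢) hB hφ
      refine ⟨|C| * ((T + 1) / 2), fun p => ?_⟩
      have hi := integrable_of_memLp_two (Lp.memLp p)
      refine (norm_integral_le_of_norm_le (hi.norm.const_mul |C|) ?_).trans ?_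
      · filter_upwards [ae_restrict_mem measurableSet_Ioo] with t ht
        exact (hC t (Ioo_subset_Icc_self ht) _).trans
          (mul_le_mul_of_nonneg_right (le_abs_self C) (norm_nonneg _))
      · rw [integral_const_mul, mul_assoc]
        exact mul_le_mul_of_nonneg_left (integral_norm_le hT p) (abs_nonneg C))

omit [CompleteSpace V] [CompleteSpace H] in
theorem weakFunctional_apply (hT : 0 ≤ T) (hB : BoundedFamily T B c) {φ : ℝ → V}
    (hφ : ContDiff ℝ 1 φ) (p : Lp V 2 (muTime T)) :
    weakFunctional 𝒢 hT hB hφ p = ∫ t in Ioo 0 T, weakIntegrand 𝒢 B φ t (p t) := rfl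

/-- `φ ↦ S φ`, where `⟪S φ, p⟫` is the weak formulation for `p` tested with `φ`. -/
def weakOperator (𝒢 : FormTriple V H K) (hT : 0 ≤ T) (hB : BoundedFamily T B c) :
    testCurves V T →ₗ[ℝ] Lp V 2 (muTime T) where
  toFun φ := riesz _ (weakFunctional 𝒢 hT hB φ.2.1)
  map_add' φ ψ := by
    rw [← map_add]
    congr 1
    ext p
    rw [add_apply, weakFunctional_apply, weakFunctional_apply, weakFunctional_apply,
      ← integral_add (integrable_weakIntegrand hB φ.2.1 (Lp.memLp p))
        (integrable_weakIntegrand hB ψ.2.1 (Lp.memLp p))]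
    congr 1
    ext t
    have hd : deriv ((φ : ℝ → V) + (ψ : ℝ → V)) t = deriv φ t + deriv ψ t :=
      deriv_add (φ.2.1.differentiable one_ne_zero t) (ψ.2.1.differentiable one_ne_zero t)
    simp only [weakIntegrand_apply, hd, Submodule.coe_add, Pi.add_apply, map_add, inner_add_left]
    ring
  map_smul' a φ := by
    rw [RingHom.id_apply, ← map_smul]
    congr 1
    ext p
    rw [smul_apply, weakFunctional_apply, weakFunctional_apply, smul_eq_mul, ← integral_const_mul]
    congr 1
    ext t
    have hd : deriv (a • (φ : ℝ → V)) t = a • deriv φ t :=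
      deriv_const_smul a (φ.2.1.differentiable one_ne_zero t)
    simp only [weakIntegrand_apply, hd, Submodule.coe_smul, Pi.smul_apply, map_smul,
      inner_smul_left, RCLike.conj_to_real]
    ring

omit [CompleteSpace H] in
theorem inner_weakOperator (hT : 0 ≤ T) (hB : BoundedFamily T B c) (φ : testCurves V T)
    (p : Lp V 2 (muTime T)) :
    inner ℝ (weakOperator 𝒢 hT hB φ) p = ∫ t in Ioo 0 T, weakIntegrand 𝒢 B φ t (p t) :=
  inner_riesz _ _

omit [CompleteSpace V] [CompleteSpace H] in
/-- Coercivity: the weak formulation for `e^{2(c+1)t} φ`, tested with `φ`, dominates both the norm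
in `L²(0,T;V)` and the initial value of `φ`. -/
theorem weakIntegrand_coercive (hT : 0 ≤ T) (hB : BoundedFamily T B c) {φ : ℝ → V}
    (hφ : ContDiff ℝ 1 φ) (hφT : φ T = 0) :
    1 / 2 * ‖𝒢.ι (φ 0)‖ ^ 2 + ∫ t in Ioo 0 T, ‖φ t‖ ^ 2
      ≤ ∫ t in Ioo 0 T, weakIntegrand 𝒢 B φ t (Real.exp (2 * (c + 1) * t) • φ t) := by
  set θ : ℝ → ℝ := fun t => Real.exp (2 * (c + 1) * t) with hθ
  have hθd : ∀ t, HasDerivAt θ (2 * (c + 1) * θ t) t := fun t => by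
    have := ((hasDerivAt_id t).const_mul (2 * (c + 1))).exp
    simpa [hθ, mul_comm] using this
  have hθc : ContDiff ℝ 1 θ := by simp only [hθ]; fun_prop
  have hd : ∀ t, HasDerivAt (fun t => 1 / 2 * (θ t * ‖𝒢.ι (φ t)‖ ^ 2))
      ((c + 1) * θ t * ‖𝒢.ι (φ t)‖ ^ 2 + θ t * inner ℝ (𝒢.ι (deriv φ t)) (𝒢.ι (φ t))) t := fun t => by
    have h1 := 𝒢.ι.hasFDerivAt.comp_hasDerivAt t (hφ.differentiable one_ne_zero t).hasDerivAt
    have h2 := (h1.inner ℝ h1)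
    have h3 := ((hθd t).mul h2).const_mul (1 / 2)
    simp only [Function.comp_apply, real_inner_self_eq_norm_sq] at h3
    refine h3.congr_deriv ?_
    rw [real_inner_comm (𝒢.ι (deriv φ t))]
    ring
  have hcont : Continuous fun t =>
      (c + 1) * θ t * ‖𝒢.ι (φ t)‖ ^ 2 + θ t * inner ℝ (𝒢.ι (deriv φ t)) (𝒢.ι (φ t)) := by
    have h1 := 𝒢.ι.continuous.comp hφ.continuous
    have h2 := 𝒢.ι.continuous.comp (hφ.continuous_deriv le_rfl)
    exact ((continuous_const.mul hθc.continuous).mul (h1.norm.pow 2)).add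
      (hθc.continuous.mul (h2.inner h1))
  have hftc := intervalIntegral.integral_eq_sub_of_hasDerivAt (fun t _ => hd t)
    (hcont.intervalIntegrable 0 T)
  rw [hφT, map_zero, norm_zero, ← integral_Ioo_eq hT] at hftc
  have h0 : θ 0 = 1 := by simp [hθ]
  rw [h0] at hftc
  have hMem : ∀ {E : Type _} [NormedAddCommGroup E] {f : ℝ → E}, Continuous f →
    Integrable f (muTime T) := fun hf =>
      (memLp_of_continuousOn hf.continuousOn 1).integrable le_rfl
  have hθφ : MemLp (fun t => θ t • φ t) 2 (muTime T) :=
    memLp_of_continuousOn (hθc.continuous.smul hφ.continuous).continuousOn 2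
  -- the weight is at least one and its growth absorbs the operators `B t`
  have hmono : ∫ t in Ioo 0 T, (‖φ t‖ ^ 2 - ((c + 1) * θ t * ‖𝒢.ι (φ t)‖ ^ 2
      + θ t * inner ℝ (𝒢.ι (deriv φ t)) (𝒢.ι (φ t))))
      ≤ ∫ t in Ioo 0 T, weakIntegrand 𝒢 B φ t (θ t • φ t) := by
    refine integral_mono_ae ((hMem (hφ.continuous.norm.pow 2)).sub (hMem hcont))
      (integrable_weakIntegrand hB hφ hθφ) ?_
    filter_upwards [ae_restrict_mem measurableSet_Ioo] with t ht
    rw [map_smul, weakIntegrand_apply, real_inner_self_eq_norm_sq, smul_eq_mul, 𝒢.norm_sq]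
    have hθ1 : 1 ≤ θ t := Real.one_le_exp (mul_nonneg (by linarith [hB.nonneg]) ht.1.le)
    have h1 : inner ℝ (𝒢.ι (φ t)) (B t (𝒢.ι (φ t))) ≤ c * ‖𝒢.ι (φ t)‖ ^ 2 := by
      refine (real_inner_le_norm _ _).trans ?_
      have := mul_le_mul_of_nonneg_left (hB.le t (𝒢.ι (φ t))) (norm_nonneg (𝒢.ι (φ t)))
      nlinarith
    nlinarith [sq_nonneg ‖𝒢.ι (φ t)‖, sq_nonneg ‖𝒢.D (φ t)‖,
      mul_le_mul_of_nonneg_left h1 (zero_le_one.trans hθ1)]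
  rw [integral_sub (f := fun t => ‖φ t‖ ^ 2) (hMem (hφ.continuous.norm.pow 2)) (hMem hcont),
    hftc] at hmono
  linarith

/-- Existence for the homogeneous equation `ρ' + A ρ = B ρ` with given initial value: by coercivity,
the functional `φ ↦ ⟪p₀, φ(0)⟫` is bounded by `‖S φ‖`, so the projection theorem provides a curve
satisfying the weak formulation. -/
theorem exists_solves (𝒢 : FormTriple V H K) (hT : 0 < T) (hB : BoundedFamily T B c) (p₀ : H) :
    ∃ (ρ : ℝ → V) (r : ℝ → H), Solves 𝒢 T ρ (fun t => B t (r t)) r ∧ r 0 = p₀ := by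
  set M : ℝ := Real.exp (2 * (c + 1) * T) with hM
  have hM1 : 0 < M := Real.exp_pos _
  let L : testCurves V T →ₗ[ℝ] ℝ :=
    { toFun := fun φ => inner ℝ p₀ (𝒢.ι ((φ : ℝ → V) 0))
      map_add' := fun φ ψ => by
        rw [Submodule.coe_add, Pi.add_apply, map_add, inner_add_right]
      map_smul' := fun a φ => by
        rw [Submodule.coe_smul, Pi.smul_apply, map_smul, inner_smul_right]; rfl }
  obtain ⟨p, hp⟩ := exists_inner_eq_of_le (weakOperator 𝒢 hT.le hB) L (‖p₀‖ * (2 * M)) (fun φ => by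
    have hφ := φ.2.1
    have hφ2 : MemLp (φ : ℝ → V) 2 (muTime T) :=
      memLp_of_continuousOn hφ.continuous.continuousOn 2
    have hθφ : MemLp (fun t => Real.exp (2 * (c + 1) * t) • (φ : ℝ → V) t) 2 (muTime T) :=
      memLp_of_continuousOn (Continuous.smul (by fun_prop) hφ.continuous).continuousOn 2
    have hco := weakIntegrand_coercive (𝒢 := 𝒢) hT.le hB hφ φ.2.2
    set s := ‖weakOperator 𝒢 hT.le hB φ‖ with hs
    set N := ‖hφ2.toLp‖ with hN
    have e1 : ∫ t in Ioo 0 T, weakIntegrand 𝒢 B φ t (Real.exp (2 * (c + 1) * t) • (φ : ℝ → V) t)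
        = inner ℝ (weakOperator 𝒢 hT.le hB φ) hθφ.toLp := by
      rw [inner_weakOperator]
      refine integral_congr_ae ?_
      filter_upwards [hθφ.coeFn_toLp] with t ht
      rw [ht]
    have e2 : ∫ t in Ioo 0 T, ‖(φ : ℝ → V) t‖ ^ 2 = N ^ 2 := by
      rw [hN, norm_sq_Lp]
      refine integral_congr_ae ?_
      filter_upwards [hφ2.coeFn_toLp] with t ht
      rw [ht]
    have e3 : ‖hθφ.toLp‖ ≤ M * N := by
      refine Lp.norm_le_mul_norm_of_ae_le_mul ?_
      filter_upwards [hθφ.coeFn_toLp, hφ2.coeFn_toLp, ae_restrict_mem measurableSet_Ioo]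
        with t h1 h2 h3
      rw [h1, h2, norm_smul, Real.norm_of_nonneg (Real.exp_pos _).le]
      refine mul_le_mul_of_nonneg_right (Real.exp_le_exp.2 ?_) (norm_nonneg _)
      exact mul_le_mul_of_nonneg_left h3.2.le (by linarith [hB.nonneg])
    have e4 := real_inner_le_norm (weakOperator 𝒢 hT.le hB φ) hθφ.toLp
    rw [e1, e2] at hco
    have hs0 : 0 ≤ s := norm_nonneg _
    have hN0 : 0 ≤ N := norm_nonneg _
    have e5 : 1 / 2 * ‖𝒢.ι ((φ : ℝ → V) 0)‖ ^ 2 + N ^ 2 ≤ s * (M * N) :=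
      hco.trans (e4.trans (mul_le_mul_of_nonneg_left e3 hs0))
    have e6 : ‖𝒢.ι ((φ : ℝ → V) 0)‖ ≤ 2 * M * s := by
      refine abs_le_of_sq_le_sq' ?_ (by positivity) |>.2
      nlinarith [sq_nonneg (s * M - N), sq_nonneg (s * M)]
    calc |L φ| ≤ ‖p₀‖ * ‖𝒢.ι ((φ : ℝ → V) 0)‖ := abs_real_inner_le_norm _ _
      _ ≤ ‖p₀‖ * (2 * M * s) := mul_le_mul_of_nonneg_left e6 (norm_nonneg _)
      _ = _ := by ring)
  have hpL := Lp.memLp p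
  have hBp := hB.memLp (𝒢.ι.comp_memLp' hpL)
  obtain ⟨r, hr, hr0⟩ := exists_solves_of_weak (𝒢 := 𝒢) hT hpL hBp (p₀ := p₀) (fun φ hφ hφT => by
    have := hp ⟨φ, hφ, hφT⟩
    rw [real_inner_comm, inner_weakOperator] at this
    refine Eq.trans (integral_congr_ae (Eventually.of_forall fun t => ?_)) this
    simp only [weakIntegrand_apply, Function.comp_apply]
    ring)
  refine ⟨p, r, hr.congr (Filter.EventuallyEq.refl _ _) ?_, hr0⟩
  filter_upwards [hr.evolves.ae_eq] with t ht
  simp only [Function.comp_apply, ht]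

end

section

/-! ### The maximum principle -/

variable {V H K : Type*} [NormedAddCommGroup V] [InnerProductSpace ℝ V]
  [NormedAddCommGroup H] [InnerProductSpace ℝ H]
  [NormedAddCommGroup K] [InnerProductSpace ℝ K] {𝒢 : FormTriple V H K} {T : ℝ}

/-- The properties of the positive part used in the truncation argument: `P` is the gradient of the
convex function `‖P ·‖² / 2`, it is nonexpansive, and it acts on `V` compatibly with the form. -/
structure IsTruncation (𝒢 : FormTriple V H K) (P : H → H) : Prop where
  zero : P 0 = 0
  nonexpansive : ∀ x y, ‖P x - P y‖ ≤ ‖x - y‖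
  gradient : ∀ x y, 1 / 2 * ‖P x‖ ^ 2 + inner ℝ (P x) (y - x) ≤ 1 / 2 * ‖P y‖ ^ 2
  lift : ∀ v, ∃ w, 𝒢.ι w = P (𝒢.ι v) ∧ 0 ≤ inner ℝ (𝒢.D v) (𝒢.D w)

namespace IsTruncation

variable {P : H → H} (hP : IsTruncation 𝒢 P)
include hP

theorem norm_le (x : H) : ‖P x‖ ≤ ‖x‖ := by
  simpa [hP.zero] using hP.nonexpansive x 0

theorem continuous : Continuous P :=
  (LipschitzWith.of_dist_le_mul (K := 1) fun x y => by
    rw [dist_eq_norm, dist_eq_norm, NNReal.coe_one, one_mul]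
    exact hP.nonexpansive x y).continuous

theorem hasFDerivAt (x : H) : HasFDerivAt (fun x => 1 / 2 * ‖P x‖ ^ 2) (innerSL ℝ (P x)) x := by
  rw [hasFDerivAt_iff_isLittleO_nhds_zero]
  refine Asymptotics.IsBigO.trans_isLittleO (g := fun h : H => ‖h‖ ^ 2) ?_ ?_
  · refine Asymptotics.IsBigO.of_bound 1 (Eventually.of_forall fun h => ?_)
    have h1 := hP.gradient x (x + h)
    have h2 := hP.gradient (x + h) x
    have h3 := real_inner_le_norm (P (x + h) - P x) h
    have h4 := hP.nonexpansive (x + h) x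
    rw [add_sub_cancel_left] at h1 h4
    rw [sub_add_cancel_left, inner_neg_right] at h2
    rw [inner_sub_left] at h3
    have h5 := mul_le_mul_of_nonneg_right h4 (norm_nonneg h)
    rw [innerSL_apply_apply, Real.norm_eq_abs, norm_pow, norm_norm, abs_le]
    constructor <;> nlinarith
  · exact (Asymptotics.isLittleO_norm_pow_id one_lt_two)

/-- `‖P ·‖² / 2` is Lipschitz continuous on bounded sets. -/
theorem abs_sub_le (R : ℝ) : ∃ L : ℝ, ∀ x y : H, ‖x‖ ≤ R → ‖y‖ ≤ R →
    |1 / 2 * ‖P x‖ ^ 2 - 1 / 2 * ‖P y‖ ^ 2| ≤ L * ‖x - y‖ := by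
  refine ⟨R, fun x y hx hy => ?_⟩
  have h1 := (hP.norm_le x).trans hx
  have h2 := (hP.norm_le y).trans hy
  have h3 := (abs_norm_sub_norm_le (P x) (P y)).trans (hP.nonexpansive x y)
  have e : 1 / 2 * ‖P x‖ ^ 2 - 1 / 2 * ‖P y‖ ^ 2
      = (‖P x‖ + ‖P y‖) / 2 * (‖P x‖ - ‖P y‖) := by ring
  rw [e, abs_mul, abs_of_nonneg (by positivity)]
  exact mul_le_mul (by linarith) h3 (abs_nonneg _) ((norm_nonneg x).trans hx)

end IsTruncation

variable [CompleteSpace V] [CompleteSpace H]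

/-- Truncation inequality: `‖P z‖² / 2` grows along `z = r - k·1` at most at the rate given by the
zeroth order terms. It holds for the curves smoothed by the resolvents, which commute with `A`, and
passes to the limit in `H`; thus continuity of the truncation in `V` is not needed. -/
theorem Solves.truncation {ρ : ℝ → V} {f r : ℝ → H} (h : Solves 𝒢 T ρ f r) {P : H → H}
    (hP : IsTruncation 𝒢 P) {e : V} (he : 𝒢.D e = 0) {k k' : ℝ → ℝ}
    (hk : ∀ t, HasDerivAt k (k' t) t) (hk' : Continuous k') {t : ℝ} (ht : t ∈ Icc 0 T) :
    1 / 2 * ‖P (r t - k t • 𝒢.ι e)‖ ^ 2 ≤ 1 / 2 * ‖P (r 0 - k 0 • 𝒢.ι e)‖ ^ 2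
      + ∫ τ in (0 : ℝ)..t, inner ℝ (P (r τ - k τ • 𝒢.ι e)) (f τ - k' τ • 𝒢.ι e) := by
  have hT : 0 ≤ T := ht.1.trans ht.2
  have h0 : (0 : ℝ) ∈ Icc 0 T := ⟨le_rfl, hT⟩
  have hkc : Continuous k := continuous_iff_continuousAt.2 fun t => (hk t).continuousAt
  have hsub : ∀ τ ∈ uIcc 0 t, τ ∈ Icc 0 T := fun τ hτ => by
    rw [uIcc_of_le ht.1] at hτ; exact ⟨hτ.1, hτ.2.trans ht.2⟩
  set Z : ℕ → ℝ → H := fun n τ => 𝒢.ι (𝒢.res n (𝒢.emb (r τ))) - k τ • 𝒢.ι e with hZ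
  set g : ℝ → StrongDual ℝ V := fun τ => 𝒢.emb (f τ) - 𝒢.embD (𝒢.D (ρ τ)) with hg
  have hZc : ∀ n, ContinuousOn (Z n) (Icc 0 T) := fun n =>
    ((𝒢.ι.comp ((𝒢.res n).comp 𝒢.emb)).continuous.comp_continuousOn h.evolves.cont).sub
      (hkc.smul continuous_const).continuousOn
  have hk'i : ∀ s : ℝ, IntervalIntegrable (fun τ => k' τ • 𝒢.ι e) volume 0 s := fun s =>
    (hk'.smul continuous_const).intervalIntegrable 0 s
  have key := fun n => integral_fderiv_primitive (fun x => hP.hasFDerivAt x) hP.abs_sub_le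
    ((h.evolves.intervalIntegrable_res n ht).sub (hk'i t)) (Z n 0) (Z := Z n) (fun s hs => by
      have hs' := hsub s hs
      rw [intervalIntegral.integral_sub (h.evolves.intervalIntegrable_res n hs') (hk'i s),
        intervalIntegral.integral_smul_const, intervalIntegral.integral_eq_sub_of_hasDerivAt
          (fun x _ => hk x) (hk'.intervalIntegrable 0 s)]
      simp only [hZ]
      rw [h.evolves.res_eq n hs', sub_smul]
      abel)
  -- the integrand without the elliptic part
  set Y : ℕ → ℝ → ℝ := fun n τ =>
    inner ℝ (P (Z n τ)) (𝒢.ι (𝒢.res n (𝒢.emb (f τ))) - k' τ • 𝒢.ι e) with hY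
  obtain ⟨R, hR⟩ := isCompact_Icc.exists_bound_of_continuousOn h.evolves.cont
  obtain ⟨C, hC⟩ := isCompact_Icc.exists_bound_of_continuousOn (s := Icc 0 T)
    ((hkc.smul (continuous_const (y := 𝒢.ι e))).continuousOn)
  have hbound : ∀ n, ∀ᵐ τ ∂muTime T, ‖Y n τ‖ ≤ (R + C) * (‖f τ‖ + ‖k' τ • 𝒢.ι e‖) := fun n => by
    filter_upwards [ae_restrict_mem measurableSet_Ioo] with τ hτ
    have hτ' := Ioo_subset_Icc_self hτ
    refine (norm_inner_le_norm _ _).trans (mul_le_mul ((hP.norm_le _).trans ?_) ?_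
      (norm_nonneg _) ?_)
    · exact (norm_sub_le _ _).trans (add_le_add ((𝒢.norm_ι_res_emb_le n _).trans (hR τ hτ'))
        (hC τ hτ'))
    · exact (norm_sub_le _ _).trans (add_le_add (𝒢.norm_ι_res_emb_le n _) le_rfl)
    · exact add_nonneg ((norm_nonneg _).trans (hR τ hτ')) ((norm_nonneg _).trans (hC τ hτ'))
  have hfi := integrable_of_memLp_two h.source
  have hk'm : Integrable (fun τ => k' τ • 𝒢.ι e) (muTime T) :=
    integrable_of_memLp_two (memLp_of_continuousOn (hk'.smul continuous_const).continuousOn 2)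
  have hbi : Integrable (fun τ => (R + C) * (‖f τ‖ + ‖k' τ • 𝒢.ι e‖)) (muTime T) :=
    (hfi.norm.add hk'm.norm).const_mul _
  have hYm : ∀ n, AEStronglyMeasurable (Y n) (muTime T) := fun n =>
    AEStronglyMeasurable.inner
      (((hP.continuous.comp_continuousOn (hZc n)).mono Ioo_subset_Icc_self).aestronglyMeasurable
        measurableSet_Ioo)
      (((𝒢.ι.comp ((𝒢.res n).comp 𝒢.emb)).continuous.comp_aestronglyMeasurable hfi.1).sub hk'm.1)
  have hYi : ∀ n, IntervalIntegrable (Y n) volume 0 t := fun n =>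
    intervalIntegrable_of_muTime (hbi.mono' (hYm n) (hbound n)) h0 ht
  have hle : ∀ n, 1 / 2 * ‖P (Z n t)‖ ^ 2 ≤ 1 / 2 * ‖P (Z n 0)‖ ^ 2
      + ∫ τ in (0 : ℝ)..t, Y n τ := fun n => by
    have h1 : ∫ τ in (0 : ℝ)..t, innerSL ℝ (P (Z n τ)) (𝒢.ι (𝒢.res n (g τ)) - k' τ • 𝒢.ι e)
        ≤ ∫ τ in (0 : ℝ)..t, Y n τ := by
      refine intervalIntegral.integral_mono_ae_restrict ht.1 (key n).1 (hYi n) ?_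
      refine ae_restrict_of_ae_restrict_of_subset (Icc_subset_Icc_right ht.2) ?_
      rw [← restrict_Ioo_eq_restrict_Icc]
      filter_upwards [h.evolves.ae_eq] with τ hτ
      have hv : Z n τ = 𝒢.ι (𝒢.res n (𝒢.emb (𝒢.ι (ρ τ))) - k τ • e) := by
        simp only [hZ, hτ, map_sub, map_smul]
      -- the elliptic part has a sign, because the resolvent commutes with `A` and `D e = 0`
      obtain ⟨w, hw, hw'⟩ := hP.lift (𝒢.res n (𝒢.emb (𝒢.ι (ρ τ))) - k τ • e)
      rw [map_sub, map_smul, he, smul_zero, sub_zero, ← 𝒢.inner_ι_res_embD, hw, ← hv] at hw'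
      simp only [hY, hg, innerSL_apply_apply, map_sub, inner_sub_right]
      rw [real_inner_comm] at hw'
      linarith
    have h2 := (key n).2
    rw [h2] at h1
    linarith
  have hPlim : ∀ τ, Tendsto (fun n => P (Z n τ)) atTop (𝓝 (P (r τ - k τ • 𝒢.ι e))) := fun τ =>
    (hP.continuous.tendsto _).comp ((𝒢.tendsto_ι_res (r τ)).sub_const _)
  have hint : Tendsto (fun n => ∫ τ in (0 : ℝ)..t, Y n τ) atTop
      (𝓝 (∫ τ in (0 : ℝ)..t, inner ℝ (P (r τ - k τ • 𝒢.ι e)) (f τ - k' τ • 𝒢.ι e))) := by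
    refine intervalIntegral.tendsto_integral_filter_of_dominated_convergence _
      (Eventually.of_forall fun n => (intervalIntegrable_iff.1 (hYi n)).aestronglyMeasurable)
      (Eventually.of_forall fun n => ae_uIoc_of_muTime ht (hbound n))
      (intervalIntegrable_of_muTime hbi h0 ht) (Eventually.of_forall fun τ _ => ?_)
    exact (hPlim τ).inner ((𝒢.tendsto_ι_res (f τ)).sub_const _)
  exact le_of_tendsto_of_tendsto' (((hPlim t).norm.pow 2).const_mul _)
    ((((hPlim 0).norm.pow 2).const_mul _).add hint) hle

/-- Maximum principle: if `r(0) ≤ κ` and the zeroth order term is controlled by `l`, then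
`r(t) ≤ κ e^{l t}`; here `x ≤ y` is expressed by `P (x - y) = 0`. -/
theorem Solves.truncation_eq_zero {ρ : ℝ → V} {f r : ℝ → H} (h : Solves 𝒢 T ρ f r) {P : H → H}
    (hP : IsTruncation 𝒢 P) {e : V} (he : 𝒢.D e = 0) {κ l : ℝ} (hl : 0 ≤ l)
    (h0 : P (r 0 - κ • 𝒢.ι e) = 0)
    (hf : ∀ᵐ τ ∂muTime T, ∀ k : ℝ, 0 ≤ k →
      inner ℝ (P (r τ - k • 𝒢.ι e)) (f τ - (l * k) • 𝒢.ι e) ≤ l * ‖P (r τ - k • 𝒢.ι e)‖ ^ 2)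
    (hκ : 0 ≤ κ) {t : ℝ} (ht : t ∈ Icc 0 T) :
    P (r t - (κ * Real.exp (l * t)) • 𝒢.ι e) = 0 := by
  set k : ℝ → ℝ := fun t => κ * Real.exp (l * t) with hk
  have hkd : ∀ t, HasDerivAt k (l * k t) t := fun t => by
    have := (((hasDerivAt_id t).const_mul l).exp).const_mul κ
    refine this.congr_deriv ?_
    simp only [hk, id, mul_one]; ring
  have hkc : Continuous k := by simp only [hk]; fun_prop
  have hz : ContinuousOn (fun τ => P (r τ - k τ • 𝒢.ι e)) (Icc 0 T) :=
    hP.continuous.comp_continuousOn (h.evolves.cont.sub (hkc.smul continuous_const).continuousOn)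
  have hcont : ContinuousOn (fun τ => 1 / 2 * ‖P (r τ - k τ • 𝒢.ι e)‖ ^ 2) (Icc 0 T) :=
    continuousOn_const.mul (hz.norm.pow 2)
  have hk0 : k 0 = κ := by simp [hk]
  have key := le_mul_exp_of_le_add_integral (c := 0) (K := 2 * l) hcont (by positivity)
    (fun s hs => by
      have hT : 0 ≤ T := hs.1.trans hs.2
      have h00 : (0 : ℝ) ∈ Icc 0 T := ⟨le_rfl, hT⟩
      have h1 := h.truncation hP he hkd (continuous_const.mul hkc) hs
      rw [hk0, h0, norm_zero] at h1
      have hi1 : Integrable (fun τ => (inner ℝ (P (r τ - k τ • 𝒢.ι e))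
          (f τ - (l * k τ) • 𝒢.ι e) : ℝ)) (muTime T) :=
        integrable_inner_of_memLp (memLp_of_continuousOn hz 2) (h.source.sub
          (memLp_of_continuousOn ((continuous_const.mul hkc).smul continuous_const).continuousOn 2))
      have hi2 : IntervalIntegrable (fun τ => 1 / 2 * ‖P (r τ - k τ • 𝒢.ι e)‖ ^ 2) volume 0 s :=
        (hcont.mono (by rw [uIcc_of_le hs.1]; exact Icc_subset_Icc_right hs.2)).intervalIntegrable
      have h2 : ∫ τ in (0 : ℝ)..s, inner ℝ (P (r τ - k τ • 𝒢.ι e)) (f τ - (l * k τ) • 𝒢.ι e)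
          ≤ ∫ τ in (0 : ℝ)..s, 2 * l * (1 / 2 * ‖P (r τ - k τ • 𝒢.ι e)‖ ^ 2) := by
        refine intervalIntegral.integral_mono_ae_restrict hs.1
          (intervalIntegrable_of_muTime hi1 h00 hs) (hi2.const_mul _) ?_
        refine ae_restrict_of_ae_restrict_of_subset (Icc_subset_Icc_right hs.2) ?_
        rw [← restrict_Ioo_eq_restrict_Icc]
        filter_upwards [hf] with τ hτ
        have := hτ (k τ) (mul_nonneg hκ (Real.exp_pos _).le)
        linarith
      rw [intervalIntegral.integral_const_mul] at h2
      linarith) t ht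
  have h3 : ‖P (r t - k t • 𝒢.ι e)‖ ^ 2 ≤ 0 := by linarith
  exact norm_eq_zero.1 (pow_eq_zero_iff two_ne_zero |>.1 (le_antisymm h3 (sq_nonneg _)))

end

section

/-! ### The weighted Sobolev space -/

/-- Local properties in `Ω` may be checked on compact subintervals. -/
theorem ae_muOmega_of_compact {p : ℝ → Prop}
    (h : ∀ c d : ℝ, -1 < c → c ≤ d → d < 1 → ∀ᵐ x, x ∈ uIcc c d → p x) :
    ∀ᵐ x ∂muOmega, p x := by
  rw [ae_restrict_iff' measurableSet_Ioo]
  have hn : ∀ n : ℕ, ∀ᵐ x, x ∈ uIcc (-1 + 1 / ((n : ℝ) + 1 + 1)) (1 - 1 / ((n : ℝ) + 1 + 1)) →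
      p x := fun n => by
    have h1 : 0 < 1 / ((n : ℝ) + 1 + 1) := by positivity
    have h2 : 1 / ((n : ℝ) + 1 + 1) ≤ 1 := by
      rw [div_le_one (by positivity)]; linarith [(Nat.cast_nonneg n : (0 : ℝ) ≤ n)]
    exact h _ _ (by linarith) (by linarith) (by linarith)
  filter_upwards [ae_all_iff.2 hn] with x hx hx1
  obtain ⟨n, hn⟩ := exists_nat_one_div_lt (show 0 < min (x + 1) (1 - x) from
    lt_min (by linarith [hx1.1]) (by linarith [hx1.2]))
  have h3 : 1 / ((n : ℝ) + 1 + 1) ≤ 1 / ((n : ℝ) + 1) := by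
    gcongr; linarith
  have h4 := lt_min_iff.1 (h3.trans_lt hn)
  refine hx n ?_
  rw [mem_uIcc]
  left
  exact ⟨by linarith [h4.1], by linarith [h4.2]⟩

theorem uIcc_subset_Omega {x y : ℝ} (hx : x ∈ Ioo (-1 : ℝ) 1) (hy : y ∈ Ioo (-1 : ℝ) 1) :
    uIcc x y ⊆ Ioo (-1) 1 := ordConnected_Ioo.uIcc_subset hx hy

namespace IsDegenerateCoefficient

variable {a : ℝ → ℝ} (ha : IsDegenerateCoefficient a)
include ha

theorem sqrt_pos {x : ℝ} (hx : x ∈ Ioo (-1 : ℝ) 1) : 0 < √(a x) := Real.sqrt_pos.2 (ha.pos x hx)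

theorem continuousOn_sqrt : ContinuousOn (fun x => √(a x)) (Icc (-1) 1) :=
  ha.contDiffOn.continuousOn.sqrt

theorem continuousOn_inv_sqrt : ContinuousOn (fun x => (√(a x))⁻¹) (Ioo (-1) 1) :=
  (ha.continuousOn_sqrt.mono Ioo_subset_Icc_self).inv₀ fun _ hx => (ha.sqrt_pos hx).ne'

theorem intervalIntegrable (g : L2Omega) {x y : ℝ} (hx : x ∈ Ioo (-1 : ℝ) 1)
    (hy : y ∈ Ioo (-1 : ℝ) 1) : IntervalIntegrable (fun s => g s * (√(a s))⁻¹) volume x y := by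
  have hg : IntegrableOn g (Ioo (-1) 1) := (Lp.memLp g).integrable (by norm_num)
  have h1 : IntervalIntegrable g volume x y := by
    rw [intervalIntegrable_iff]
    exact hg.mono_set (uIoc_subset_uIcc.trans (uIcc_subset_Omega hx hy))
  exact h1.mul_continuousOn (ha.continuousOn_inv_sqrt.mono (uIcc_subset_Omega hx hy))

/-- The elements of the weighted space are described by the fundamental theorem of calculus. -/
theorem isWeightedDeriv_iff (u g : L2Omega) :
    IsWeightedDeriv a u g ↔ ∃ f : ℝ → ℝ, u =ᵐ[muOmega] f ∧ ∀ x ∈ Ioo (-1 : ℝ) 1,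
      ∀ y ∈ Ioo (-1 : ℝ) 1, ∫ s in x..y, g s * (√(a s))⁻¹ = f y - f x := by
  constructor
  · rintro ⟨f, f', hf, hf', hu, hg⟩
    have hac : ∀ x ∈ Ioo (-1 : ℝ) 1, ∀ y ∈ Ioo (-1 : ℝ) 1, AbsolutelyContinuousOnInterval f x y := by
      intro x hx y hy
      rcases le_total x y with h | h
      · exact hf x y hx.1 h hy.2
      · exact (hf y x hy.1 h hx.2).symm
    refine ⟨f, hu, fun x hx y hy => ?_⟩
    refine (hac x hx y hy).integral_eq_sub (ha.intervalIntegrable g hx hy) ?_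
    have h1 := (ae_restrict_iff' measurableSet_Ioo).1 (hf'.and hg)
    filter_upwards [h1] with s hs hs'
    have hsΩ := uIcc_subset_Omega hx hy hs'
    obtain ⟨h2, h3⟩ := hs hsΩ
    rw [h3, mul_comm (√(a s)), mul_assoc, mul_inv_cancel₀ (ha.sqrt_pos hsΩ).ne', mul_one]
    exact h2
  · rintro ⟨f, hu, hf⟩
    refine ⟨f, fun s => g s * (√(a s))⁻¹, fun c d hc hcd hd => ?_, ?_, hu, ?_⟩
    · have hcΩ : c ∈ Ioo (-1 : ℝ) 1 := ⟨hc, by linarith⟩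
      have hdΩ : d ∈ Ioo (-1 : ℝ) 1 := ⟨by linarith, hd⟩
      refine AbsolutelyContinuousOnInterval.of_dist_le (C := 1)
        (absolutelyContinuousOnInterval_primitive (ha.intervalIntegrable g hcΩ hdΩ) (f c))
        fun x hx y hy => ?_
      rw [hf c hcΩ x (uIcc_subset_Omega hcΩ hdΩ hx), hf c hcΩ y (uIcc_subset_Omega hcΩ hdΩ hy)]
      simp
    · refine ae_muOmega_of_compact fun c d hc hcd hd => ?_
      have hcΩ : (c - 1) / 2 ∈ Ioo (-1 : ℝ) 1 := ⟨by linarith, by linarith⟩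
      have hdΩ : (d + 1) / 2 ∈ Ioo (-1 : ℝ) 1 := ⟨by linarith, by linarith⟩
      filter_upwards [(ha.intervalIntegrable g hcΩ hdΩ).ae_hasDerivAt_integral] with x hx hxcd
      rw [uIcc_of_le hcd] at hxcd
      have hx1 : x ∈ Ioo (-1 : ℝ) 1 := ⟨by linarith [hxcd.1], by linarith [hxcd.2]⟩
      have hx2 : x ∈ uIcc ((c - 1) / 2) ((d + 1) / 2) :=
        mem_uIcc.2 (Or.inl ⟨by linarith [hxcd.1], by linarith [hxcd.2]⟩)
      have h1 := (hx hx2 _ left_mem_uIcc).const_add (f ((c - 1) / 2))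
      refine h1.congr_of_eventuallyEq ?_
      filter_upwards [isOpen_Ioo.mem_nhds hx1] with y hy
      rw [hf _ hcΩ y hy]; ring
    · filter_upwards [ae_restrict_mem measurableSet_Ioo] with s hs
      rw [mul_comm, mul_assoc, inv_mul_cancel₀ (ha.sqrt_pos hs).ne', mul_one]

/-- On compact subintervals, integration against `1/√a` is continuous on `L²(Ω)`. -/
theorem exists_inner_eq_integral {x y : ℝ} (hx : x ∈ Ioo (-1 : ℝ) 1) (hy : y ∈ Ioo (-1 : ℝ) 1) :
    ∃ k : L2Omega, ∀ g : L2Omega, ∫ s in x..y, g s * (√(a s))⁻¹ = inner ℝ k g := by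
  have hsub : uIoc x y ⊆ Ioo (-1) 1 := uIoc_subset_uIcc.trans (uIcc_subset_Omega hx hy)
  obtain ⟨C, hC⟩ := isCompact_uIcc.exists_bound_of_continuousOn
    (ha.continuousOn_inv_sqrt.mono (uIcc_subset_Omega hx hy))
  have hm : MemLp ((uIoc x y).indicator fun s => (√(a s))⁻¹) 2 muOmega := by
    refine MemLp.of_bound ?_ C ?_
    · refine AEStronglyMeasurable.indicator ?_ measurableSet_uIoc
      exact ha.continuousOn_inv_sqrt.aestronglyMeasurable measurableSet_Ioo
    · refine Eventually.of_forall fun s => ?_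
      by_cases hs : s ∈ uIoc x y
      · rw [indicator_of_mem hs]; exact hC s (uIoc_subset_uIcc hs)
      · rw [indicator_of_notMem hs, norm_zero]
        exact (norm_nonneg _).trans (hC x left_mem_uIcc)
  refine ⟨(if x ≤ y then (1 : ℝ) else -1) • hm.toLp, fun g => ?_⟩
  rw [intervalIntegral.intervalIntegral_eq_integral_uIoc, inner_smul_left, L2.inner_def,
    RCLike.conj_to_real, smul_eq_mul]
  congr 1
  rw [← integral_indicator measurableSet_uIoc]
  have : ∫ s, (uIoc x y).indicator (fun s => g s * (√(a s))⁻¹) s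
      = ∫ s in Ioo (-1) 1, (uIoc x y).indicator (fun s => g s * (√(a s))⁻¹) s :=
    (setIntegral_eq_integral_of_forall_compl_eq_zero fun s hs =>
      indicator_of_notMem (fun h => hs (hsub h)) _).symm
  rw [this]
  refine integral_congr_ae ?_
  filter_upwards [hm.coeFn_toLp] with s hs
  rw [hs]
  by_cases h : s ∈ uIoc x y
  · simp [h]
  · simp [h]

/-- The weighted space is closed: along a subsequence the representatives converge almost everywhere,
and the fundamental theorem of calculus passes to the limit. -/
theorem isClosed_H1a : IsClosed (H1a a : Set (WithLp 2 (L2Omega × L2Omega))) := by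
  rw [← isSeqClosed_iff_isClosed]
  intro p q hp hpq
  have hu : Tendsto (fun n => (p n).fst) atTop (𝓝 q.fst) :=
    ((continuous_fst.comp (WithLp.prod_continuous_ofLp 2 _ _)).tendsto q).comp hpq
  have hg : Tendsto (fun n => (p n).snd) atTop (𝓝 q.snd) :=
    ((continuous_snd.comp (WithLp.prod_continuous_ofLp 2 _ _)).tendsto q).comp hpq
  have hp' : ∀ n, IsWeightedDeriv a (p n).fst (p n).snd := hp
  simp_rw [ha.isWeightedDeriv_iff] at hp'
  choose f hf hfi using hp'
  change IsWeightedDeriv a q.fst q.snd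
  rw [ha.isWeightedDeriv_iff]
  obtain ⟨ns, hns, hae⟩ := (tendstoInMeasure_of_tendsto_Lp hu).exists_seq_tendsto_ae
  have hae2 : ∀ᵐ x ∂muOmega, Tendsto (fun k => f (ns k) x) atTop (𝓝 (q.fst x)) := by
    filter_upwards [hae, ae_all_iff.2 hf] with x h1 h2
    exact h1.congr fun k => h2 _
  have hne : (ae muOmega).NeBot := by
    rw [ae_neBot, ne_eq, Measure.restrict_eq_zero, Real.volume_Ioo]
    norm_num
  obtain ⟨x₀, hx₀, hx₀Ω⟩ := (hae2.and (ae_restrict_mem measurableSet_Ioo)).exists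
  have hint : ∀ x ∈ Ioo (-1 : ℝ) 1, ∀ y ∈ Ioo (-1 : ℝ) 1,
      Tendsto (fun k => ∫ s in x..y, (p (ns k)).snd s * (√(a s))⁻¹) atTop
        (𝓝 (∫ s in x..y, q.snd s * (√(a s))⁻¹)) := fun x hx y hy => by
    obtain ⟨k, hk⟩ := ha.exists_inner_eq_integral hx hy
    simp_rw [hk]
    exact tendsto_const_nhds.inner (hg.comp hns.tendsto_atTop)
  refine ⟨fun y => q.fst x₀ + ∫ s in x₀..y, q.snd s * (√(a s))⁻¹, ?_, fun x hx y hy => ?_⟩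
  · filter_upwards [hae2, ae_restrict_mem measurableSet_Ioo] with y hy hyΩ
    refine tendsto_nhds_unique hy ((hx₀.add (hint x₀ hx₀Ω y hyΩ)).congr fun k => ?_)
    rw [hfi _ x₀ hx₀Ω y hyΩ]; ring
  · rw [add_sub_add_left_eq_sub, intervalIntegral.integral_interval_sub_left
      (ha.intervalIntegrable _ hx₀Ω hy) (ha.intervalIntegrable _ hx₀Ω hx)]

theorem completeSpace_H1a : CompleteSpace (H1a a) := ha.isClosed_H1a.completeSpace_coe

end IsDegenerateCoefficient

/-- `wderiv` as a continuous linear map. -/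
def wderivL (a : ℝ → ℝ) : H1a a →L[ℝ] L2Omega :=
  LinearMap.mkContinuous
    ((WithLp.sndₗ 2 ℝ L2Omega L2Omega).comp (H1a a).subtype) 1 (by
      intro u
      have h := WithLp.prod_norm_sq_eq_of_L2 (u : WithLp 2 (L2Omega × L2Omega))
      rw [one_mul]
      refine abs_le_of_sq_le_sq' ?_ (norm_nonneg _) |>.2
      change ‖(u : WithLp 2 (L2Omega × L2Omega)).snd‖ ^ 2
        ≤ ‖(u : WithLp 2 (L2Omega × L2Omega))‖ ^ 2
      nlinarith [sq_nonneg ‖(u : WithLp 2 (L2Omega × L2Omega)).fst‖])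

@[simp] theorem toL2L_apply {a : ℝ → ℝ} (u : H1a a) : toL2L a u = toL2 u := rfl

namespace IsDegenerateCoefficient

variable {a : ℝ → ℝ} (ha : IsDegenerateCoefficient a)
include ha

omit ha in
theorem memLp_of_continuous {ψ : ℝ → ℝ} (hψ : Continuous ψ) : MemLp ψ 2 muOmega := by
  obtain ⟨C, hC⟩ := (isCompact_Icc (a := (-1 : ℝ)) (b := 1)).exists_bound_of_continuousOn
    hψ.continuousOn
  refine MemLp.of_bound hψ.aestronglyMeasurable C ?_
  filter_upwards [ae_restrict_mem measurableSet_Ioo] with x hx using hC x (Ioo_subset_Icc_self hx)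

theorem memLp_sqrt_mul {ψ : ℝ → ℝ} (hψ : Continuous ψ) :
    MemLp (fun x => √(a x) * ψ x) 2 muOmega := by
  have h := ha.continuousOn_sqrt.mul hψ.continuousOn
  obtain ⟨C, hC⟩ := isCompact_Icc.exists_bound_of_continuousOn h
  refine MemLp.of_bound ((h.mono Ioo_subset_Icc_self).aestronglyMeasurable measurableSet_Ioo) C ?_
  filter_upwards [ae_restrict_mem measurableSet_Ioo] with x hx using hC x (Ioo_subset_Icc_self hx)

theorem exists_of_contDiff {ψ : ℝ → ℝ} (hψ : ContDiff ℝ 1 ψ) :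
    ∃ u : H1a a, toL2 u =ᵐ[muOmega] ψ ∧ wderiv u =ᵐ[muOmega] fun x => √(a x) * deriv ψ x := by
  have h1 := IsDegenerateCoefficient.memLp_of_continuous hψ.continuous
  have h2 := ha.memLp_sqrt_mul (hψ.continuous_deriv le_rfl)
  exact ⟨⟨WithLp.toLp 2 (h1.toLp, h2.toLp), ψ, deriv ψ,
    fun c d _ _ _ => hψ.contDiffOn.absolutelyContinuousOnInterval,
    Eventually.of_forall fun x => (hψ.differentiable one_ne_zero x).hasDerivAt,
    h1.coeFn_toLp, h2.coeFn_toLp⟩, h1.coeFn_toLp, h2.coeFn_toLp⟩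

omit ha in
/-- The weighted derivative is determined by the function. -/
theorem toL2_injective : Function.Injective (toL2L a) := by
  rw [injective_iff_map_eq_zero]
  intro u hu
  have hu' : toL2 u = 0 := hu
  obtain ⟨f, f', hf, hf', hfu, hg⟩ := u.2
  have hf0 : f =ᵐ[muOmega] fun _ => 0 := by
    have h1 : toL2 u =ᵐ[muOmega] f := hfu
    rw [hu'] at h1
    exact h1.symm.trans (Lp.coeFn_zero _ _ _)
  have hcont : ContinuousOn f (Ioo (-1) 1) := fun x hx => by
    refine ContinuousAt.continuousWithinAt ?_
    have h := (hf ((x - 1) / 2) ((x + 1) / 2) (by linarith [hx.1]) (by linarith)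
      (by linarith [hx.2])).continuousOn
    rw [uIcc_of_le (by linarith)] at h
    exact h.continuousAt (Icc_mem_nhds (by linarith [hx.1, hx.2]) (by linarith [hx.1, hx.2]))
  have hzero : EqOn f (fun _ => 0) (Ioo (-1) 1) :=
    Measure.eqOn_open_of_ae_eq hf0 isOpen_Ioo hcont continuousOn_const
  have hw : wderiv u = 0 := by
    refine Lp.ext ?_
    have hg' : wderiv u =ᵐ[muOmega] fun x => √(a x) * f' x := hg
    filter_upwards [hg', hf', ae_restrict_mem measurableSet_Ioo, Lp.coeFn_zero ℝ 2 muOmega]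
      with x h1 h2 h3 h4
    have h5 : HasDerivAt f 0 x := (hasDerivAt_const x (0 : ℝ)).congr_of_eventuallyEq (by
      filter_upwards [isOpen_Ioo.mem_nhds h3] with y hy using hzero hy)
    rw [h1, h4, h2.unique h5, mul_zero, Pi.zero_apply]
  refine Subtype.ext ?_
  have h6 : (u : WithLp 2 (L2Omega × L2Omega)) = WithLp.toLp 2 (toL2 u, wderiv u) := rfl
  rw [h6, hu', hw]
  rfl

/-- The weighted space is dense in `L²(Ω)`, because it contains the test functions. -/
theorem dense_toL2 : DenseRange (toL2L a) := by
  have hr : range (toL2L a) = ((toL2L a).range : Set L2Omega) := rfl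
  rw [DenseRange, hr, Submodule.dense_iff_topologicalClosure_eq_top,
    Submodule.topologicalClosure_eq_top_iff, Submodule.eq_bot_iff]
  intro z hz
  rw [Submodule.mem_orthogonal] at hz
  have hzi : IntegrableOn z (Ioo (-1) 1) := (Lp.memLp z).integrable (by norm_num)
  have h := isOpen_Ioo.ae_eq_zero_of_integral_contDiff_smul_eq_zero hzi.locallyIntegrableOn
    (fun ψ h1 h2 h3 => by
      obtain ⟨u, hu, -⟩ := ha.exists_of_contDiff (h1.of_le (by exact_mod_cast le_top))
      have h4 := hz (toL2 u) ⟨u, rfl⟩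
      rw [L2.inner_def] at h4
      rw [← setIntegral_eq_integral_of_forall_compl_eq_zero (s := Ioo (-1 : ℝ) 1) fun t ht => by
        rw [image_eq_zero_of_notMem_tsupport fun h => ht (h3 h), zero_smul], ← h4]
      refine integral_congr_ae ?_
      filter_upwards [hu] with x hx
      rw [hx]; simp [mul_comm])
  refine Lp.ext ?_
  have h' : ∀ᵐ x ∂muOmega, z x = 0 := (ae_restrict_iff' measurableSet_Ioo).2 h
  filter_upwards [h', Lp.coeFn_zero ℝ 2 muOmega] with x h1 h2
  rw [h1, h2]; rfl

omit ha in
theorem inner_H1a (u v : H1a a) :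
    inner ℝ u v = inner ℝ (toL2 u) (toL2 v) + inner ℝ (wderiv u) (wderiv v) :=
  WithLp.prod_inner_apply (𝕜 := ℝ) (u : WithLp 2 (L2Omega × L2Omega)) v

/-- The form triple `H¹_a(Ω) ⊂ L²(Ω)` with `D u = √a u_x`. -/
def triple : FormTriple (H1a a) L2Omega L2Omega where
  ι := toL2L a
  D := wderivL a
  inner_eq := inner_H1a
  dense := ha.dense_toL2
  injective := toL2_injective

@[simp] theorem triple_ι (u : H1a a) : ha.triple.ι u = toL2 u := rfl

@[simp] theorem triple_D (u : H1a a) : ha.triple.D u = wderiv u := rfl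

/-- The constant function one, as an element of the weighted space. -/
theorem exists_one : ∃ e : H1a a, toL2 e =ᵐ[muOmega] (fun _ => 1) ∧ wderiv e = 0 := by
  obtain ⟨e, h1, h2⟩ := ha.exists_of_contDiff (ψ := fun _ => 1) contDiff_const
  refine ⟨e, h1, Lp.ext ?_⟩
  filter_upwards [h2, Lp.coeFn_zero ℝ 2 muOmega] with x h3 h4
  rw [h3, h4]; simp

end IsDegenerateCoefficient

/-! ### Positive parts -/

/-- At points where `f x ≤ 0` the positive part has a minimum, so that `deriv` vanishes there, be it
the derivative or the default value. -/
theorem deriv_posPart {f : ℝ → ℝ} {f' x : ℝ} (hf : HasDerivAt f f' x) :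
    deriv (fun y => max (f y) 0) x = if 0 < f x then f' else 0 := by
  split_ifs with h
  · refine (hf.congr_of_eventuallyEq ?_).deriv
    filter_upwards [hf.continuousAt.eventually_const_lt h] with y hy using max_eq_left hy.le
  · refine IsLocalMin.deriv_eq_zero (Eventually.of_forall fun y => ?_)
    simp only [max_eq_right (not_lt.1 h)]
    exact le_max_right _ _

theorem norm_sq_L2Omega (z : L2Omega) : ‖z‖ ^ 2 = ∫ x in Ioo (-1) 1, z x ^ 2 := by
  rw [← real_inner_self_eq_norm_sq, L2.inner_def]
  simp [sq]

theorem inner_L2Omega (y z : L2Omega) : inner ℝ y z = ∫ x in Ioo (-1) 1, y x * z x := by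
  rw [L2.inner_def]
  simp [mul_comm]

theorem integrable_L2Omega_mul (y z : L2Omega) : Integrable (fun x => y x * z x) muOmega :=
  (Lp.memLp y).integrable_mul (Lp.memLp z)

/-- The positive part on `L²(Ω)` acts on the weighted space, with `(v⁺)_x = v_x` on `{v > 0}` and
`(v⁺)_x = 0` elsewhere. -/
theorem IsDegenerateCoefficient.isTruncation {a : ℝ → ℝ} (ha : IsDegenerateCoefficient a) :
    IsTruncation ha.triple (Lp.posPart (p := 2) (μ := muOmega)) where
  zero := by
    refine Lp.ext ?_
    filter_upwards [Lp.coeFn_posPart (0 : L2Omega), Lp.coeFn_zero ℝ 2 muOmega] with x h1 h2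
    rw [h1, h2]; simp
  nonexpansive y z := by
    refine Lp.norm_le_norm_of_ae_le ?_
    filter_upwards [Lp.coeFn_posPart y, Lp.coeFn_posPart z, Lp.coeFn_sub y z,
      Lp.coeFn_sub (Lp.posPart y) (Lp.posPart z)] with x h1 h2 h3 h4
    rw [h3, h4, Pi.sub_apply, Pi.sub_apply, h1, h2]
    exact abs_max_sub_max_le_abs _ _ _
  gradient y z := by
    rw [← real_inner_self_eq_norm_sq, ← real_inner_self_eq_norm_sq, inner_L2Omega, inner_L2Omega,
      inner_L2Omega, ← integral_const_mul, ← integral_const_mul,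
      ← integral_add ((integrable_L2Omega_mul _ _).const_mul _) (integrable_L2Omega_mul _ _)]
    refine integral_mono_ae (((integrable_L2Omega_mul _ _).const_mul _).add
      (integrable_L2Omega_mul _ _)) ((integrable_L2Omega_mul _ _).const_mul _) ?_
    filter_upwards [Lp.coeFn_posPart y, Lp.coeFn_posPart z, Lp.coeFn_sub z y] with x h1 h2 h3
    rw [h1, h2, h3, Pi.sub_apply]
    rcases le_total (y x) 0 with hy | hy <;> rcases le_total (z x) 0 with hz | hz <;>
      simp only [hy, hz, max_eq_right, max_eq_left] <;> nlinarith [sq_nonneg (y x - z x)]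
  lift v := by
    obtain ⟨f, f', hf, hf', hfu, hg⟩ := v.2
    have hg' : wderiv v =ᵐ[muOmega] fun x => √(a x) * f' x := hg
    set F : ℝ → ℝ := fun x => max (f x) 0 with hF
    have hFac : ∀ c d : ℝ, -1 < c → c ≤ d → d < 1 → AbsolutelyContinuousOnInterval F c d :=
      fun c d h1 h2 h3 => AbsolutelyContinuousOnInterval.of_dist_le (C := 1) (hf c d h1 h2 h3)
        fun x _ y _ => by
          rw [one_mul, Real.dist_eq, Real.dist_eq]
          exact abs_max_sub_max_le_abs _ _ _
    have hFd : ∀ᵐ x ∂muOmega, HasDerivAt F (deriv F x) x :=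
      ae_muOmega_of_compact fun c d h1 h2 h3 => by
        filter_upwards [(hFac c d h1 h2 h3).ae_differentiableAt] with x hx hx'
        exact (hx hx').hasDerivAt
    have hG : MemLp (fun x => √(a x) * deriv F x) 2 muOmega := by
      refine MemLp.of_le (Lp.memLp (wderiv v)) ?_ ?_
      · exact ((ha.continuousOn_sqrt.mono Ioo_subset_Icc_self).aestronglyMeasurable
          measurableSet_Ioo).mul (measurable_deriv F).aestronglyMeasurable
      · filter_upwards [hf', hg'] with x h1 h2
        rw [h2, hF, deriv_posPart h1]
        split_ifs
        · exact le_rfl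
        · rw [mul_zero, norm_zero]; exact norm_nonneg _
    have hu : toL2 v =ᵐ[muOmega] f := hfu
    refine ⟨⟨WithLp.toLp 2 (Lp.posPart (toL2 v), hG.toLp), F, deriv F, hFac, hFd, ?_,
      hG.coeFn_toLp⟩, rfl, ?_⟩
    · filter_upwards [Lp.coeFn_posPart (toL2 v), hu] with x h1 h2
      exact h1.trans (by rw [h2])
    · change 0 ≤ inner ℝ (wderiv v) hG.toLp
      rw [inner_L2Omega]
      refine integral_nonneg_of_ae ?_
      filter_upwards [hf', hg', hG.coeFn_toLp] with x h1 h2 h3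
      rw [h2, h3, hF, deriv_posPart h1]
      split_ifs
      · simpa using mul_self_nonneg (√(a x) * f' x)
      · simp

end

section

/-! ### Multiplication operators -/

theorem memLp_mul_of_bounded {b : ℝ → ℝ} (hb : Measurable b) {c : ℝ} (hc : ∀ x, |b x| ≤ c)
    (h : L2Omega) : MemLp (fun x => b x * h x) 2 muOmega :=
  MemLp.of_le_mul (Lp.memLp h) (hb.aestronglyMeasurable.mul (Lp.aestronglyMeasurable h))
    (Eventually.of_forall fun x => by
      rw [norm_mul]; exact mul_le_mul_of_nonneg_right (hc x) (norm_nonneg _))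

/-- Multiplication by a bounded measurable function on `L²(Ω)`; the bound `c` only serves to make it a
continuous linear map. -/
def mulOp (b : ℝ → ℝ) (hb : Measurable b) (c : ℝ) (hc : ∀ x, |b x| ≤ c) :
    L2Omega →L[ℝ] L2Omega :=
  have hm : ∀ h : L2Omega, MemLp (fun x => b x * h x) 2 muOmega :=
    memLp_mul_of_bounded hb hc
  LinearMap.mkContinuous
    { toFun := fun h => (hm h).toLp
      map_add' := fun h k => by
        refine Lp.ext ?_
        filter_upwards [(hm (h + k)).coeFn_toLp, (hm h).coeFn_toLp, (hm k).coeFn_toLp,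
          Lp.coeFn_add (hm h).toLp (hm k).toLp, Lp.coeFn_add h k] with x h1 h2 h3 h4 h5
        rw [h1, h4, Pi.add_apply, h2, h3, h5, Pi.add_apply]; ring
      map_smul' := fun a h => by
        refine Lp.ext ?_
        filter_upwards [(hm (a • h)).coeFn_toLp, (hm h).coeFn_toLp,
          Lp.coeFn_smul a (hm h).toLp, Lp.coeFn_smul a h] with x h1 h2 h3 h4
        rw [h1, RingHom.id_apply, h3, Pi.smul_apply, h2, h4, Pi.smul_apply, smul_eq_mul,
          smul_eq_mul]
        ring } c (fun h => by
    refine Lp.norm_le_mul_norm_of_ae_le_mul ?_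
    filter_upwards [(hm h).coeFn_toLp] with x hx
    refine (congrArg norm hx).trans_le ?_
    rw [norm_mul]; exact mul_le_mul_of_nonneg_right (hc x) (norm_nonneg _))

section mulOp

variable {b : ℝ → ℝ} {hb : Measurable b} {c : ℝ} {hc : ∀ x, |b x| ≤ c}

theorem coeFn_mulOp (h : L2Omega) : mulOp b hb c hc h =ᵐ[muOmega] fun x => b x * h x :=
  (memLp_mul_of_bounded hb hc h).coeFn_toLp

theorem norm_mulOp_le (h : L2Omega) : ‖mulOp b hb c hc h‖ ≤ c * ‖h‖ := by
  refine Lp.norm_le_mul_norm_of_ae_le_mul ?_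
  filter_upwards [coeFn_mulOp (hb := hb) (hc := hc) h] with x hx
  rw [hx, norm_mul]; exact mul_le_mul_of_nonneg_right (hc x) (norm_nonneg _)

theorem inner_mulOp (h k : L2Omega) :
    inner ℝ (mulOp b hb c hc h) k = ∫ x in Ioo (-1) 1, b x * h x * k x := by
  rw [inner_L2Omega]
  refine integral_congr_ae ?_
  filter_upwards [coeFn_mulOp (hb := hb) (hc := hc) h] with x hx
  rw [hx]

theorem inner_mulOp_comm (h k : L2Omega) :
    inner ℝ (mulOp b hb c hc h) k = inner ℝ h (mulOp b hb c hc k) := by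
  rw [← real_inner_comm h, inner_mulOp, inner_mulOp]
  congr 1 with x
  ring

end mulOp

/-- A map into a separable normed space is measurable as soon as its distances to all points are. -/
theorem stronglyMeasurable_of_norm_sub {α E : Type*} [MeasurableSpace α] [NormedAddCommGroup E]
    [SecondCountableTopology E] {f : α → E} (hf : ∀ z, Measurable fun t => ‖f t - z‖) :
    StronglyMeasurable f := by
  borelize E
  refine (measurable_of_isOpen fun U hU => ?_).stronglyMeasurable
  obtain ⟨I, hIU, hI, he⟩ := TopologicalSpace.isOpen_biUnion_countable
    {p : E × ℝ | Metric.ball p.1 p.2 ⊆ U} (fun p => Metric.ball p.1 p.2)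
    fun _ _ => Metric.isOpen_ball
  have hUe : U = ⋃ p ∈ I, Metric.ball p.1 p.2 := by
    rw [he]
    refine Subset.antisymm (fun x hx => ?_) (iUnion₂_subset fun p hp => hp)
    obtain ⟨r, hr, hrU⟩ := Metric.isOpen_iff.1 hU x hx
    exact mem_biUnion (x := (x, r)) hrU (Metric.mem_ball_self hr)
  rw [hUe, preimage_iUnion₂]
  refine MeasurableSet.biUnion hI fun p _ => ?_
  have : f ⁻¹' Metric.ball p.1 p.2 = {t | ‖f t - p.1‖ < p.2} := by
    ext t; simp [dist_eq_norm]
  rw [this]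
  exact measurableSet_lt (hf p.1) measurable_const

/-- Multiplication by the time slices of a bounded measurable function of `(t, x)`. -/
theorem boundedFamily_mulOp (T : ℝ) {b : ℝ × ℝ → ℝ} (hb : Measurable b) {c : ℝ} (h0 : 0 ≤ c)
    (hc : ∀ z, |b z| ≤ c) : BoundedFamily T (fun t => mulOp (fun x => b (t, x))
      (hb.comp measurable_prodMk_left) c fun x => hc (t, x)) c where
  nonneg := h0
  le t h := norm_mulOp_le h
  meas p hp := by
    have : Fact ((2 : ℝ≥0∞) ≠ ∞) := ⟨ENNReal.ofNat_ne_top⟩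
    have : SecondCountableTopology L2Omega := inferInstance
    have hk : ∀ k : L2Omega, StronglyMeasurable fun t => mulOp (fun x => b (t, x))
        (hb.comp measurable_prodMk_left) c (fun x => hc (t, x)) k := fun k => by
      refine stronglyMeasurable_of_norm_sub fun z => ?_
      have h1 : ∀ t, ‖mulOp (fun x => b (t, x)) (hb.comp measurable_prodMk_left) c
          (fun x => hc (t, x)) k - z‖ = √(∫ x in Ioo (-1) 1, (b (t, x) * k x - z x) ^ 2) := by
        intro t
        rw [← Real.sqrt_sq (norm_nonneg (_ - z)), norm_sq_L2Omega]
        congr 1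
        refine integral_congr_ae ?_
        filter_upwards [coeFn_mulOp (b := fun x => b (t, x)) (hb := hb.comp measurable_prodMk_left)
          (hc := fun x => hc (t, x)) k, Lp.coeFn_sub (mulOp (fun x => b (t, x))
          (hb.comp measurable_prodMk_left) c (fun x => hc (t, x)) k) z] with x h1 h2
        rw [h2, Pi.sub_apply, h1]
      simp_rw [h1]
      refine Measurable.sqrt ?_
      have h2 : StronglyMeasurable fun z' : ℝ × ℝ => (b z' * k z'.2 - z z'.2) ^ 2 :=
        (((hb.mul ((Lp.stronglyMeasurable k).measurable.comp measurable_snd)).sub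
          ((Lp.stronglyMeasurable z).measurable.comp measurable_snd)).pow_const 2).stronglyMeasurable
      exact h2.integral_prod_right'.measurable
    let _ : MeasurableSpace L2Omega := borel L2Omega
    have _ : BorelSpace L2Omega := ⟨rfl⟩
    have hu := stronglyMeasurable_uncurry_of_continuous_of_stronglyMeasurable
      (u := fun (k : L2Omega) t => mulOp (fun x => b (t, x))
        (hb.comp measurable_prodMk_left) c (fun x => hc (t, x)) k)
      (fun t => ContinuousLinearMap.continuous _) hk
    refine ⟨fun t => mulOp (fun x => b (t, x)) (hb.comp measurable_prodMk_left) c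
      (fun x => hc (t, x)) (hp.mk p t), ?_, ?_⟩
    · exact hu.comp_measurable (hp.stronglyMeasurable_mk.measurable.prodMk measurable_id)
    · filter_upwards [hp.ae_eq_mk] with t ht
      rw [← ht]

/-! ### Controls as families of multiplication operators -/

section Control

variable {T : ℝ} {ω : Set ℝ}

theorem ae_norm_control_le (v : Control T ω) : ∀ᵐ z ∂muControl T ω, |v z| ≤ ‖v‖ := by
  filter_upwards [ae_le_eLpNormEssSup (f := v) (μ := muControl T ω)] with z hz
  rw [Lp.norm_def, eLpNorm_exponent_top]
  have h1 := Lp.eLpNorm_lt_top v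
  rw [eLpNorm_exponent_top] at h1
  have := ENNReal.toReal_mono h1.ne hz
  simpa using this

/-- The everywhere bounded representative of a control, extended by zero: the values are clamped to
`[-‖v‖, ‖v‖]`. -/
def extend (v : Control T ω) : ℝ × ℝ → ℝ :=
  (Ioo 0 T ×ˢ ω).indicator fun z => max (-‖v‖) (min ‖v‖ (v z))

theorem abs_extend_le (v : Control T ω) (z : ℝ × ℝ) : |extend v z| ≤ ‖v‖ := by
  have h0 := norm_nonneg v
  rw [extend]
  by_cases hz : z ∈ Ioo 0 T ×ˢ ω
  · rw [indicator_of_mem hz, abs_le]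
    exact ⟨le_max_left _ _, max_le (by linarith) (min_le_left _ _)⟩
  · rw [indicator_of_notMem hz, abs_zero]; exact h0

theorem measurable_extend (hω : MeasurableSet ω) (v : Control T ω) : Measurable (extend v) :=
  (measurable_const.max (measurable_const.min (Lp.stronglyMeasurable v).measurable)).indicator
    (measurableSet_Ioo.prod hω)

theorem extend_ae_eq (hω : MeasurableSet ω) (v : Control T ω) :
    extend v =ᵐ[muControl T ω] v := by
  filter_upwards [ae_norm_control_le v, ae_restrict_mem (measurableSet_Ioo.prod hω)] with z h1 h2
  obtain ⟨h3, h4⟩ := abs_le.1 h1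
  rw [extend, indicator_of_mem h2, min_eq_right h4, max_eq_right h3]

theorem muControl_eq_prod : muControl T ω = (muTime T).prod (volume.restrict ω) := by
  rw [muControl, muTime, Measure.prod_restrict, ← Measure.volume_eq_prod]

/-- Fubini: a property valid almost everywhere in `ω_T` is valid on almost every time slice. -/
theorem ae_slice {p : ℝ × ℝ → Prop} (h : ∀ᵐ z ∂muControl T ω, p z) :
    ∀ᵐ t ∂muTime T, ∀ᵐ x ∂volume.restrict ω, p (t, x) := by
  rw [muControl_eq_prod] at h
  exact Measure.ae_ae_of_ae_prod h

/-- Multiplication by `v(t, ·) χ_ω` on `L²(Ω)`. -/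
def potential (hω : MeasurableSet ω) (v : Control T ω) (t : ℝ) : L2Omega →L[ℝ] L2Omega :=
  mulOp (fun x => extend v (t, x)) ((measurable_extend hω v).comp measurable_prodMk_left) ‖v‖
    fun x => abs_extend_le v (t, x)

variable (hω : MeasurableSet ω)

theorem boundedFamily_potential (v : Control T ω) :
    BoundedFamily T (potential hω v) ‖v‖ :=
  boundedFamily_mulOp T (measurable_extend hω v) (norm_nonneg v) (abs_extend_le v)

theorem coeFn_potential (v : Control T ω) (t : ℝ) (h : L2Omega) :
    potential hω v t h =ᵐ[muOmega] fun x => extend v (t, x) * h x := coeFn_mulOp h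

theorem norm_potential_le (v : Control T ω) (t : ℝ) (h : L2Omega) :
    ‖potential hω v t h‖ ≤ ‖v‖ * ‖h‖ := norm_mulOp_le h

theorem inner_potential_comm (v : Control T ω) (t : ℝ) (h k : L2Omega) :
    inner ℝ (potential hω v t h) k = inner ℝ h (potential hω v t k) := inner_mulOp_comm h k

theorem integral_extend_mul (hΩ : ω ⊆ Ioo (-1) 1) (v : Control T ω) (t : ℝ) (f : ℝ → ℝ) :
    ∫ x in Ioo (-1) 1, extend v (t, x) * f x = ∫ x in ω, extend v (t, x) * f x := by
  refine (setIntegral_eq_of_subset_of_forall_sdiff_eq_zero measurableSet_Ioo hΩ fun x hx => ?_)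
  rw [extend, indicator_of_notMem (fun h => hx.2 h.2), zero_mul]

/-- For almost every time, the control term of the weak formulation is given by the family of
multiplication operators. -/
theorem ae_integral_control (hΩ : ω ⊆ Ioo (-1) 1) (v : Control T ω) : ∀ᵐ t ∂muTime T,
    ∀ h k : L2Omega, ∫ x in ω, v (t, x) * h x * k x = inner ℝ (potential hω v t h) k := by
  filter_upwards [ae_slice (extend_ae_eq hω v)] with t ht h k
  refine Eq.trans ?_ (inner_mulOp h k).symm
  simp_rw [mul_assoc]
  rw [integral_extend_mul hΩ]
  refine integral_congr_ae ?_
  filter_upwards [ht] with x hx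
  rw [hx]

theorem potential_add_apply (u w : Control T ω) : ∀ᵐ t ∂muTime T, ∀ h : L2Omega,
    potential hω (u + w) t h = potential hω u t h + potential hω w t h := by
  have h1 : ∀ᵐ z ∂muControl T ω, extend (u + w) z = extend u z + extend w z := by
    filter_upwards [extend_ae_eq hω u, extend_ae_eq hω w, extend_ae_eq hω (u + w),
      Lp.coeFn_add u w] with z e1 e2 e3 e4
    rw [e1, e2, e3, e4, Pi.add_apply]
  filter_upwards [ae_slice h1] with t ht h
  have h2 : ∀ᵐ x, extend (u + w) (t, x) = extend u (t, x) + extend w (t, x) := by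
    filter_upwards [(ae_restrict_iff' hω).1 ht] with x hx
    by_cases hxω : x ∈ ω
    · exact hx hxω
    · simp [extend, hxω]
  refine Lp.ext ?_
  filter_upwards [ae_restrict_of_ae h2, coeFn_potential hω u t h, coeFn_potential hω w t h,
    coeFn_potential hω (u + w) t h,
    Lp.coeFn_add (potential hω u t h) (potential hω w t h)] with x e1 e2 e3 e4 e5
  rw [e4, e1, e5, Pi.add_apply, e2, e3, add_mul]

/-! ### Boundedness of solutions -/

/-- The zeroth order term satisfies the hypothesis of the maximum principle: where `h > k ≥ 0` one
has `v h - ‖v‖ k ≤ ‖v‖ (h - k)`. -/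
theorem inner_posPart_potential_le (v : Control T ω) (t : ℝ) {e : L2Omega}
    (he : e =ᵐ[muOmega] fun _ => 1) (h : L2Omega) {k : ℝ} (hk : 0 ≤ k) :
    inner ℝ (Lp.posPart (h - k • e)) (potential hω v t h - (‖v‖ * k) • e)
      ≤ ‖v‖ * ‖Lp.posPart (h - k • e)‖ ^ 2 := by
  rw [inner_L2Omega, norm_sq_L2Omega, ← integral_const_mul]
  refine integral_mono_ae (integrable_L2Omega_mul _ _) ?_ ?_
  · simp_rw [sq]
    exact (integrable_L2Omega_mul _ _).const_mul _
  filter_upwards [Lp.coeFn_posPart (h - k • e), Lp.coeFn_sub h (k • e), Lp.coeFn_smul k e, he,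
    Lp.coeFn_sub (potential hω v t h) ((‖v‖ * k) • e), Lp.coeFn_smul (‖v‖ * k) e,
    coeFn_potential hω v t h] with x h1 h2 h3 h4 h5 h6 h7
  rw [h1, h5, h2, Pi.sub_apply, Pi.sub_apply, h3, h6, h7, Pi.smul_apply, Pi.smul_apply, h4]
  simp only [smul_eq_mul, mul_one]
  have hb := (abs_le.1 (abs_extend_le v (t, x))).2
  rcases le_total (h x - k) 0 with hx | hx
  · rw [max_eq_right hx]; simp
  · rw [max_eq_left hx]
    have h8 : extend v (t, x) * h x ≤ ‖v‖ * h x := mul_le_mul_of_nonneg_right hb (by linarith)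
    nlinarith

variable {a : ℝ → ℝ} (ha : IsDegenerateCoefficient a)
include ha

/-- One-sided bound. The reparametrization `θ` of time covers the reversed equation too. -/
theorem Solves.ae_le {ρ : ℝ → H1a a} {f r : ℝ → L2Omega} (h : Solves ha.triple T ρ f r)
    {v : Control T ω} {θ : ℝ → ℝ} (hf : ∀ᵐ t ∂muTime T, f t = potential hω v (θ t) (r t))
    {κ : ℝ} (hκ : 0 ≤ κ) (h0 : ∀ᵐ x ∂muOmega, r 0 x ≤ κ) {t : ℝ} (ht : t ∈ Icc 0 T) :
    ∀ᵐ x ∂muOmega, r t x ≤ κ * Real.exp (‖v‖ * t) := by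
  have := ha.completeSpace_H1a
  obtain ⟨e, he, he'⟩ := ha.exists_one
  have key := h.truncation_eq_zero ha.isTruncation (e := e) he' (κ := κ) (l := ‖v‖)
    (norm_nonneg v) ?_ ?_ hκ ht
  · have h1 := Lp.coeFn_posPart (r t - (κ * Real.exp (‖v‖ * t)) • toL2 e)
    have h1' : Lp.posPart (r t - (κ * Real.exp (‖v‖ * t)) • toL2 e) = 0 := key
    rw [h1'] at h1
    filter_upwards [h1, Lp.coeFn_zero ℝ 2 muOmega,
      Lp.coeFn_sub (r t) ((κ * Real.exp (‖v‖ * t)) • toL2 e),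
      Lp.coeFn_smul (κ * Real.exp (‖v‖ * t)) (toL2 e), he] with x e1 e2 e3 e4 e5
    rw [e2, e3, Pi.sub_apply, e4, Pi.smul_apply, e5, Pi.zero_apply, smul_eq_mul, mul_one] at e1
    have := le_max_left (r t x - κ * Real.exp (‖v‖ * t)) 0
    linarith
  · refine Lp.ext ?_
    filter_upwards [Lp.coeFn_posPart (r 0 - κ • toL2 e), Lp.coeFn_zero ℝ 2 muOmega,
      Lp.coeFn_sub (r 0) (κ • toL2 e), Lp.coeFn_smul κ (toL2 e), he, h0] with x e1 e2 e3 e4 e5 e6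
    rw [ha.triple_ι, e1, e3, Pi.sub_apply, e4, Pi.smul_apply, e5, smul_eq_mul, mul_one, e2]
    exact max_eq_right (by linarith)
  · filter_upwards [hf] with τ hτ k hk
    rw [hτ]
    exact inner_posPart_potential_le hω v (θ τ) he (r τ) hk

/-- Solutions with bounded initial value stay bounded. -/
theorem Solves.ae_abs_le {ρ : ℝ → H1a a} {f r : ℝ → L2Omega} (h : Solves ha.triple T ρ f r)
    {v : Control T ω} {θ : ℝ → ℝ} (hf : ∀ᵐ t ∂muTime T, f t = potential hω v (θ t) (r t))
    {κ : ℝ} (hκ : 0 ≤ κ) (h0 : ∀ᵐ x ∂muOmega, |r 0 x| ≤ κ) {t : ℝ} (ht : t ∈ Icc 0 T) :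
    ∀ᵐ x ∂muOmega, |r t x| ≤ κ * Real.exp (‖v‖ * T) := by
  have hexp : κ * Real.exp (‖v‖ * t) ≤ κ * Real.exp (‖v‖ * T) :=
    mul_le_mul_of_nonneg_left (Real.exp_le_exp.2
      (mul_le_mul_of_nonneg_left ht.2 (norm_nonneg v))) hκ
  have h1 := h.ae_le hω ha hf hκ (h0.mono fun x hx => (le_abs_self _).trans hx) ht
  have h2 := h.neg.ae_le hω ha (v := v) (θ := θ) (hf.mono fun t ht => by rw [ht, map_neg]) hκ
    (by
      filter_upwards [h0, Lp.coeFn_neg (r 0)] with x hx e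
      rw [e, Pi.neg_apply]
      exact (neg_le_abs _).trans hx) ht
  filter_upwards [h1, h2, Lp.coeFn_neg (r t)] with x e1 e2 e3
  rw [e3, Pi.neg_apply] at e2
  rw [abs_le]
  constructor <;> linarith

end Control

/-! ### Jointly measurable representatives -/

/-- The primitive of an `L²(Ω)` function as an inner product with an indicator function. -/
theorem ae_hasDerivAt_inner_indicator (h : L2Omega) : ∀ᵐ x ∂muOmega,
    HasDerivAt (fun y => (inner ℝ h (indicatorConstLp 2 (measurableSet_Iio (a := y))
      (measure_ne_top muOmega _) (1 : ℝ)) : ℝ)) (h x) x := by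
  have hi : Integrable h muOmega := (Lp.memLp h).integrable (by norm_num)
  have hi' : IntervalIntegrable h volume (-1) 1 := by
    rw [intervalIntegrable_iff, uIoc_of_le (by norm_num), integrableOn_Ioc_iff_integrableOn_Ioo]
    exact hi
  have hF : ∀ y ∈ Ioo (-1 : ℝ) 1, (inner ℝ h (indicatorConstLp 2 (measurableSet_Iio (a := y))
      (measure_ne_top muOmega _) (1 : ℝ)) : ℝ) = ∫ s in (-1 : ℝ)..y, h s := fun y hy => by
    rw [inner_L2Omega, intervalIntegral.integral_of_le hy.1.le, integral_Ioc_eq_integral_Ioo]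
    have h1 : Ioo (-1 : ℝ) y = Iio y ∩ Ioo (-1) 1 := by
      ext s; simp only [mem_Ioo, mem_inter_iff, mem_Iio]
      exact ⟨fun hs => ⟨hs.2, hs.1, hs.2.trans hy.2⟩, fun hs => ⟨hs.2.1, hs.1⟩⟩
    rw [h1, ← Measure.restrict_restrict measurableSet_Iio, ← integral_indicator measurableSet_Iio]
    refine integral_congr_ae ?_
    filter_upwards [indicatorConstLp_coeFn (p := 2) (hs := measurableSet_Iio (a := y))
      (hμs := measure_ne_top muOmega _) (c := (1 : ℝ))] with s hs
    rw [hs]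
    by_cases h : s ∈ Iio y
    · simp only [indicator_of_mem h, mul_one]
    · simp only [indicator_of_notMem h, mul_zero]
  rw [ae_restrict_iff' measurableSet_Ioo]
  filter_upwards [hi'.ae_hasDerivAt_integral] with x hx hxΩ
  have h1 := hx (by rw [uIcc_of_le (by norm_num)]; exact Ioo_subset_Icc_self hxΩ) (-1)
    left_mem_uIcc
  refine h1.congr_of_eventuallyEq ?_
  filter_upwards [isOpen_Ioo.mem_nhds hxΩ] with y hy using hF y hy

/-- A bounded curve in `C([0,T]; L²(Ω))` is given by an element of `L^∞(Q)`. A jointly measurable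
representative is obtained by differentiating in `x` the primitive `⟪r(t), 1_{(-∞,x)}⟫`, which is
continuous in `(t, x)`. -/
theorem exists_linfty_rep {T : ℝ} (hT : 0 ≤ T) {r : ℝ → L2Omega} (hr : ContinuousOn r (Icc 0 T))
    {κ : ℝ} (hκ : ∀ t ∈ Icc 0 T, ∀ᵐ x ∂muOmega, |r t x| ≤ κ) :
    ∃ Y : Lp ℝ ∞ (muQ T), ∀ᵐ t ∂muTime T, r t =ᵐ[muOmega] fun x => Y (t, x) := by
  set r' : ℝ → L2Omega := IccExtend hT ((Icc 0 T).domRestrict r) with hr'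
  have hr'c : Continuous r' := (continuousOn_iff_continuous_domRestrict.1 hr).Icc_extend'
  have hr'e : ∀ t ∈ Icc 0 T, r' t = r t := fun t ht => IccExtend_of_mem hT _ ht
  set F : ℝ → ℝ → ℝ := fun t y => inner ℝ (r' t) (indicatorConstLp 2 (measurableSet_Iio (a := y))
    (measure_ne_top muOmega _) (1 : ℝ)) with hF
  have hFc : Continuous F.uncurry := by
    have h1 : Continuous fun y : ℝ => indicatorConstLp 2 (measurableSet_Iio (a := y))
        (measure_ne_top muOmega _) (1 : ℝ) := by
      refine continuous_indicatorConstLp_set (by norm_num) fun x => ?_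
      have h2 : Tendsto (fun y : ℝ => ENNReal.ofReal |y - x|) (𝓝 x) (𝓝 0) := by
        have : Tendsto (fun y : ℝ => |y - x|) (𝓝 x) (𝓝 |x - x|) := by
          apply Continuous.tendsto; fun_prop
        simpa using ENNReal.tendsto_ofReal this
      refine tendsto_of_tendsto_of_tendsto_of_le_of_le tendsto_const_nhds h2 (fun _ => zero_le)
        fun y => ?_
      refine (Measure.restrict_le_self _).trans ?_
      refine (measure_mono (t := uIcc x y) ?_).trans_eq Real.volume_interval
      rintro s (⟨h3, h4⟩ | ⟨h3, h4⟩)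
      · exact mem_uIcc.2 (Or.inl ⟨not_lt.1 h4, le_of_lt h3⟩)
      · exact mem_uIcc.2 (Or.inr ⟨not_lt.1 h4, le_of_lt h3⟩)
    exact (hr'c.comp continuous_fst).inner (h1.comp continuous_snd)
  have hm : Measurable fun p : ℝ × ℝ => deriv (F p.1) p.2 := measurable_deriv_with_param hFc
  have hd : ∀ t, ∀ᵐ x ∂muOmega, deriv (F t) x = r' t x := fun t => by
    filter_upwards [ae_hasDerivAt_inner_indicator (r' t)] with x hx using hx.deriv
  have hb : ∀ᵐ z ∂muControl T (Ioo (-1) 1), ‖deriv (F z.1) z.2‖ ≤ κ := by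
    rw [muControl_eq_prod (ω := Ioo (-1) 1), Measure.ae_prod_iff_ae_ae (measurableSet_le hm.norm measurable_const)]
    filter_upwards [ae_restrict_mem measurableSet_Ioo] with t ht
    have ht' := Ioo_subset_Icc_self ht
    filter_upwards [hd t, hκ t ht'] with x h1 h2
    rw [h1, hr'e t ht']; exact h2
  have hL : MemLp (fun p : ℝ × ℝ => deriv (F p.1) p.2) ∞ (muQ T) :=
    memLp_top_of_bound hm.aestronglyMeasurable κ hb
  refine ⟨hL.toLp, ?_⟩
  filter_upwards [ae_slice hL.coeFn_toLp, ae_restrict_mem measurableSet_Ioo] with t h4 ht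
  filter_upwards [h4, hd t] with x h5 h6
  rw [h5, h6, hr'e t (Ioo_subset_Icc_self ht)]

end

section

/-! ### Weak solutions as solutions of the evolution equation -/

variable {T : ℝ} {a : ℝ → ℝ} {ω : Set ℝ}

/-- The continuous representative is unique on `[0,T]`. -/
theorem IsContinuousRep.valueAt_eq (hT : 0 < T) {ρ : L2H1a T a} {r : ℝ → L2Omega}
    (hr : IsContinuousRep ρ r) : EqOn (valueAt ρ) r (Icc 0 T) := by
  have hex : ∃ r, IsContinuousRep ρ r := ⟨r, hr⟩
  have hv : valueAt ρ = hex.choose := by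
    funext t; rw [valueAt, dif_pos hex]
  have hc := hex.choose_spec
  rw [hv]
  refine Measure.eqOn_Icc_of_ae_eq volume hT.ne ?_ hc.1 hr.1
  rw [← restrict_Ioo_eq_restrict_Icc]
  filter_upwards [hc.2, hr.2] with t h1 h2
  rw [h1, h2]

theorem FormTriple.memLp_emb {V H K : Type*} [NormedAddCommGroup V] [InnerProductSpace ℝ V]
    [NormedAddCommGroup H] [InnerProductSpace ℝ H] [NormedAddCommGroup K] [InnerProductSpace ℝ K]
    (𝒢 : FormTriple V H K) {f : ℝ → H} (hf : MemLp f 2 (muTime T)) :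
    MemLp (fun t => 𝒢.emb (f t)) 2 (muTime T) := 𝒢.emb.comp_memLp' hf

theorem IsTimeDeriv.congr {E : Type*} [NormedAddCommGroup E] [NormedSpace ℝ E] {f g f' g' : ℝ → E}
    (h : IsTimeDeriv T f g) (hf : f =ᵐ[muTime T] f') (hg : g =ᵐ[muTime T] g') :
    IsTimeDeriv T f' g' := fun ψ h1 h2 h3 => by
  have e1 : ∫ t in Ioo 0 T, deriv ψ t • f t = ∫ t in Ioo 0 T, deriv ψ t • f' t :=
    integral_congr_ae (hf.mono fun t ht => congrArg (deriv ψ t • ·) ht)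
  have e2 : ∫ t in Ioo 0 T, ψ t • g t = ∫ t in Ioo 0 T, ψ t • g' t :=
    integral_congr_ae (hg.mono fun t ht => congrArg (ψ t • ·) ht)
  rw [← e1, ← e2]
  exact h ψ h1 h2 h3

variable (ha : IsDegenerateCoefficient a)

theorem exists_evolves_of_mem_Wa (hT : 0 < T) {ρ : L2H1a T a} (hρ : ρ ∈ Wa T a) :
    ∃ g r, Evolves ha.triple T ρ g r := by
  have := ha.completeSpace_H1a
  obtain ⟨g, hg⟩ := hρ
  obtain ⟨r, hr⟩ := exists_evolves (𝒢 := ha.triple) hT (Lp.memLp ρ) (Lp.memLp g) hg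
  exact ⟨g, r, hr⟩

theorem Evolves.mem_Wa (hT : 0 < T) {ρ : L2H1a T a} {g : ℝ → StrongDual ℝ (H1a a)}
    {r : ℝ → L2Omega} (h : Evolves ha.triple T ρ g r) : ρ ∈ Wa T a :=
  ⟨h.memLp_deriv.toLp, (h.isTimeDeriv hT.le).congr (EventuallyEq.refl _ _)
    h.memLp_deriv.coeFn_toLp.symm⟩

theorem Evolves.valueAt_eq (hT : 0 < T) {ρ : L2H1a T a} {g : ℝ → StrongDual ℝ (H1a a)}
    {r : ℝ → L2Omega} (h : Evolves ha.triple T ρ g r) : EqOn (valueAt ρ) r (Icc 0 T) :=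
  IsContinuousRep.valueAt_eq hT ⟨h.cont, h.ae_eq⟩

/-- Test functions of the weak formulation are curves of the evolution triple. -/
theorem HasL2TimeDeriv.evolves (hT : 0 < T) {φ : L2H1a T a} {φ' : L2Q T}
    (h : HasL2TimeDeriv φ φ') :
    Evolves ha.triple T φ (fun t => ha.triple.emb (φ' t)) (valueAt φ) := by
  have := ha.completeSpace_H1a
  have h1 : MemLp (fun t => ha.triple.emb (φ' t)) 2 (muTime T) :=
    ha.triple.memLp_emb (Lp.memLp φ')
  have h2 : IsTimeDeriv T (fun t => ha.triple.emb (ha.triple.ι (φ t)))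
      (fun t => ha.triple.emb (φ' t)) :=
    IsTimeDeriv.clm_comp (integrable_of_memLp_two ((toL2L a).comp_memLp' (Lp.memLp φ)))
      (integrable_of_memLp_two (Lp.memLp φ')) h _
  obtain ⟨r, hr⟩ := exists_evolves (𝒢 := ha.triple) hT (Lp.memLp φ) h1 h2
  have he := hr.valueAt_eq ha hT
  have h0 : (0 : ℝ) ∈ Icc 0 T := ⟨le_rfl, hT.le⟩
  exact
    { memLp := hr.memLp
      memLp_deriv := hr.memLp_deriv
      cont := hr.cont.congr he
      ae_eq := by
        filter_upwards [hr.ae_eq, ae_restrict_mem measurableSet_Ioo] with t h3 h4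
        rw [he (Ioo_subset_Icc_self h4), h3]
      emb_eq := fun t ht => by rw [he ht, he h0, hr.emb_eq t ht] }

variable (hω : MeasurableSet ω) (hΩ : ω ⊆ Ioo (-1) 1)

include hΩ in
/-- The form of the weak formulation as a single time integral of inner products. -/
theorem spaceTimeForm_eq (v : Control T ω) (p φ : L2H1a T a) {φ' : ℝ → L2Omega}
    (hφ' : MemLp φ' 2 (muTime T)) : spaceTimeForm v p φ φ' = ∫ t in Ioo 0 T,
      (inner ℝ (φ' t) (toL2 (p t)) + inner ℝ (wderiv (p t)) (wderiv (φ t))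
        - inner ℝ (potential hω v t (toL2 (p t))) (toL2 (φ t))) := by
  have hp : MemLp (fun t => toL2 (p t)) 2 (muTime T) := (toL2L a).comp_memLp' (Lp.memLp p)
  have hφ : MemLp (fun t => toL2 (φ t)) 2 (muTime T) := (toL2L a).comp_memLp' (Lp.memLp φ)
  have hp2 : MemLp (fun t => wderiv (p t)) 2 (muTime T) := (wderivL a).comp_memLp' (Lp.memLp p)
  have hφ2 : MemLp (fun t => wderiv (φ t)) 2 (muTime T) := (wderivL a).comp_memLp' (Lp.memLp φ)
  have i1 := integrable_inner_of_memLp hφ' hp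
  have i2 := integrable_inner_of_memLp hp2 hφ2
  have i3 := integrable_inner_of_memLp ((boundedFamily_potential hω v).memLp hp) hφ
  rw [integral_sub (f := fun t => inner ℝ (φ' t) (toL2 (p t))
    + inner ℝ (wderiv (p t)) (wderiv (φ t))) (i1.add i2) i3, integral_add i1 i2, spaceTimeForm]
  simp_rw [inner_L2Omega (φ' _), inner_L2Omega (wderiv _)]
  congr 1
  refine integral_congr_ae ?_
  filter_upwards [ae_integral_control hω hΩ v] with t ht using ht _ _

include hΩ in
/-- Solutions of the evolution equation are weak solutions, by integration by parts. -/
theorem isWeakSolution_of_solves (hT : 0 < T) {v : Control T ω} {p : L2H1a T a} {f r : ℝ → L2Omega}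
    (h : Solves ha.triple T p f r) (hf : ∀ᵐ t ∂muTime T, f t = potential hω v t (r t)) :
    IsWeakSolution v (r 0) p := by
  have := ha.completeSpace_H1a
  refine ⟨h.evolves.mem_Wa ha hT, fun φ φ' hφ hφT => ?_⟩
  have hE := hφ.evolves ha hT
  have key := h.evolves.integral_pairing hE (right_mem_Icc.2 hT.le)
  rw [hφT, inner_zero_right, zero_sub, ← integral_Ioo_eq hT.le] at key
  rw [spaceTimeForm_eq hω hΩ v p φ (φ' := fun t => -φ' t) (Lp.memLp φ').neg, ← inner_L2Omega, ← neg_inj, ← key,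
    ← integral_neg]
  refine integral_congr_ae ?_
  filter_upwards [hf, h.evolves.ae_eq] with t h1 h2
  simp only [sub_apply, FormTriple.emb_apply, FormTriple.embD_apply, h1, h2,
    IsDegenerateCoefficient.triple_ι, IsDegenerateCoefficient.triple_D,
    inner_neg_left]
  ring

include hΩ in
/-- Weak solutions solve the evolution equation, since `C¹` curves are admissible test functions. -/
theorem IsWeakSolution.exists_solves (hT : 0 < T) {v : Control T ω} {p₀ : L2Omega}
    {p : L2H1a T a} (h : IsWeakSolution v p₀ p) :
    ∃ r, Solves ha.triple T p (fun t => potential hω v t (r t)) r ∧ r 0 = p₀ := by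
  have := ha.completeSpace_H1a
  have hp : MemLp (fun t => toL2 (p t)) 2 (muTime T) := (toL2L a).comp_memLp' (Lp.memLp p)
  obtain ⟨r, hr, hr0⟩ := exists_solves_of_weak (𝒢 := ha.triple) (p₀ := p₀) hT (Lp.memLp p)
    ((boundedFamily_potential hω v).memLp hp) (fun φ hφ hφT => by
      have m1 : MemLp φ 2 (muTime T) := memLp_of_continuousOn hφ.continuous.continuousOn 2
      have hd : Continuous fun t => toL2L a (deriv φ t) :=
        (toL2L a).continuous.comp (hφ.continuous_deriv le_rfl)
      have m2 : MemLp (fun t => toL2L a (deriv φ t)) 2 (muTime T) :=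
        memLp_of_continuousOn hd.continuousOn 2
      have hrep : IsContinuousRep m1.toLp fun t => toL2L a (φ t) := by
        refine ⟨((toL2L a).continuous.comp hφ.continuous).continuousOn, ?_⟩
        filter_upwards [m1.coeFn_toLp] with t ht
        rw [ht]; rfl
      have hval := hrep.valueAt_eq hT
      have htd : HasL2TimeDeriv m1.toLp m2.toLp := by
        refine (isTimeDeriv_of_primitive hT.le (F := fun t => toL2L a (φ t))
          (g := fun t => toL2L a (deriv φ t)) (c := toL2L a (φ 0))
          (integrable_of_memLp_two m2) (Eventually.of_forall fun t => ?_)).congr ?_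
          m2.coeFn_toLp.symm
        · have hi := (hφ.continuous_deriv le_rfl).intervalIntegrable (μ := volume) 0 t
          have h1 := intervalIntegral.integral_eq_sub_of_hasDerivAt
            (fun s _ => (hφ.differentiable one_ne_zero s).hasDerivAt) hi
          rw [(toL2L a).intervalIntegral_comp_comm hi, h1, map_sub]; abel
        · filter_upwards [m1.coeFn_toLp] with t ht
          rw [ht]; rfl
      have key := h.2 m1.toLp m2.toLp htd (by
        rw [hval (right_mem_Icc.2 hT.le)]; simp only [hφT, map_zero])
      rw [spaceTimeForm_eq hω hΩ v p _ (φ' := fun t => -m2.toLp _ t) (Lp.memLp (m2.toLp _)).neg, ← inner_L2Omega,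
        hval (left_mem_Icc.2 hT.le)] at key
      rw [ha.triple_ι, ← toL2L_apply, ← key]
      refine integral_congr_ae ?_
      filter_upwards [m1.coeFn_toLp, m2.coeFn_toLp] with t h1 h2
      rw [h1, h2, inner_neg_left, real_inner_comm (wderiv (φ t)),
        real_inner_comm (toL2 (φ t))]
      rfl)
  refine ⟨r, hr.congr (EventuallyEq.refl _ _) ?_, hr0⟩
  filter_upwards [hr.evolves.ae_eq] with t ht
  rw [ht]; rfl

/-- A solution of the evolution equation may be given as an element of the Bochner space. -/
theorem Solves.exists_Lp {ρ : ℝ → H1a a} {f r : ℝ → L2Omega} (h : Solves ha.triple T ρ f r) :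
    ∃ p : L2H1a T a, Solves ha.triple T p f r :=
  ⟨h.evolves.memLp.toLp, h.congr h.evolves.memLp.coeFn_toLp.symm (EventuallyEq.refl _ _)⟩

include ha hω hΩ in
theorem exists_isWeakSolution (hT : 0 < T) (v : Control T ω) (p₀ : L2Omega) :
    ∃ p : L2H1a T a, IsWeakSolution v p₀ p := by
  have := ha.completeSpace_H1a
  obtain ⟨ρ, r, h, rfl⟩ := exists_solves ha.triple hT (boundedFamily_potential hω v) p₀
  obtain ⟨p, hp⟩ := h.exists_Lp ha
  exact ⟨p, isWeakSolution_of_solves ha hω hΩ hT hp (Eventually.of_forall fun _ => rfl)⟩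

include ha hω hΩ in
theorem IsWeakSolution.unique (hT : 0 < T) {v : Control T ω} {p₀ : L2Omega} {p p' : L2H1a T a}
    (h : IsWeakSolution v p₀ p) (h' : IsWeakSolution v p₀ p') : p = p' := by
  have := ha.completeSpace_H1a
  obtain ⟨r, hr, hr0⟩ := h.exists_solves ha hω hΩ hT
  obtain ⟨s, hs, hs0⟩ := h'.exists_solves ha hω hΩ hT
  refine Lp.ext (hr.eqOn hs (norm_nonneg v) (Eventually.of_forall fun t => ?_)
    (hr0.trans hs0.symm)).2
  rw [← map_sub]
  exact norm_potential_le hω v t _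

include ha hω hΩ in
theorem isWeakSolution_stateMap (hT : 0 < T) (y₀ : L2Omega) (v : Control T ω) :
    IsWeakSolution v y₀ (stateMap a y₀ v) := by
  have h := exists_isWeakSolution ha hω hΩ hT v y₀
  rw [stateMap, dif_pos h]
  exact h.choose_spec

/-- `s ∈ C([0,T]; L²(Ω))` represents a solution `q` of the backward equation with potential `v`. -/
def SolvesBackward (v : Control T ω) (q : L2H1a T a) (s : ℝ → L2Omega) : Prop :=
  Evolves ha.triple T q
    (fun t => ha.triple.embD (ha.triple.D (q t)) - ha.triple.emb (potential hω v t (s t))) s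

/-- The backward problem is solved by reversing time. -/
theorem exists_solvesBackward (hT : 0 < T) (v : Control T ω) (qT : L2Omega) :
    ∃ (q : L2H1a T a) (s : ℝ → L2Omega), SolvesBackward ha hω v q s ∧ s T = qT ∧
      ∀ κ : ℝ, 0 ≤ κ → (∀ᵐ x ∂muOmega, |qT x| ≤ κ) → ∀ t ∈ Icc 0 T,
        ∀ᵐ x ∂muOmega, |s t x| ≤ κ * Real.exp (‖v‖ * T) := by
  have := ha.completeSpace_H1a
  obtain ⟨ρ, r, h, rfl⟩ := exists_solves ha.triple hT (boundedFamily_potential hω v).reverse qT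
  have hE := h.evolves.reverse
  refine ⟨hE.memLp.toLp, fun t => r (T - t), ?_, by simp, fun κ hκ h0 t ht => ?_⟩
  · refine hE.congr hE.memLp.coeFn_toLp.symm ?_
    filter_upwards [hE.memLp.coeFn_toLp] with t ht
    rw [ht, sub_sub_cancel, neg_sub]
  · exact h.ae_abs_le hω ha (θ := fun t => T - t) (Eventually.of_forall fun _ => rfl) hκ h0
      ⟨by linarith [ht.2], by linarith [ht.1]⟩

include hΩ in
theorem SolvesBackward.isBackwardWeakSolution (hT : 0 < T) {v : Control T ω} {q : L2H1a T a}
    {s : ℝ → L2Omega} (h : SolvesBackward ha hω v q s) : IsBackwardWeakSolution v (s T) q := by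
  have := ha.completeSpace_H1a
  refine ⟨Evolves.mem_Wa ha hT h, fun φ φ' hφ hφ0 => ?_⟩
  have key := Evolves.integral_pairing h (hφ.evolves ha hT) (right_mem_Icc.2 hT.le)
  rw [hφ0, inner_zero_right, sub_zero, ← integral_Ioo_eq hT.le] at key
  rw [spaceTimeForm_eq hω hΩ v q φ (Lp.memLp φ'), ← inner_L2Omega, ← key]
  refine integral_congr_ae ?_
  filter_upwards [h.ae_eq] with t h2
  simp only [sub_apply, FormTriple.emb_apply, FormTriple.embD_apply, h2,
    IsDegenerateCoefficient.triple_ι, IsDegenerateCoefficient.triple_D]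
  ring

end

section

/-! ### Differentiability of the reduced cost functional -/

/-- A quadratic bound on the remainder gives Fréchet differentiability. -/
theorem hasFDerivAt_of_abs_sub_le {E : Type*} [NormedAddCommGroup E] [NormedSpace ℝ E]
    {J : E → ℝ} {L : StrongDual ℝ E} {u : E} (C : ℝ)
    (h : ∀ w, ‖w‖ ≤ 1 → |J (u + w) - J u - L w| ≤ C * ‖w‖ ^ 2) : HasFDerivAt J L u := by
  rw [hasFDerivAt_iff_isLittleO_nhds_zero]
  refine Asymptotics.IsBigO.trans_isLittleO (g := fun h : E => ‖h‖ ^ 2) ?_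
    (Asymptotics.isLittleO_norm_pow_id one_lt_two)
  refine Asymptotics.IsBigO.of_bound C ?_
  filter_upwards [Metric.closedBall_mem_nhds (0 : E) one_pos] with w hw
  rw [norm_pow, norm_norm, Real.norm_eq_abs]
  exact h w (by simpa using hw)

variable {T : ℝ} {a : ℝ → ℝ} {ω : Set ℝ}

theorem integrable_mul_control {g : ℝ × ℝ → ℝ} (hg : Integrable g (muControl T ω))
    (w : Control T ω) : Integrable (fun z => g z * w z) (muControl T ω) :=
  hg.mul_bdd (Lp.aestronglyMeasurable w) (ae_norm_control_le w)

/-- Integration against an integrable function, as a functional on `L^∞(ω_T)`. -/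
def pairing (g : ℝ × ℝ → ℝ) (hg : Integrable g (muControl T ω)) : StrongDual ℝ (Control T ω) :=
  LinearMap.mkContinuous
    { toFun := fun w => ∫ z in Ioo 0 T ×ˢ ω, g z * w z
      map_add' := fun w w' => by
        rw [← integral_add (integrable_mul_control hg w) (integrable_mul_control hg w')]
        refine integral_congr_ae ?_
        filter_upwards [Lp.coeFn_add w w'] with z hz
        rw [hz, Pi.add_apply, mul_add]
      map_smul' := fun c w => by
        rw [RingHom.id_apply, smul_eq_mul, ← integral_const_mul]
        refine integral_congr_ae ?_
        filter_upwards [Lp.coeFn_smul c w] with z hz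
        rw [hz, Pi.smul_apply, smul_eq_mul]; ring } (∫ z in Ioo 0 T ×ˢ ω, |g z|) fun w => by
    rw [← integral_mul_const]
    refine norm_integral_le_of_norm_le (hg.abs.mul_const _) ?_
    filter_upwards [ae_norm_control_le w] with z hz
    rw [norm_mul]
    exact mul_le_mul_of_nonneg_left hz (abs_nonneg _)

@[simp] theorem pairing_apply (g : ℝ × ℝ → ℝ) (hg : Integrable g (muControl T ω))
    (w : Control T ω) : pairing g hg w = ∫ z in Ioo 0 T ×ˢ ω, g z * w z := rfl

section

variable (hω : MeasurableSet ω) (hΩ : ω ⊆ Ioo (-1) 1)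
include hΩ

theorem muControl_le_muQ : muControl T ω ≤ muQ T :=
  Measure.restrict_mono (prod_mono le_rfl hΩ) le_rfl

theorem isFiniteMeasure_muControl : IsFiniteMeasure (muControl T ω) := by
  have : IsFiniteMeasure (muQ T) := by
    rw [muQ, Measure.volume_eq_prod, ← Measure.prod_restrict]
    infer_instance
  exact isFiniteMeasure_of_le _ (muControl_le_muQ hΩ)

theorem memLp_top_muControl (Y : Lp ℝ ∞ (muQ T)) : MemLp Y ∞ (muControl T ω) :=
  (Lp.memLp Y).mono_measure (muControl_le_muQ hΩ)

theorem integrable_gradient (α : ℝ) (u : Control T ω) (Y Q : Lp ℝ ∞ (muQ T)) :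
    Integrable (fun z => α * u z + Y z * Q z) (muControl T ω) := by
  have := isFiniteMeasure_muControl (T := T) hΩ
  have h1 : Integrable u (muControl T ω) := (Lp.memLp u).integrable le_top
  have h2 : MemLp (fun z => Y z * Q z) ∞ (muControl T ω) :=
    (memLp_top_muControl hΩ Q).mul (memLp_top_muControl hΩ Y)
  exact (h1.const_mul α).add (h2.integrable le_top)

/-- Fubini: the control term as a time integral of inner products and as an integral over the control
region. -/
theorem integral_potential_eq {r s : ℝ → L2Omega} {Y Q : Lp ℝ ∞ (muQ T)}
    (hY : ∀ᵐ t ∂muTime T, r t =ᵐ[muOmega] fun x => Y (t, x))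
    (hQ : ∀ᵐ t ∂muTime T, s t =ᵐ[muOmega] fun x => Q (t, x)) (w : Control T ω) :
    ∫ t in Ioo 0 T, inner ℝ (potential hω w t (r t)) (s t)
      = (∫ z in Ioo 0 T ×ˢ ω, Y z * Q z * w z) := by
  have := isFiniteMeasure_muControl (T := T) hΩ
  have h2 : MemLp (fun z => Y z * Q z) ∞ (muControl T ω) :=
    (memLp_top_muControl hΩ Q).mul (memLp_top_muControl hΩ Y)
  have h3 := integrable_mul_control (h2.integrable le_top) w
  refine Eq.trans ?_ (setIntegral_prod (μ := volume) (ν := volume) _ h3).symm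
  refine integral_congr_ae ?_
  filter_upwards [hY, hQ, ae_integral_control hω hΩ w] with t e1 e2 e3
  rw [← e3]
  refine integral_congr_ae ?_
  filter_upwards [ae_restrict_of_ae_restrict_of_subset hΩ e1,
    ae_restrict_of_ae_restrict_of_subset hΩ e2] with x d1 d2
  rw [d1, d2]; ring

variable (ha : IsDegenerateCoefficient a)
include ha

omit hΩ in
/-- The states depend Lipschitz continuously on the control. -/
theorem exists_state_lipschitz (hT : 0 < T) {u : Control T ω} {y : L2H1a T a} {r : ℝ → L2Omega}
    (hy : Solves ha.triple T y (fun t => potential hω u t (r t)) r) :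
    ∃ C, 0 ≤ C ∧ ∀ (w : Control T ω) (y' : L2H1a T a) (r' : ℝ → L2Omega), ‖w‖ ≤ 1 →
      Solves ha.triple T y' (fun t => potential hω (u + w) t (r' t)) r' → r' 0 = r 0 →
      ∀ t ∈ Icc 0 T, ‖r' t - r t‖ ≤ C * ‖w‖ := by
  have := ha.completeSpace_H1a
  obtain ⟨R, hR⟩ := isCompact_Icc.exists_bound_of_continuousOn hy.evolves.cont
  set N := T * R ^ 2 * Real.exp ((2 * (‖u‖ + 1) + 1) * T) with hN
  have hN0 : 0 ≤ N := by positivity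
  refine ⟨√N, Real.sqrt_nonneg _, fun w y' r' hw hy' h0 t ht => ?_⟩
  have hadd := potential_add_apply hω u w
  have key := (hy'.sub hy).norm_sq_le (c := ‖u‖ + 1) (b := ‖w‖ * R) (by positivity) (by
    filter_upwards [hadd, ae_restrict_mem measurableSet_Ioo] with τ h1 h2
    -- the difference solves an equation with potential `u + w` and source `w r`
    have e : potential hω (u + w) τ (r' τ) - potential hω u τ (r τ)
        = potential hω (u + w) τ (r' τ - r τ) + potential hω w τ (r τ) := by
      rw [map_sub, h1 (r τ)]; abel
    rw [e]
    refine (norm_add_le _ _).trans (add_le_add ?_ ?_)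
    · refine (norm_potential_le hω _ _ _).trans (mul_le_mul_of_nonneg_right ?_ (norm_nonneg _))
      exact (norm_add_le _ _).trans (by linarith)
    · exact (norm_potential_le hω _ _ _).trans
        (mul_le_mul_of_nonneg_left (hR τ (Ioo_subset_Icc_self h2)) (norm_nonneg _))) ht
  refine abs_le_of_sq_le_sq' ?_ (by positivity) |>.2
  refine key.trans_eq ?_
  rw [h0, sub_self, norm_zero, mul_pow √N, Real.sq_sqrt hN0, hN]
  ring

omit hΩ in
/-- The adjoint state represents the variation of the final state. -/
theorem inner_sub_final (hT : 0 < T) {u w : Control T ω} {y y' q : L2H1a T a}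
    {r r' s : ℝ → L2Omega} (hy : Solves ha.triple T y (fun t => potential hω u t (r t)) r)
    (hy' : Solves ha.triple T y' (fun t => potential hω (u + w) t (r' t)) r') (h0 : r' 0 = r 0)
    (hq : SolvesBackward ha hω u q s) :
    inner ℝ (r' T - r T) (s T) = ∫ t in Ioo 0 T, inner ℝ (potential hω w t (r' t)) (s t) := by
  have := ha.completeSpace_H1a
  have key := (hy'.sub hy).evolves.integral_pairing hq (right_mem_Icc.2 hT.le)
  rw [h0, sub_self, inner_zero_left, sub_zero, ← integral_Ioo_eq hT.le] at key
  rw [← key]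
  refine integral_congr_ae ?_
  filter_upwards [potential_add_apply hω u w, hy.evolves.ae_eq, hy'.evolves.ae_eq, hq.ae_eq]
    with t e1 e2 e3 e4
  simp only [sub_apply, FormTriple.emb_apply, FormTriple.embD_apply, map_sub, ← e2, ← e3, ← e4]
  rw [e1, real_inner_comm (ha.triple.D (y' t)), real_inner_comm (ha.triple.D (y t))]
  simp only [inner_add_left]
  rw [inner_potential_comm hω u t (s t), inner_potential_comm hω u t (s t),
    real_inner_comm (s t) (potential hω u t (r t)), real_inner_comm (s t) (potential hω u t (r' t))]
  ring

/-- The derivative of the reduced cost functional, in terms of the state and the adjoint state. -/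
theorem hasFDerivAt_cost (hT : 0 < T) (α : ℝ) {y₀ yd : L2Omega} {u : Control T ω}
    {y q : L2H1a T a} {r s : ℝ → L2Omega} {Y Q : Lp ℝ ∞ (muQ T)}
    (hy : Solves ha.triple T y (fun t => potential hω u t (r t)) r) (h0 : r 0 = y₀)
    (hq : SolvesBackward ha hω u q s) (hsT : s T = r T - yd)
    (hY : ∀ᵐ t ∂muTime T, r t =ᵐ[muOmega] fun x => Y (t, x))
    (hQ : ∀ᵐ t ∂muTime T, s t =ᵐ[muOmega] fun x => Q (t, x)) :
    HasFDerivAt (cost a α y₀ yd) (pairing _ (integrable_gradient hΩ α u Y Q)) u := by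
  have := ha.completeSpace_H1a
  have hfin := isFiniteMeasure_muControl (T := T) hΩ
  obtain ⟨C, hC, hlip⟩ := exists_state_lipschitz hω ha hT hy
  obtain ⟨S, hS⟩ := isCompact_Icc.exists_bound_of_continuousOn hq.cont
  have hS0 : 0 ≤ S := (norm_nonneg _).trans (hS 0 (left_mem_Icc.2 hT.le))
  have hTT := right_mem_Icc.2 hT.le
  have h00 := left_mem_Icc.2 hT.le
  set V := (muControl T ω).real univ with hV
  refine hasFDerivAt_of_abs_sub_le (1 / 2 * C ^ 2 + C * S * T + |α| / 2 * V) fun w hw => ?_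
  -- the state at a control, and its continuous representative
  have hstate : ∀ v : Control T ω, ∃ r' : ℝ → L2Omega, Solves ha.triple T (stateMap a y₀ v)
      (fun t => potential hω v t (r' t)) r' ∧ r' 0 = y₀ ∧ valueAt (stateMap a y₀ v) T = r' T := by
    intro v
    obtain ⟨r', h1, h2⟩ := (isWeakSolution_stateMap ha hω hΩ hT y₀ v).exists_solves ha hω hΩ hT
    exact ⟨r', h1, h2, h1.evolves.valueAt_eq ha hT hTT⟩
  obtain ⟨r₁, hr₁, hr₁0, hr₁T⟩ := hstate u
  obtain ⟨r', hr', hr'0, hr'T⟩ := hstate (u + w)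
  have hr₁r : r₁ T = r T := (hr₁.eqOn hy (norm_nonneg u) (Eventually.of_forall fun t => by
    rw [← map_sub]; exact norm_potential_le hω u t _) (by rw [hr₁0, h0])).1 hTT
  have hδ := hlip w _ r' hw hr' (by rw [hr'0, h0])
  have hadj := inner_sub_final hω ha hT hy hr' (by rw [hr'0, h0]) hq
  have mr := hy.memLp_rep
  have mr' := hr'.memLp_rep
  have ms : MemLp s 2 (muTime T) := memLp_of_continuousOn hq.cont 2
  have i1 : Integrable (fun t => inner ℝ (potential hω w t (r t)) (s t)) (muTime T) :=
    integrable_inner_of_memLp ((boundedFamily_potential hω w).memLp mr) ms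
  have i2 : Integrable (fun t => inner ℝ (potential hω w t (r' t - r t)) (s t)) (muTime T) :=
    integrable_inner_of_memLp ((boundedFamily_potential hω w).memLp (mr'.sub mr)) ms
  -- expansion of the linear term, of the quadratic terms, and bounds for the remainders
  have hsplit : ∫ t in Ioo 0 T, inner ℝ (potential hω w t (r' t)) (s t)
      = (∫ z in Ioo 0 T ×ˢ ω, Y z * Q z * w z)
        + (∫ t in Ioo 0 T, inner ℝ (potential hω w t (r' t - r t)) (s t)) := by
    rw [← integral_potential_eq hω hΩ hY hQ w, ← integral_add i1 i2]
    refine integral_congr_ae (Eventually.of_forall fun t => ?_)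
    simp only [map_sub, inner_sub_left]; ring
  have hrem : |(∫ t in Ioo 0 T, inner ℝ (potential hω w t (r' t - r t)) (s t))|
      ≤ C * S * T * ‖w‖ ^ 2 := by
    have h1 := norm_setIntegral_le_of_norm_le_const_ae' (μ := volume) (s := Ioo 0 T)
      (f := fun t => (inner ℝ (potential hω w t (r' t - r t)) (s t) : ℝ))
      (C := ‖w‖ * (C * ‖w‖) * S) (by simp) (by
        refine Eventually.of_forall fun t ht => ?_
        have ht' := Ioo_subset_Icc_self ht
        refine (norm_inner_le_norm _ _).trans (mul_le_mul ?_ (hS t ht') (norm_nonneg _)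
          (by positivity))
        exact (norm_potential_le hω _ _ _).trans
          (mul_le_mul_of_nonneg_left (hδ t ht') (norm_nonneg _)))
    rw [Real.norm_eq_abs] at h1
    refine h1.trans_eq ?_
    rw [Measure.real, Real.volume_Ioo, sub_zero, ENNReal.toReal_ofReal hT.le]
    ring
  have bu : ∀ v v' : Control T ω, Integrable (fun z => v z * v' z) (muControl T ω) := fun v v' =>
    integrable_mul_control ((Lp.memLp v).integrable le_top) v'
  have hquad : ∫ z in Ioo 0 T ×ˢ ω, (u + w) z ^ 2 = (∫ z in Ioo 0 T ×ˢ ω, u z ^ 2)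
      + 2 * (∫ z in Ioo 0 T ×ˢ ω, u z * w z) + (∫ z in Ioo 0 T ×ˢ ω, w z * w z) := by
    have hu2 : (∫ z in Ioo 0 T ×ˢ ω, u z ^ 2) = (∫ z in Ioo 0 T ×ˢ ω, u z * u z) := by
      simp_rw [sq]
    rw [hu2, ← integral_const_mul, ← integral_add (bu u u) ((bu u w).const_mul 2),
      ← integral_add (f := fun z => u z * u z + 2 * (u z * w z))
        ((bu u u).add ((bu u w).const_mul 2)) (bu w w)]
    refine integral_congr_ae ?_
    filter_upwards [Lp.coeFn_add u w] with z hz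
    rw [hz, Pi.add_apply]; ring
  have hww : |(∫ z in Ioo 0 T ×ˢ ω, w z * w z)| ≤ V * ‖w‖ ^ 2 := by
    have h1 := norm_integral_le_of_norm_le_const (μ := muControl T ω) (f := fun z => w z * w z)
      (C := ‖w‖ ^ 2) (by
        filter_upwards [ae_norm_control_le w] with z hz
        rw [norm_mul, ← sq]
        exact pow_le_pow_left₀ (abs_nonneg _) hz 2)
    rw [Real.norm_eq_abs] at h1
    refine h1.trans_eq (mul_comm _ _)
  have hL : pairing _ (integrable_gradient hΩ α u Y Q) w
      = α * (∫ z in Ioo 0 T ×ˢ ω, u z * w z) + (∫ z in Ioo 0 T ×ˢ ω, Y z * Q z * w z) := by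
    have h2 : MemLp (fun z => Y z * Q z) ∞ (muControl T ω) :=
      (memLp_top_muControl hΩ Q).mul (memLp_top_muControl hΩ Y)
    rw [pairing_apply, ← integral_const_mul, ← integral_add ((bu u w).const_mul α)
      (integrable_mul_control (h2.integrable le_top) w)]
    congr 1 with z
    ring
  have hnorm : ‖r' T - yd‖ ^ 2 = ‖r T - yd‖ ^ 2 + 2 * inner ℝ (r' T - r T) (s T)
      + ‖r' T - r T‖ ^ 2 := by
    have e : r' T - yd = (r' T - r T) + (r T - yd) := by abel
    rw [e, norm_add_sq_real, hsT]; ring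
  have hδT := hδ T hTT
  have hδ2 : ‖r' T - r T‖ ^ 2 ≤ C ^ 2 * ‖w‖ ^ 2 := by
    rw [← mul_pow]; exact pow_le_pow_left₀ (norm_nonneg _) hδT 2
  rw [hL, cost, cost, hr'T, hr₁T, hr₁r, hquad, hnorm, hadj, hsplit]
  have e : 1 / 2 * (‖r T - yd‖ ^ 2 + 2 * ((∫ z in Ioo 0 T ×ˢ ω, Y z * Q z * w z)
        + (∫ t in Ioo 0 T, inner ℝ (potential hω w t (r' t - r t)) (s t))) + ‖r' T - r T‖ ^ 2)
      + α / 2 * ((∫ z in Ioo 0 T ×ˢ ω, u z ^ 2) + 2 * (∫ z in Ioo 0 T ×ˢ ω, u z * w z)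
        + (∫ z in Ioo 0 T ×ˢ ω, w z * w z))
      - (1 / 2 * ‖r T - yd‖ ^ 2 + α / 2 * (∫ z in Ioo 0 T ×ˢ ω, u z ^ 2))
      - (α * (∫ z in Ioo 0 T ×ˢ ω, u z * w z) + (∫ z in Ioo 0 T ×ˢ ω, Y z * Q z * w z))
      = 1 / 2 * ‖r' T - r T‖ ^ 2
        + (∫ t in Ioo 0 T, inner ℝ (potential hω w t (r' t - r t)) (s t))
        + α / 2 * (∫ z in Ioo 0 T ×ˢ ω, w z * w z) := by ring
  rw [e]
  refine (abs_add_le _ _).trans ?_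
  refine (add_le_add_left (abs_add_le _ _) _).trans ?_
  rw [abs_of_nonneg (a := 1 / 2 * ‖r' T - r T‖ ^ 2) (by positivity), abs_mul, abs_div,
    abs_of_pos (a := (2 : ℝ)) two_pos]
  have h5 := mul_le_mul_of_nonneg_left hww (show 0 ≤ |α| / 2 by positivity)
  nlinarith

end

end

section

/-! ### Variational inequality and projection formula -/

/-- The variational characterization of the projection onto `[m, M]`. -/
theorem mul_sub_clamp_nonpos {m M : ℝ} (p x : ℝ) (hx : m ≤ x ∧ x ≤ M) :
    (p - min (max m p) M) * (x - min (max m p) M) ≤ 0 := by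
  rcases le_total p m with h | h
  · rw [max_eq_left h, min_eq_left (hx.1.trans hx.2)]
    exact mul_nonpos_of_nonpos_of_nonneg (by linarith) (by linarith [hx.1])
  · rw [max_eq_right h]
    rcases le_total p M with h' | h'
    · rw [min_eq_left h']; simp
    · rw [min_eq_right h']
      exact mul_nonpos_of_nonneg_of_nonpos (by linarith) (by linarith [hx.2])

variable {T : ℝ} {ω : Set ℝ}

/-- The variational inequality with the density `α (u - p)` says that `u` is the pointwise
projection of `p` onto the interval of admissible values. -/
theorem variational_iff_projection [IsFiniteMeasure (muControl T ω)] {α m M : ℝ} (hα : 0 < α)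
    (hmM : m ≤ M) {u : Control T ω} (hu : u ∈ admissible T ω m M) {g p : ℝ × ℝ → ℝ}
    (hg : Integrable g (muControl T ω)) (hp : AEStronglyMeasurable p (muControl T ω))
    (hgp : ∀ᵐ z ∂muControl T ω, g z = α * (u z - p z)) :
    (∀ v ∈ admissible T ω m M, 0 ≤ ∫ z in Ioo 0 T ×ˢ ω, g z * (v z - u z)) ↔
      ∀ᵐ z ∂muControl T ω, u z = min (max m (p z)) M := by
  have hgi : ∀ v : Control T ω, Integrable (fun z => g z * (v z - u z)) (muControl T ω) :=
    fun v => by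
      simp_rw [mul_sub]
      exact (integrable_mul_control hg v).sub (integrable_mul_control hg u)
  constructor
  · intro h
    have hb : ∀ z, m ≤ min (max m (p z)) M ∧ min (max m (p z)) M ≤ M := fun z =>
      ⟨le_min (le_max_left _ _) hmM, min_le_right _ _⟩
    have hL : MemLp (fun z => min (max m (p z)) M) ∞ (muControl T ω) := by
      refine memLp_top_of_bound ?_ (max |m| |M|) (Eventually.of_forall fun z => ?_)
      · exact (aestronglyMeasurable_const.sup hp).inf aestronglyMeasurable_const
      · exact abs_le_max_abs_abs (hb z).1 (hb z).2
    set v : Control T ω := hL.toLp with hv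
    have hve := hL.coeFn_toLp
    have h1 := h v (by
      filter_upwards [hve] with z hz
      rw [hz]; exact hb z)
    -- the integrand is nonpositive for this choice of `v`, hence it vanishes
    have hle : ∀ᵐ z ∂muControl T ω, g z * (v z - u z) ≤ -(α * (u z - v z) ^ 2) := by
      filter_upwards [hve, hgp, hu] with z e1 e2 e3
      have key := mul_sub_clamp_nonpos (p z) (u z) e3
      rw [e2, e1]
      nlinarith
    have hz0 : 0 ≤ᵐ[muControl T ω] fun z => -(g z * (v z - u z)) := by
      filter_upwards [hle] with z hz
      have : 0 ≤ α * (u z - v z) ^ 2 := by positivity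
      show 0 ≤ -(g z * (v z - u z))
      linarith
    have h2 : ∫ z in Ioo 0 T ×ˢ ω, -(g z * (v z - u z)) = 0 :=
      le_antisymm (by rw [integral_neg]; linarith) (integral_nonneg_of_ae hz0)
    have h3 := (integral_eq_zero_iff_of_nonneg_ae hz0 (hgi v).neg).1 h2
    filter_upwards [h3, hle, hve] with z e1 e2 e3
    rw [← e3]
    have e4 : g z * (v z - u z) = 0 := neg_eq_zero.1 e1
    have e5 : (u z - v z) ^ 2 = 0 :=
      le_antisymm (nonpos_of_mul_nonpos_right (by linarith) hα) (sq_nonneg _)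
    exact sub_eq_zero.1 (pow_eq_zero_iff two_ne_zero |>.1 e5)
  · intro h v hv
    refine integral_nonneg_of_ae ?_
    filter_upwards [h, hgp, hv] with z e1 e2 e3
    have key := mul_sub_clamp_nonpos (p z) (v z) e3
    rw [← e1] at key
    show 0 ≤ g z * (v z - u z)
    rw [e2]
    nlinarith

theorem convex_admissible (T : ℝ) (ω : Set ℝ) (m M : ℝ) : Convex ℝ (admissible T ω m M) := by
  intro v hv w hw b c hb hc hbc
  filter_upwards [hv, hw, Lp.coeFn_add (b • v) (c • w), Lp.coeFn_smul b v, Lp.coeFn_smul c w]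
    with z h1 h2 h3 h4 h5
  rw [h3, Pi.add_apply, h4, h5, Pi.smul_apply, Pi.smul_apply]
  exact convex_Icc m M h1 h2 hb hc hbc

theorem IsLinftyLocalMin.fderiv_nonneg {a : ℝ → ℝ} {α m M : ℝ} {y₀ yd : L2Omega}
    {u : Control T ω} (h : IsLinftyLocalMin a α m M y₀ yd u)
    (hd : DifferentiableAt ℝ (cost a α y₀ yd) u) {v : Control T ω}
    (hv : v ∈ admissible T ω m M) : 0 ≤ fderiv ℝ (cost a α y₀ yd) u (v - u) := by
  obtain ⟨hu, ε, hε, hmin⟩ := h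
  have hloc : IsLocalMinOn (cost a α y₀ yd) (admissible T ω m M) u := by
    filter_upwards [self_mem_nhdsWithin, mem_nhdsWithin_of_mem_nhds (Metric.ball_mem_nhds u hε)]
      with w hw hwε
    exact hmin w hw (by rwa [← dist_eq_norm])
  exact hloc.hasFDerivWithinAt_nonneg hd.hasFDerivAt.hasFDerivWithinAt
    (sub_mem_posTangentConeAt_of_segment_subset ((convex_admissible T ω m M).segment_subset hu hv))

theorem exists_ae_abs_le_of_memLp_top {h : ℝ → ℝ} (hh : MemLp h ∞ muOmega) :
    ∃ κ : ℝ, 0 ≤ κ ∧ ∀ᵐ x ∂muOmega, |h x| ≤ κ := by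
  refine ⟨(eLpNormEssSup h muOmega).toReal, ENNReal.toReal_nonneg, ?_⟩
  have h1 := hh.2
  rw [eLpNorm_exponent_top] at h1
  filter_upwards [ae_le_eLpNormEssSup (f := h) (μ := muOmega)] with x hx
  simpa using ENNReal.toReal_mono h1.ne hx

end

end DegenerateControl

end

open DegenerateControl in
theorem mainTheorem2 (T : ℝ) (hT : 0 < T) (a : ℝ → ℝ) (ha : IsDegenerateCoefficient a)
    (ω : Set ℝ) (hω : ω ⊆ Ioo (-1) 1) (hω_ne : ω.Nonempty) (hω_meas : MeasurableSet ω)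
    (α m M : ℝ) (hα : 0 < α) (hmM : m < M)
    (y₀ yd : L2Omega) (hy₀ : MemLp y₀ ∞ muOmega) (hyd : MemLp yd ∞ muOmega) :
    -- the objects of the problem are well defined
    (∀ ρ ∈ Wa T a, ∃ r, IsContinuousRep ρ r) ∧
    (∀ v : Control T ω, IsWeakSolution v y₀ (stateMap a y₀ v) ∧
      ∀ y : L2H1a T a, IsWeakSolution v y₀ y → y = stateMap a y₀ v) ∧
    -- optimality conditions
    ∀ u ∈ admissible T ω m M,
      DifferentiableAt ℝ (cost a α y₀ yd) u ∧
      (IsLinftyLocalMin a α m M y₀ yd u →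
        ∀ v ∈ admissible T ω m M, 0 ≤ fderiv ℝ (cost a α y₀ yd) u (v - u)) ∧
      ∃ (y q : L2H1a T a) (Y Q : Lp ℝ ∞ (muQ T)),
        IsLinftyRep y Y ∧ IsLinftyRep q Q ∧
        IsWeakSolution u y₀ y ∧
        IsBackwardWeakSolution u (valueAt y T - yd) q ∧
        (∀ w : Control T ω, fderiv ℝ (cost a α y₀ yd) u w =
          ∫ z in Ioo 0 T ×ˢ ω, (α * u z + Y z * Q z) * w z) ∧
        ((∀ v ∈ admissible T ω m M, 0 ≤ fderiv ℝ (cost a α y₀ yd) u (v - u)) ↔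
          ∀ v ∈ admissible T ω m M,
            0 ≤ ∫ z in Ioo 0 T ×ˢ ω, (α * u z + Y z * Q z) * (v z - u z)) ∧
        ((∀ v ∈ admissible T ω m M,
            0 ≤ ∫ z in Ioo 0 T ×ˢ ω, (α * u z + Y z * Q z) * (v z - u z)) ↔
          ∀ᵐ z ∂muControl T ω, u z = min (max m (-(Q z / α) * Y z)) M) ∧
        (IsLinftyLocalMin a α m M y₀ yd u →
          (∀ v ∈ admissible T ω m M,
            0 ≤ ∫ z in Ioo 0 T ×ˢ ω, (α * u z + Y z * Q z) * (v z - u z)) ∧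
          ∀ᵐ z ∂muControl T ω, u z = min (max m (-(Q z / α) * Y z)) M) := by
  have := isFiniteMeasure_muControl (T := T) hω
  refine ⟨fun ρ hρ => ?_, fun v => ?_, fun u hu => ?_⟩
  · obtain ⟨g, r, h⟩ := exists_evolves_of_mem_Wa ha hT hρ
    exact ⟨r, h.cont, h.ae_eq⟩
  · have h := isWeakSolution_stateMap ha hω_meas hω hT y₀ v
    exact ⟨h, fun y hy => hy.unique ha hω_meas hω hT h⟩
  -- the state and the adjoint state, with their bounded representatives
  have hyw := isWeakSolution_stateMap ha hω_meas hω hT y₀ u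
  obtain ⟨r, hr, hr0⟩ := hyw.exists_solves ha hω_meas hω hT
  set y := stateMap a y₀ u with hy
  have hyT : valueAt y T = r T := hr.evolves.valueAt_eq ha hT (right_mem_Icc.2 hT.le)
  obtain ⟨κ, hκ, hκ0⟩ := exists_ae_abs_le_of_memLp_top hy₀
  have hrb : ∀ t ∈ Icc 0 T, ∀ᵐ x ∂muOmega, |r t x| ≤ κ * Real.exp (‖u‖ * T) := fun t ht =>
    hr.ae_abs_le hω_meas ha (θ := id) (Filter.Eventually.of_forall fun _ => rfl) hκ
      (by rwa [hr0]) ht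
  obtain ⟨q, s, hq, hsT, hsb⟩ := exists_solvesBackward ha hω_meas hT u (r T - yd)
  obtain ⟨κ', hκ', hκd⟩ := exists_ae_abs_le_of_memLp_top hyd
  have hsb' := hsb (κ * Real.exp (‖u‖ * T) + κ') (by positivity) (by
    filter_upwards [hrb T (right_mem_Icc.2 hT.le), hκd, Lp.coeFn_sub (r T) yd] with x h1 h2 h3
    rw [h3, Pi.sub_apply]
    exact (abs_sub _ _).trans (add_le_add h1 h2))
  obtain ⟨Y, hY⟩ := exists_linfty_rep hT.le hr.evolves.cont hrb
  obtain ⟨Q, hQ⟩ := exists_linfty_rep hT.le hq.cont hsb'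
  have hJ := hasFDerivAt_cost hω_meas hω ha hT α hr hr0 hq hsT hY hQ
  have hd := hJ.differentiableAt
  have hform : ∀ w : Control T ω, fderiv ℝ (cost a α y₀ yd) u w =
      ∫ z in Ioo 0 T ×ˢ ω, (α * u z + Y z * Q z) * w z := fun w => by
    rw [hJ.fderiv, pairing_apply]
  have h12 : (∀ v ∈ admissible T ω m M, 0 ≤ fderiv ℝ (cost a α y₀ yd) u (v - u)) ↔
      ∀ v ∈ admissible T ω m M,
        0 ≤ ∫ z in Ioo 0 T ×ˢ ω, (α * u z + Y z * Q z) * (v z - u z) := by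
    refine forall₂_congr fun v _ => ?_
    rw [hform]
    have : ∫ z in Ioo 0 T ×ˢ ω, (α * u z + Y z * Q z) * (v - u) z
        = ∫ z in Ioo 0 T ×ˢ ω, (α * u z + Y z * Q z) * (v z - u z) := by
      refine integral_congr_ae ?_
      filter_upwards [Lp.coeFn_sub v u] with z hz
      rw [hz, Pi.sub_apply]
    rw [this]
  have h23 := variational_iff_projection hα hmM.le hu (integrable_gradient hω α u Y Q)
    (p := fun z => -(Q z / α) * Y z)
    (((memLp_top_muControl hω Q).1.aemeasurable.div_const α).neg.mul
      (memLp_top_muControl hω Y).1.aemeasurable).aestronglyMeasurable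
    (Filter.Eventually.of_forall fun z => by field_simp; ring)
  have hmin : IsLinftyLocalMin a α m M y₀ yd u → ∀ v ∈ admissible T ω m M,
      0 ≤ fderiv ℝ (cost a α y₀ yd) u (v - u) := fun h v hv => h.fderiv_nonneg hd hv
  refine ⟨hd, hmin, y, q, Y, Q, ?_, ?_, hyw, ?_, hform, h12, h23, fun h => ?_⟩
  · filter_upwards [hY, hr.evolves.ae_eq] with t h1 h2
    have h3 : toL2 (y t) = r t := h2.symm
    rw [h3]; exact h1
  · filter_upwards [hQ, hq.ae_eq] with t h1 h2
    have h3 : toL2 (q t) = s t := h2.symm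
    rw [h3]; exact h1
  · rw [hyT, ← hsT]
    exact hq.isBackwardWeakSolution ha hω_meas hω hT
  · have h2 := h12.1 (hmin h)
    exact ⟨h2, h23.1 h2⟩
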